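/- Throughout let $n\ge 1$. **(1)** Let $X$ be a Calabi–Yau manifold of complex dimension $n$, i.e. a smooth Riemannian manifold of real dimension $2n$ with a parallel orthogonal complex structure $J$ and a parallel form $\Phi$ of type $(n,0)$ normalized so that $\operatorname{Re}\Phi$ has comass $1$. Let $f:L\to X$ be an oriented Lagrangian submanifold: $L$ is an oriented $n$-manifold with the induced metric, $f$ is an immersion of class $C^2$ (for instance the inclusion of a smooth embedded submanifold), and the form $\langle J\cdot,\cdot\rangle$ vanishes on $L$. Then there is a unique function $\theta:L\to\mathbb R/2\pi\mathbb Z$ (the phase) with $\Phi|_L=e^{i\theta}\,d\mathrm{vol}_L$. Locally $\theta$ has $C^1$ real-valued representatives, and for every vector $V$ tangent to $L$ $$V\theta=\langle JV,H\rangle,\qquad\text{that is}\qquad \nabla\theta=-JH ,$$ where $H$ is the mean curvature vector of $L$, the trace of its second fundamental form $B(V,W)=(\nabla_VW)^{\rm normal}$. **(2)** In particular, let $\Omega\subset\mathbb R^n$ be open and let $G:\Omega\to\mathbb R^n$ be a $C^2$ map whose graph $L\subset\mathbb R^n\oplus i\mathbb R^n=\mathbb C^n$ is Lagrangian; orient $L$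 by $x_1,\dots,x_n$. Then there is a unique $\theta:L\to\mathbb R/2\pi\mathbb Z$ with $dz_1\wedge\cdots\wedge dz_n|_L=e^{i\theta}\,d\mathrm{vol}_L$, and $\nabla\theta=-JH$ on $L$. **(3)** Let $\Omega\subset\mathbb R^n$ be open, $u\in C^2(\Omega)$, and let $L=\{x+i\nabla u(x):x\in\Omega\}\subset\mathbb C^n$, oriented by $x_1,\dots,x_n$. Then $L$ is a Lagrangian ($C^1$-immersed) submanifold, and the function $\theta(x)=\operatorname{tr}\{\arctan D^2_xu\}$, considered on $L$, is (mod $2\pi$) the phase of $L$: $dz_1\wedge\cdots\wedge dz_n|_L=e^{i\theta}\,d\mathrm{vol}_L$. At every point where $D^2u$ is differentiable (so that the second fundamental form of $L$ exists), $\theta$ is differentiable and $\nabla\theta=-JH$. Suppose moreover that $u$ solves $$\operatorname{tr}\{\arctan D^2_xu\}=\psi(x)\quad\text{on }\Omega$$ with $\psi\in C^1(\Omega)$, and let $\widetilde\psi$ be the pull-back of $\psi$ to $L$. Then $$\nabla\widetilde\psi=-JH\qquad\text{on } L .$$ This holds with the classical mean curvature vector $H$ at every point where $D^2u$ is differentiable;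 and, without any further regularity of $u$, it holds on all of $L$ with the mean curvature vector of the $C^1$ submanifold $L$ defined by the first variation of volume: a continuous vector field $H$ along $L$ satisfies $\int_L \operatorname{div}_LY\,d\mathrm{vol}_L=-\int_L\langle H,Y\rangle\,d\mathrm{vol}_L$ for all smooth compactly supported $\mathbb C^n$-valued fields $Y$ along $L$ (i.e. $Y\in C_c^\infty(\Omega,\mathbb C^n)$, where $\operatorname{div}_LY=g^{ij}\langle\partial_iY,\partial_jf\rangle$ for the graph map $f(x)=x+i\nabla u(x)$ and its induced metric $g$) if and only if $\nabla\widetilde\psi=-JH$ at every point of $L$. -/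

import Mathlib

open scoped Manifold ContDiff Topology Bundle RealInnerProductSpace

/-! ### Riemannian geometry of a manifold `X` in its preferred charts

`X` is a manifold modelled on a finite-dimensional real vector space `E`.  Recall that
`TangentSpace 𝓘(ℝ, E) p` is a copy of `E`, a tangent vector at `p` being identified with its
components in the preferred chart `extChartAt 𝓘(ℝ, E) p`. -/

section Riemannian

variable {E : Type*} [NormedAddCommGroup E] [NormedSpace ℝ E]
  {X : Type*} [TopologicalSpace X] [ChartedSpace E X]

instance tangentSpace_finiteDimensional [FiniteDimensional ℝ E] (p : X) :
    FiniteDimensional ℝ (TangentSpace 𝓘(ℝ, E) p) :=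
  inferInstanceAs (FiniteDimensional ℝ E)

/-- The components of a tangent vector at `p` in the preferred chart at `p`. -/
noncomputable def tangentCoords (p : X) : TangentSpace 𝓘(ℝ, E) p ≃L[ℝ] E :=
  ContinuousLinearEquiv.refl ℝ E

/-- The coordinate vector field of the chart at `p` with constant component `a`, at the point
with coordinate `x`. -/
noncomputable def coordField (p : X) (a x : E) :
    TangentSpace 𝓘(ℝ, E) ((extChartAt 𝓘(ℝ, E) p).symm x) :=
  mfderiv 𝓘(ℝ, E) 𝓘(ℝ, E) (extChartAt 𝓘(ℝ, E) p).symm x a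

/-- A covariant `k`-tensor, evaluated on the coordinate vector fields of the chart at `p`. -/
noncomputable def tensorInChart {k : ℕ} {W : Type*}
    (T : ∀ x : X, (Fin k → TangentSpace 𝓘(ℝ, E) x) → W) (p : X) (a : Fin k → E) (x : E) : W :=
  T ((extChartAt 𝓘(ℝ, E) p).symm x) (fun i => coordField p (a i) x)

/-- The tensor field `T` has smooth components. -/
def IsSmoothTensor {k : ℕ} {W : Type*} [NormedAddCommGroup W] [NormedSpace ℝ W]
    (T : ∀ x : X, (Fin k → TangentSpace 𝓘(ℝ, E) x) → W) : Prop :=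
  ∀ (p : X) (a : Fin k → E), ContDiffAt ℝ ∞ (tensorInChart T p a) (extChartAt 𝓘(ℝ, E) p p)

variable [Bundle.RiemannianBundle (fun x : X => TangentSpace 𝓘(ℝ, E) x)]

/-- The components `g(∂_a, ∂_b)` of the metric in the chart at `p`. -/
noncomputable def metricInChart (p : X) (a b x : E) : ℝ :=
  inner ℝ (coordField p a x) (coordField p b x)

/-- The Christoffel symbols of the first kind at `p`:
`g(∇_a ∂_b, ∂_c) = (∂_a g(∂_b, ∂_c) + ∂_b g(∂_a, ∂_c) - ∂_c g(∂_a, ∂_b)) / 2`. -/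
noncomputable def christoffelForm (p : X) (a b c : E) : ℝ :=
  (fderiv ℝ (metricInChart p b c) (extChartAt 𝓘(ℝ, E) p p) a
    + fderiv ℝ (metricInChart p a c) (extChartAt 𝓘(ℝ, E) p p) b
    - fderiv ℝ (metricInChart p a b) (extChartAt 𝓘(ℝ, E) p p) c) / 2

variable [FiniteDimensional ℝ E]

/-- The Levi-Civita derivative `∇_a ∂_b` at `p` of the coordinate vector field with constant
component `b` of the chart at `p`: the tangent vector at `p` whose inner product with each `c` is
`christoffelForm p a b c`, expanded in an orthonormal basis. -/
noncomputable def christoffel (p : X) (a b : TangentSpace 𝓘(ℝ, E) p) :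
    TangentSpace 𝓘(ℝ, E) p :=
  ∑ i, christoffelForm p (tangentCoords p a) (tangentCoords p b)
      (tangentCoords p (stdOrthonormalBasis ℝ (TangentSpace 𝓘(ℝ, E) p) i)) •
    stdOrthonormalBasis ℝ (TangentSpace 𝓘(ℝ, E) p) i

/-- `∇ T = 0` for a smooth covariant `k`-tensor `T`, in coordinates:
`∂_c (T(∂_{a 1}, …, ∂_{a k})) = ∑ i, T(∂_{a 1}, …, ∇_c ∂_{a i}, …, ∂_{a k})` at every point `p`,
in the chart at `p`. -/
def IsParallelTensor {k : ℕ} {W : Type*} [NormedAddCommGroup W] [NormedSpace ℝ W]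
    (T : ∀ x : X, (Fin k → TangentSpace 𝓘(ℝ, E) x) → W) : Prop :=
  ∀ (p : X) (a : Fin k → TangentSpace 𝓘(ℝ, E) p) (c : TangentSpace 𝓘(ℝ, E) p),
    fderiv ℝ (tensorInChart T p (fun i => tangentCoords p (a i))) (extChartAt 𝓘(ℝ, E) p p)
        (tangentCoords p c)
      = ∑ i, T p (Function.update a i (christoffel p c (a i)))

end Riemannian

/-! ### Calabi-Yau manifolds -/

/-- A Calabi-Yau manifold of complex dimension `n`: a Riemannian manifold of real dimension `2n`
with a parallel orthogonal complex structure `J` (a Kähler manifold; the parallelism is expressed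
by the Kähler form `⟪J v, w⟫`) and a parallel form `Φ` of type `(n, 0)`, normalized so that
`Re Φ` has comass one. -/
structure CalabiYau (n : ℕ) (E : Type*) [NormedAddCommGroup E] [NormedSpace ℝ E]
    [FiniteDimensional ℝ E] (X : Type*) [TopologicalSpace X] [ChartedSpace E X]
    [Bundle.RiemannianBundle (fun x : X => TangentSpace 𝓘(ℝ, E) x)] where
  finrank_eq : Module.finrank ℝ E = 2 * n
  /-- The complex structure on the tangent spaces. -/
  J : ∀ x : X, TangentSpace 𝓘(ℝ, E) x →ₗ[ℝ] TangentSpace 𝓘(ℝ, E) x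
  J_sq : ∀ x v, J x (J x v) = -v
  J_orthogonal : ∀ x v w, inner ℝ (J x v) (J x w) = inner ℝ v w
  kahler_smooth : IsSmoothTensor (k := 2) (W := ℝ) (fun x v => inner ℝ (J x (v 0)) (v 1))
  kahler_parallel : IsParallelTensor (k := 2) (W := ℝ) (fun x v => inner ℝ (J x (v 0)) (v 1))
  /-- The holomorphic volume form. -/
  Φ : ∀ x : X, (TangentSpace 𝓘(ℝ, E) x) [⋀^Fin n]→ₗ[ℝ] ℂ
  Φ_type : ∀ x v i, Φ x (Function.update v i (J x (v i))) = Complex.I * Φ x v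
  Φ_smooth : IsSmoothTensor (fun x => ⇑(Φ x))
  Φ_parallel : IsParallelTensor (fun x => ⇑(Φ x))
  Φ_comass : ∀ x, IsLUB {r : ℝ | ∃ v : Fin n → TangentSpace 𝓘(ℝ, E) x,
    Orthonormal ℝ v ∧ r = (Φ x v).re} 1

/-! ### Immersed submanifolds

`L` is an `n`-dimensional manifold and `f : L → X` is an immersion; all metric notions on `L` are
those of the metric induced by `f`, written in the preferred chart of `L` at a point. -/

/-- An orientation of a manifold: an orientation of every tangent space which is locally constant
in the local trivializations of the tangent bundle. -/
def IsContinuousOrientation {n : ℕ} {L : Type*} [TopologicalSpace L]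
    [ChartedSpace (EuclideanSpace ℝ (Fin n)) L] [IsManifold (𝓡 n) 1 L]
    (o : ∀ p : L, Orientation ℝ (TangentSpace (𝓡 n) p) (Fin n)) : Prop :=
  ∀ p : L, ∀ᶠ q in 𝓝 p,
    ∃ (hq : q ∈ (trivializationAt (EuclideanSpace ℝ (Fin n)) (TangentSpace (𝓡 n)) p).baseSet)
      (hp : p ∈ (trivializationAt (EuclideanSpace ℝ (Fin n)) (TangentSpace (𝓡 n)) p).baseSet),
    Orientation.map (Fin n)
      ((trivializationAt (EuclideanSpace ℝ (Fin n)) (TangentSpace (𝓡 n)) p).continuousLinearEquivAt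
        ℝ q hq).toLinearEquiv (o q) =
    Orientation.map (Fin n)
      ((trivializationAt (EuclideanSpace ℝ (Fin n)) (TangentSpace (𝓡 n)) p).continuousLinearEquivAt
        ℝ p hp).toLinearEquiv (o p)

/-- The coordinate basis of the tangent space in the preferred chart. -/
noncomputable def coordBasis {n : ℕ} {L : Type*} [TopologicalSpace L]
    [ChartedSpace (EuclideanSpace ℝ (Fin n)) L] (p : L) (i : Fin n) : TangentSpace (𝓡 n) p :=
  (tangentCoords p).symm (EuclideanSpace.single i (1 : ℝ))

section Submanifold

variable {n : ℕ} {L : Type*} [TopologicalSpace L] [ChartedSpace (EuclideanSpace ℝ (Fin n)) L]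
  {E : Type*} [NormedAddCommGroup E] [NormedSpace ℝ E]
  {X : Type*} [TopologicalSpace X] [ChartedSpace E X]
  [Bundle.RiemannianBundle (fun x : X => TangentSpace 𝓘(ℝ, E) x)]

/-- The differential of `f : L → X` at `p`. -/
noncomputable abbrev dmap (f : L → X) (p : L) :
    TangentSpace (𝓡 n) p →L[ℝ] TangentSpace 𝓘(ℝ, E) (f p) :=
  mfderiv (𝓡 n) 𝓘(ℝ, E) f p

/-- The Gram matrix of tangent vectors `v i` of `L` in the induced metric. -/
noncomputable def gram (f : L → X) (p : L) (v : Fin n → TangentSpace (𝓡 n) p) :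
    Matrix (Fin n) (Fin n) ℝ :=
  Matrix.of fun i j =>
    inner ℝ (dmap (E := E) f p (v i)) (dmap (E := E) f p (v j))

/-- The inverse `g^{ij}` of the matrix of the induced metric in the chart at `p`. -/
noncomputable def inverseMetric (f : L → X) (p : L) : Matrix (Fin n) (Fin n) ℝ :=
  (gram (E := E) f p (coordBasis p))⁻¹

/-- The value `dvol_L (v 1, …, v n)` of the oriented volume form of the induced metric: the square
root of the Gram determinant, with sign `1` if `v` is a positively oriented basis and `-1` if it is
a negatively oriented one. -/
noncomputable def inducedVolume (f : L → X)
    (o : ∀ p : L, Orientation ℝ (TangentSpace (𝓡 n) p) (Fin n)) (p : L)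
    (v : Fin n → TangentSpace (𝓡 n) p) : ℝ :=
  (SignType.sign ((o p).someVector v) : ℝ) * √((gram (E := E) f p v).det)

/-- `f` is Lagrangian: the form `⟪J v, w⟫` pulls back to zero (on the `n`-manifold `L`). -/
def IsLagrangian (J : ∀ x : X, TangentSpace 𝓘(ℝ, E) x →ₗ[ℝ] TangentSpace 𝓘(ℝ, E) x)
    (f : L → X) : Prop :=
  ∀ (p : L) (v w : TangentSpace (𝓡 n) p),
    inner ℝ (J (f p) (dmap (E := E) f p v)) (dmap (E := E) f p w) = 0

/-- `θ : L → ℝ / 2πℤ` is the phase of `L`: `Φ|_L = e^{iθ} dvol_L`. -/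
def IsPhase (Φ : ∀ x : X, (Fin n → TangentSpace 𝓘(ℝ, E) x) → ℂ) (f : L → X)
    (o : ∀ p : L, Orientation ℝ (TangentSpace (𝓡 n) p) (Fin n)) (θ : L → Real.Angle) : Prop :=
  ∀ (p : L) (v : Fin n → TangentSpace (𝓡 n) p),
    Φ (f p) (fun i => dmap (E := E) f p (v i)) =
      ((θ p).toCircle : ℂ) * (inducedVolume (E := E) f o p v : ℂ)

/-- `ϑ` is a real-valued representative, near `p`, of the function `θ` with values mod `2π`. -/
def IsLocalLift (θ : L → Real.Angle) (p : L) (ϑ : L → ℝ) : Prop :=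
  ∀ᶠ q in 𝓝 p, (ϑ q : Real.Angle) = θ q

/-- The derivative `V ϑ` of a real function on `L` along the tangent vector `V` at `p`. -/
noncomputable def dirDeriv (ϑ : L → ℝ) (p : L) (V : TangentSpace (𝓡 n) p) : ℝ :=
  mfderiv (𝓡 n) 𝓘(ℝ, ℝ) ϑ p V

/-- The gradient `g^{ij} ∂_j ϑ ∂_i` of a real function on `L` for the induced metric, viewed as a
tangent vector of `X` through the differential of `f`. -/
noncomputable def inducedGradient (f : L → X) (ϑ : L → ℝ) (p : L) :
    TangentSpace 𝓘(ℝ, E) (f p) :=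
  ∑ i : Fin n, ∑ j : Fin n,
    (inverseMetric (E := E) f p i j * dirDeriv (n := n) ϑ p (coordBasis p j)) •
      dmap (E := E) f p (coordBasis p i)

variable [FiniteDimensional ℝ E]

/-- The covariant derivative `∇_a (df(∂_b))` at `p`, along `f`, of the image of the coordinate
vector field with component `b`, in the charts at `p` and `f p`:
`∂_a ∂_b F + Γ(∂_a F, ∂_b F)`, where `F` is the coordinate expression of `f`. -/
noncomputable def covHessian (f : L → X) (p : L) (a b : TangentSpace (𝓡 n) p) :
    TangentSpace 𝓘(ℝ, E) (f p) :=
  (tangentCoords (f p)).symm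
      (fderiv ℝ (fderiv ℝ (writtenInExtChartAt (𝓡 n) 𝓘(ℝ, E) p f)) (extChartAt (𝓡 n) p p)
        (tangentCoords p a) (tangentCoords p b)) + christoffel (f p) (dmap (E := E) f p a) (dmap (E := E) f p b)

/-- The second fundamental form `B(a, b) = (∇_a b)^{normal}`. -/
noncomputable def secondFundamentalForm (f : L → X) (p : L) (a b : TangentSpace (𝓡 n) p) :
    TangentSpace 𝓘(ℝ, E) (f p) :=
  (LinearMap.range (dmap (n := n) (E := E) f p).toLinearMap)ᗮ.starProjection (covHessian f p a b)

/-- The mean curvature vector: the trace `g^{ij} B(∂_i, ∂_j)` of the second fundamental form. -/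
noncomputable def meanCurvature (f : L → X) (p : L) : TangentSpace 𝓘(ℝ, E) (f p) :=
  ∑ i : Fin n, ∑ j : Fin n, inverseMetric (E := E) f p i j •
    secondFundamentalForm f p (coordBasis p i) (coordBasis p j)

/-- `∇θ = -JH` at `p`, for `θ` with values mod `2π`: near `p`, `θ` has a continuously differentiable
real-valued representative, and every representative `ϑ` differentiable at `p` satisfies
`V ϑ = ⟪J V, H⟫` for all vectors `V` tangent to `L` at `p`, and `∇ϑ = -JH`. -/
def PhaseGradientFormula (J : ∀ x : X, TangentSpace 𝓘(ℝ, E) x →ₗ[ℝ] TangentSpace 𝓘(ℝ, E) x)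
    (f : L → X) (θ : L → Real.Angle) (p : L) : Prop :=
  (∃ ϑ : L → ℝ, ContMDiffAt (𝓡 n) 𝓘(ℝ, ℝ) 1 ϑ p ∧ IsLocalLift θ p ϑ) ∧
  ∀ ϑ : L → ℝ, MDifferentiableAt (𝓡 n) 𝓘(ℝ, ℝ) ϑ p → IsLocalLift θ p ϑ →
    (∀ V : TangentSpace (𝓡 n) p, dirDeriv ϑ p V =
      inner ℝ (J (f p) (dmap (E := E) f p V)) (meanCurvature (n := n) (E := E) f p)) ∧
    inducedGradient (n := n) (E := E) f ϑ p
      = -(J (f p) (meanCurvature (n := n) (E := E) f p))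

end Submanifold

/-! ### Graphs in `ℂⁿ = ℝⁿ ⊕ iℝⁿ` -/

/-- `ℂⁿ`, written as `ℝⁿ ⊕ iℝⁿ` with its Euclidean metric. -/
abbrev CSpace (n : ℕ) : Type :=
  WithLp 2 (EuclideanSpace ℝ (Fin n) × EuclideanSpace ℝ (Fin n))

/-- Multiplication by `i` on `ℂⁿ`: `J (x, y) = (-y, x)`. -/
noncomputable def flatJ (n : ℕ) (z : CSpace n) :
    TangentSpace 𝓘(ℝ, CSpace n) z →ₗ[ℝ] TangentSpace 𝓘(ℝ, CSpace n) z :=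
  (tangentCoords z).symm.toLinearMap ∘ₗ
    { toFun := fun w : CSpace n => (WithLp.toLp 2 (-w.snd, w.fst) : CSpace n)
      map_add' := fun v w => by
        apply (WithLp.ofLp_injective 2); ext <;> simp [add_comm]
      map_smul' := fun c w => by
        apply (WithLp.ofLp_injective 2); ext <;> simp } ∘ₗ
    (tangentCoords z).toLinearMap

/-- The form `dz = dz_1 ∧ ⋯ ∧ dz_n` on `ℂⁿ`: `dz (w 1, …, w n) = det (z_j (w i))`. -/
noncomputable def flatDz (n : ℕ) (z : CSpace n) (w : Fin n → TangentSpace 𝓘(ℝ, CSpace n) z) : ℂ :=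
  (Matrix.of fun i j : Fin n =>
    (((tangentCoords z (w i)).fst j : ℝ) : ℂ)
      + Complex.I * (((tangentCoords z (w i)).snd j : ℝ) : ℂ)).det

/-- The graph map `x ↦ (x, G x)` of `G` over an open set `Ω`. -/
noncomputable def graphMap {n : ℕ} (Ω : TopologicalSpace.Opens (EuclideanSpace ℝ (Fin n)))
    (G : EuclideanSpace ℝ (Fin n) → EuclideanSpace ℝ (Fin n)) (x : Ω) : CSpace n :=
  WithLp.toLp 2 ((x : EuclideanSpace ℝ (Fin n)), G x)

/-- The orientation of an open subset of `ℝⁿ` by `x_1, …, x_n`. -/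
noncomputable def stdOrientation {n : ℕ} (Ω : TopologicalSpace.Opens (EuclideanSpace ℝ (Fin n)))
    (p : Ω) : Orientation ℝ (TangentSpace (𝓡 n) p) (Fin n) :=
  Orientation.map (Fin n) (tangentCoords p).symm.toLinearEquiv
    (EuclideanSpace.basisFun (Fin n) ℝ).toBasis.orientation

/-- The Hessian matrix `D²u` at `x`. -/
noncomputable def hessianMatrix {n : ℕ} (u : EuclideanSpace ℝ (Fin n) → ℝ)
    (x : EuclideanSpace ℝ (Fin n)) : Matrix (Fin n) (Fin n) ℝ :=
  Matrix.of fun i j =>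
    fderiv ℝ (fderiv ℝ u) x (EuclideanSpace.single i 1) (EuclideanSpace.single j 1)

/-- The special Lagrangian potential operator `tr (arctan D²u)` (with `arctan` of a symmetric
matrix given by the functional calculus). -/
noncomputable def trArctan {n : ℕ} (u : EuclideanSpace ℝ (Fin n) → ℝ)
    (x : EuclideanSpace ℝ (Fin n)) : ℝ :=
  (cfc Real.arctan (hessianMatrix u x)).trace

/-- `H` is the mean curvature vector of the `C¹` immersion `f : Ω → ℂⁿ` in the sense of the first
variation of volume: `∫_L div_L Y = - ∫_L ⟪H, Y⟫` for every smooth variation field `Y` with compact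
support in `Ω`, where `div_L Y = g^{ij} ⟪∂_i Y, ∂_j f⟫` and `dvol_L = √(det g) dx`. -/
def IsWeakMeanCurvature {n : ℕ} {Ω : TopologicalSpace.Opens (EuclideanSpace ℝ (Fin n))}
    (f : Ω → CSpace n) (H : Ω → CSpace n) : Prop :=
  ∀ Y : EuclideanSpace ℝ (Fin n) → CSpace n, ContDiff ℝ ∞ Y → HasCompactSupport Y →
    tsupport Y ⊆ Ω →
    ∫ p : Ω, (∑ i : Fin n, ∑ j : Fin n, inverseMetric (E := CSpace n) f p i j *
        inner ℝ (fderiv ℝ Y p (EuclideanSpace.single i 1))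
          (tangentCoords (f p) (dmap (n := n) (E := CSpace n) f p (coordBasis p j)))) *
        √((gram (n := n) (E := CSpace n) f p (coordBasis p)).det)
        ∂(MeasureTheory.volume.comap Subtype.val)
      = - ∫ p : Ω, inner ℝ (H p) (Y p) *
          √((gram (n := n) (E := CSpace n) f p (coordBasis p)).det)
          ∂(MeasureTheory.volume.comap Subtype.val)

/-!
# The phase and the mean curvature of a Lagrangian submanifold

*Existence of the phase.* A form `Φ` of type `(n, 0)` is complex multilinear for the complex
structure `J`, and a Lagrangian frame is a complex basis of the tangent space of `X`. Together with
Hadamard's inequality this shows that comass one means `|Φ| = 1` on orthonormal Lagrangian frames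
(`norm_map_eq_sqrt_det_gram`); hence `Φ|_L = e^{iθ} dvol_L` with a unique `θ`
(`existsUnique_isPhase`).

*Its gradient.* Let `Ψ = Φ(∂₁ f, …, ∂ₙ f)`. As `Φ` is parallel, `V Ψ = ∑ᵢ Φ(…, ∇_V ∂ᵢ f, …)`
(`hasFDerivAt_pullbackInChart`), and by complex multilinearity this is `(r + iα) Ψ`, where `r` is
real and `α = g^{ij} ⟪∇_V ∂ᵢ f, J ∂ⱼ f⟫` (`sum_map_update_eq`). Differentiating
`⟪J ∂ᵢ f, ∂ⱼ f⟫ = 0` with `J` parallel, and using that `∇` is torsion free, one finds that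
`⟪∇_V ∂ᵢ f, J ∂ⱼ f⟫` is symmetric in all three vectors (`inner_covHessian_symm`,
`covHessian_symm`), so that `α = ⟪J V, H⟫`. Since `Ψ e^{-iθ}` is real up to a constant sign,
`V θ = α` (`dirDeriv_phase_eq`). Both sides of `∇θ = -JH` are tangent to `L`, so the vector
equation follows (`inducedGradient_eq_of_dirDeriv`). The proof works at a single point where `f` is
twice differentiable, which is what a gradient graph of a `C²` function may provide.

*Graphs in `ℂⁿ`.* The flat structure `flatCalabiYau` reduces graphs to the general case. For the
graph of `∇u` the tangent frame has complex coordinates `1 + i D²u`, whose determinant has argument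
`tr arctan D²u` (`det_onePlusI`). The identity
`tr arctan A = ∫₀¹ tr (A (1 + t² A²)⁻¹) dt` shows that this function is continuous, and so it
differs by a constant from any local real-valued representative of the phase.

*Weak mean curvature.* Let `M = 1 + i D²u` be the Jacobian matrix of `F = x + i ∇u`, so that
`g = M M*` and `det M = e^{iψ} √(det g)`. Hence `div_L Y dvol_L = Re (e^{-iψ} tr (adj M · DY)) dx`
(`sum_inverseMetric_mul_inner`). The cofactor fields of a `C¹` map are divergence free in the sense
of distributions (`integral_trace_adjugate_mul`, the Piola identity, by smoothing `F`); applied to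
the compactly supported `C¹` field `e^{-iψ} Y` it gives
`∫ div_L Y dvol_L = -∫ ⟪J ∇ψ, Y⟫ dvol_L`. Thus `J ∇ψ` is a weak mean curvature vector, and by the
fundamental lemma of the calculus of variations it is the only continuous one
(`isWeakMeanCurvature_iff_eq`).
-/


/-! ### Linear algebra of Lagrangian frames -/

open scoped ComplexOrder in
/-- **Hadamard's inequality** for rows of norm one. The eigenvalues `λ` of `Z Zᴴ` have sum `n`,
and `λ ≤ exp (λ - 1)`, so that their product is at most `1`. -/
theorem Matrix.norm_det_le_one_of_row_norm {n : ℕ} (Z : Matrix (Fin n) (Fin n) ℂ)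
    (hZ : ∀ i, ∑ j, ‖Z i j‖ ^ 2 = 1) : ‖Z.det‖ ≤ 1 := by
  have hpsd : (Z * Z.conjTranspose).PosSemidef := Matrix.posSemidef_self_mul_conjTranspose Z
  have hH := hpsd.isHermitian
  have htr : ∑ i, hH.eigenvalues i = n := by
    have h1 : (Z * Z.conjTranspose).trace = n := by
      simp only [Matrix.trace, Matrix.diag_apply, Matrix.mul_apply, Matrix.conjTranspose_apply]
      have : ∀ i, ∑ j, Z i j * star (Z i j) = 1 := fun i => by
        have h := congrArg (fun r : ℝ => (r : ℂ)) (hZ i)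
        simpa [Complex.mul_conj, Complex.normSq_eq_norm_sq] using h
      simp only [this, Finset.sum_const, Finset.card_univ, Fintype.card_fin, nsmul_eq_mul, mul_one]
    have h2 := hH.trace_eq_sum_eigenvalues
    rw [h1] at h2
    have h3 := congrArg Complex.re h2
    simpa using h3.symm
  have hdet : ‖Z.det‖ ^ 2 = ∏ i, hH.eigenvalues i := by
    have h2 := hH.det_eq_prod_eigenvalues
    rw [Matrix.det_mul, Matrix.det_conjTranspose, ← starRingEnd_apply, Complex.mul_conj,
      Complex.normSq_eq_norm_sq] at h2
    apply Complex.ofReal_injective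
    rw [h2, Complex.ofReal_prod]
    rfl
  have hle : ∏ i, hH.eigenvalues i ≤ 1 := by
    calc ∏ i, hH.eigenvalues i ≤ ∏ i, Real.exp (hH.eigenvalues i - 1) :=
          Finset.prod_le_prod (fun i _ => hpsd.eigenvalues_nonneg i)
            (fun i _ => by have := Real.add_one_le_exp (hH.eigenvalues i - 1); linarith)
      _ = 1 := by rw [← Real.exp_sum]; simp [htr]
  rw [← hdet] at hle
  exact (sq_le_one_iff₀ (norm_nonneg _)).mp hle

section LagrangianFrame

variable {n : ℕ} {T : Type*} [NormedAddCommGroup T] [InnerProductSpace ℝ T]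
  {J : T →ₗ[ℝ] T}

/-- The vector `∑ j, z j • b j` of the complex vector space `(T, J)`. -/
noncomputable def complexCombination (J : T →ₗ[ℝ] T) (b : Fin n → T) (z : Fin n → ℂ) : T :=
  ∑ j, ((z j).re • b j + (z j).im • J (b j))

theorem complexCombination_add (b : Fin n → T) (z w : Fin n → ℂ) :
    complexCombination J b (z + w) = complexCombination J b z + complexCombination J b w := by
  simp only [complexCombination, ← Finset.sum_add_distrib]
  refine Finset.sum_congr rfl fun j _ => ?_
  simp only [Pi.add_apply, Complex.add_re, Complex.add_im]
  module

theorem complexCombination_smul (hJ : ∀ v, J (J v) = -v) (b : Fin n → T) (c : ℂ)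
    (z : Fin n → ℂ) :
    complexCombination J b (c • z) =
      c.re • complexCombination J b z + c.im • J (complexCombination J b z) := by
  simp only [complexCombination, map_sum, map_add, map_smul, hJ, Finset.smul_sum,
    ← Finset.sum_add_distrib]
  refine Finset.sum_congr rfl fun j _ => ?_
  simp only [Pi.smul_apply, smul_eq_mul, Complex.mul_re, Complex.mul_im]
  module

theorem complexCombination_single (b : Fin n → T) (i : Fin n) :
    complexCombination J b (Pi.single i 1) = b i := by
  rw [complexCombination, Finset.sum_eq_single i]
  · simp
  · intro j _ hj
    simp [hj]
  · simp

/-- A real alternating form of type `(n, 0)` is complex multilinear for the complex structure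
`J`; composed with `z ↦ ∑ j, z j • b j` it is an alternating form on `ℂⁿ`. -/
noncomputable def complexifiedForm (hJ : ∀ v, J (J v) = -v) (Φ : T [⋀^Fin n]→ₗ[ℝ] ℂ)
    (hΦ : ∀ v i, Φ (Function.update v i (J (v i))) = Complex.I * Φ v) (b : Fin n → T) :
    (Fin n → ℂ) [⋀^Fin n]→ₗ[ℂ] ℂ where
  toFun z := Φ (fun i => complexCombination J b (z i))
  map_update_add' z i x y := by
    have key : ∀ w : Fin n → ℂ, (fun j => complexCombination J b (Function.update z i w j)) =
        Function.update (fun j => complexCombination J b (z j)) i (complexCombination J b w) := by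
      intro w
      funext j
      by_cases h : j = i
      · subst h; simp
      · simp [h]
    have := Subsingleton.elim ‹DecidableEq (Fin n)› (instDecidableEqFin n)
    subst this
    simp only [key, complexCombination_add, AlternatingMap.map_update_add]
  map_update_smul' z i c x := by
    have key : ∀ w : Fin n → ℂ, (fun j => complexCombination J b (Function.update z i w j)) =
        Function.update (fun j => complexCombination J b (z j)) i (complexCombination J b w) := by
      intro w
      funext j
      by_cases h : j = i
      · subst h; simp
      · simp [h]
    have := Subsingleton.elim ‹DecidableEq (Fin n)› (instDecidableEqFin n)
    subst this
    have h2 := hΦ (Function.update (fun j => complexCombination J b (z j)) i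
      (complexCombination J b x)) i
    simp only [Function.update_self, Function.update_idem] at h2
    simp only [key, complexCombination_smul hJ, AlternatingMap.map_update_add,
      AlternatingMap.map_update_smul, h2]
    conv_rhs => rw [← Complex.re_add_im c]
    simp only [smul_eq_mul, Complex.real_smul]
    ring
  map_eq_zero_of_eq' z i j hij hne := by
    refine Φ.map_eq_zero_of_eq _ ?_ hne
    simp only [hij]

/-- On a frame with complex coefficient matrix `Z` with respect to `b`, a form of type `(n, 0)` is
`det Z` times its value on `b`. -/
theorem map_complexCombination_eq_det (hJ : ∀ v, J (J v) = -v) (Φ : T [⋀^Fin n]→ₗ[ℝ] ℂ)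
    (hΦ : ∀ v i, Φ (Function.update v i (J (v i))) = Complex.I * Φ v) (b : Fin n → T)
    (Z : Matrix (Fin n) (Fin n) ℂ) :
    Φ (fun i => complexCombination J b (Z i)) = Z.det * Φ b := by
  have h := congrArg (fun g => g (fun i => Z i))
    (AlternatingMap.eq_smul_basis_det (Pi.basisFun ℂ (Fin n)) (complexifiedForm hJ Φ hΦ b))
  have h1 : complexifiedForm hJ Φ hΦ b (Pi.basisFun ℂ (Fin n)) = Φ b := by
    change Φ (fun i => complexCombination J b (Pi.basisFun ℂ (Fin n) i)) = Φ b
    congr 1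
    funext i
    rw [Pi.basisFun_apply, complexCombination_single]
  simp only [h1, AlternatingMap.smul_apply, Pi.basisFun_det, smul_eq_mul] at h
  rw [mul_comm]
  exact h

variable (hJ : ∀ v, J (J v) = -v) (hJo : ∀ v w, ⟪J v, J w⟫ = ⟪v, w⟫)
include hJ hJo

theorem inner_complexStructure_left (v w : T) : ⟪J v, w⟫ = -⟪v, J w⟫ := by
  rw [← hJo v (J w), hJ, inner_neg_right, neg_neg]

omit hJo in
/-- A Lagrangian frame is a basis of `(T, J)` over `ℂ`, because its span is orthogonal to the
`J`-image of its span and both have half the dimension. -/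
theorem exists_eq_complexCombination [FiniteDimensional ℝ T]
    (hdim : Module.finrank ℝ T = 2 * n) {e : Fin n → T}
    (he : LinearIndependent ℝ e) (hL : ∀ i j, ⟪J (e i), e j⟫ = 0) (w : T) :
    ∃ z : Fin n → ℂ, w = complexCombination J e z := by
  have hli : LinearIndependent ℝ (Sum.elim e (fun i => J (e i))) := by
    have hJi : Function.Injective J := fun a b hab => by
      have := congrArg J hab
      rw [hJ, hJ] at this
      exact neg_injective this
    have he' : LinearIndependent ℝ (fun i => J (e i)) :=
      he.map' J (LinearMap.ker_eq_bot.mpr hJi)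
    refine he.sum_type he' ?_
    have hle : Submodule.span ℝ (Set.range e) ⟂ Submodule.span ℝ (Set.range fun i => J (e i)) := by
      rw [Submodule.isOrtho_span]
      rintro _ ⟨i, rfl⟩ _ ⟨j, rfl⟩
      rw [real_inner_comm]
      exact hL j i
    exact hle.disjoint
  have hspan : Submodule.span ℝ (Set.range (Sum.elim e (fun i => J (e i)))) = ⊤ :=
    hli.span_eq_top_of_card_eq_finrank' (by simp [hdim]; ring)
  have hw : w ∈ Submodule.span ℝ (Set.range (Sum.elim e (fun i => J (e i)))) := by
    rw [hspan]; trivial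
  obtain ⟨c, hc⟩ := (Submodule.mem_span_range_iff_exists_fun ℝ).mp hw
  refine ⟨fun j => ⟨c (Sum.inl j), c (Sum.inr j)⟩, ?_⟩
  rw [← hc, Fintype.sum_sum_type, complexCombination, Finset.sum_add_distrib]
  rfl

omit hJ in
/-- The coefficients along the vectors `J (e j)` are found from the inner products with them. -/
theorem complexCombination_im_eq {e : Fin n → T} (he : LinearIndependent ℝ e)
    (hL : ∀ i j, ⟪J (e i), e j⟫ = 0) (z : Fin n → ℂ) (i : Fin n) :
    (z i).im = ∑ k, (Matrix.gram ℝ e)⁻¹ i k * ⟪complexCombination J e z, J (e k)⟫ := by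
  have hG : IsUnit (Matrix.gram ℝ e).det :=
    (Matrix.posDef_gram_of_linearIndependent he).det_pos.ne'.isUnit
  have h1 : ∀ k, ⟪complexCombination J e z, J (e k)⟫ =
      ((Matrix.gram ℝ e).mulVec (fun j => (z j).im)) k := by
    intro k
    rw [complexCombination, sum_inner, Matrix.mulVec, dotProduct]
    refine Finset.sum_congr rfl fun j _ => ?_
    rw [inner_add_left, inner_smul_left, inner_smul_left, hJo, real_inner_comm _ (e j), hL,
      Matrix.gram_apply, real_inner_comm]
    simp [mul_comm]
  simp only [h1]
  change _ = ((Matrix.gram ℝ e)⁻¹.mulVec _) i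
  rw [Matrix.mulVec_mulVec, Matrix.nonsing_inv_mul _ hG, Matrix.one_mulVec]

/-- The derivation property of a form of type `(n, 0)` on a Lagrangian frame: its infinitesimal
rotation is the trace of the components normal to the frame. -/
theorem sum_map_update_eq [FiniteDimensional ℝ T]
    (hdim : Module.finrank ℝ T = 2 * n) {e : Fin n → T}
    (he : LinearIndependent ℝ e) (hL : ∀ i j, ⟪J (e i), e j⟫ = 0) (Φ : T [⋀^Fin n]→ₗ[ℝ] ℂ)
    (hΦ : ∀ v i, Φ (Function.update v i (J (v i))) = Complex.I * Φ v) (w : Fin n → T) :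
    ∃ r : ℝ, ∑ i, Φ (Function.update e i (w i)) =
      (r + Complex.I * ((∑ i, ∑ k, (Matrix.gram ℝ e)⁻¹ i k * ⟪w i, J (e k)⟫ : ℝ) : ℂ)) * Φ e := by
  choose z hz using fun i => exists_eq_complexCombination hJ hdim he hL (w i)
  refine ⟨∑ i, (z i i).re, ?_⟩
  have h1 : ∀ i, Φ (Function.update e i (w i)) = z i i * Φ e := by
    intro i
    have hu : Function.update e i (w i) =
        fun j => complexCombination J e ((1 : Matrix (Fin n) (Fin n) ℂ).updateRow i (z i) j) := by
      funext j
      by_cases h : j = i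
      · subst h; simp [hz]
      · simp only [Function.update_of_ne h, Matrix.updateRow_ne h]
        rw [show (1 : Matrix (Fin n) (Fin n) ℂ) j = Pi.single j 1 from ?_,
          complexCombination_single]
        funext k
        simp [Matrix.one_apply, Pi.single_apply, eq_comm]
    rw [hu, map_complexCombination_eq_det hJ Φ hΦ e]
    congr 1
    have hrow : z i = ∑ k, z i k • (1 : Matrix (Fin n) (Fin n) ℂ) k := by
      funext j
      simp [Matrix.one_apply]
    rw [hrow, Matrix.det_updateRow_sum]
    simp [Matrix.one_apply]
  have h2 : ∀ i, z i i = ((z i i).re : ℂ) + Complex.I *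
      ((∑ k, (Matrix.gram ℝ e)⁻¹ i k * ⟪w i, J (e k)⟫ : ℝ) : ℂ) := by
    intro i
    rw [hz i, ← complexCombination_im_eq hJo he hL (z i) i, mul_comm, Complex.re_add_im]
  simp only [h1]
  rw [← Finset.sum_mul]
  congr 1
  push_cast
  rw [Finset.mul_sum, ← Finset.sum_add_distrib]
  refine Finset.sum_congr rfl fun i _ => ?_
  conv_lhs => rw [h2 i]
  push_cast
  rfl

/-- A form of type `(n, 0)` and comass one has modulus one on orthonormal Lagrangian frames. -/
theorem norm_map_orthonormal_eq_one [FiniteDimensional ℝ T] (hn : 1 ≤ n)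
    (hdim : Module.finrank ℝ T = 2 * n) (Φ : T [⋀^Fin n]→ₗ[ℝ] ℂ)
    (hΦ : ∀ v i, Φ (Function.update v i (J (v i))) = Complex.I * Φ v)
    (hcomass : IsLUB {r : ℝ | ∃ v : Fin n → T, Orthonormal ℝ v ∧ r = (Φ v).re} 1)
    {b : Fin n → T} (hb : Orthonormal ℝ b) (hL : ∀ i j, ⟪J (b i), b j⟫ = 0) :
    ‖Φ b‖ = 1 := by
  have hin : ∀ z : Fin n → ℂ, ⟪complexCombination J b z, complexCombination J b z⟫ =
      ∑ j, ‖z j‖ ^ 2 := by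
    intro z
    have hbb := orthonormal_iff_ite.mp hb
    have hL' : ∀ i j, ⟪b i, J (b j)⟫ = 0 := fun i j => by rw [real_inner_comm]; exact hL j i
    simp only [complexCombination, sum_inner, inner_sum, inner_add_left, inner_add_right,
      inner_smul_left, inner_smul_right, hJo, hbb, hL, hL']
    simp only [← Complex.normSq_eq_norm_sq, Complex.normSq_apply]
    simp
  apply le_antisymm
  · -- rotate the first vector so that the value of the form becomes `‖Φ b‖`
    by_cases h0 : Φ b = 0
    · rw [h0]; simp
    let i0 : Fin n := ⟨0, hn⟩
    let c : ℂ := (‖Φ b‖ : ℂ) / Φ b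
    have hc : ‖c‖ = 1 := by
      simp [c, h0]
    let d : Fin n → ℂ := Function.update 1 i0 c
    have hd : ∀ i, ‖d i‖ = 1 := by
      intro i
      by_cases h : i = i0
      · subst h; simp [d, hc]
      · simp [d, h]
    have hval := map_complexCombination_eq_det hJ Φ hΦ b (Matrix.diagonal d)
    have hdet : (Matrix.diagonal d).det = c := by
      rw [Matrix.det_diagonal, Finset.prod_eq_single i0]
      · simp [d]
      · intro j _ hj; simp [d, hj]
      · simp
    rw [hdet, div_mul_cancel₀ _ h0] at hval
    refine hcomass.1 ⟨fun i => complexCombination J b (Matrix.diagonal d i), ?_, by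
      rw [hval]; simp⟩
    have hv : ∀ i, complexCombination J b (Matrix.diagonal d i) =
        (d i).re • b i + (d i).im • J (b i) := by
      intro i
      rw [complexCombination, Finset.sum_eq_single i]
      · simp
      · intro j _ hj; simp [Matrix.diagonal_apply_ne d hj.symm]
      · simp
    have hbb := orthonormal_iff_ite.mp hb
    have hL' : ∀ i j, ⟪b i, J (b j)⟫ = 0 := fun i j => by rw [real_inner_comm]; exact hL j i
    rw [orthonormal_iff_ite]
    intro i j
    simp only [hv, inner_add_left, inner_add_right, inner_smul_left, inner_smul_right, hJo, hbb,
      hL, hL']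
    by_cases h : i = j
    · subst h
      have h3 := hd i
      have h4 : (d i).re * (d i).re + (d i).im * (d i).im = 1 := by
        rw [← Complex.normSq_apply, Complex.normSq_eq_norm_sq, h3]; norm_num
      simpa using h4
    · simp [h]
  · -- by Hadamard's inequality `‖Φ b‖` bounds `Φ` on all orthonormal frames
    refine hcomass.2 ?_
    rintro r ⟨v, hv, rfl⟩
    choose z hz using fun i =>
      exists_eq_complexCombination hJ hdim hb.linearIndependent hL (v i)
    have h1 : Φ v = Matrix.det (Matrix.of z) * Φ b := by
      rw [← map_complexCombination_eq_det hJ Φ hΦ b]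
      congr 1
      funext i
      exact hz i
    have h2 : ‖Matrix.det (Matrix.of z)‖ ≤ 1 := by
      refine Matrix.norm_det_le_one_of_row_norm _ fun i => ?_
      have h3 := hin (z i)
      rw [← hz i, real_inner_self_eq_norm_sq, hv.1 i] at h3
      simpa using h3.symm
    calc (Φ v).re ≤ ‖Φ v‖ := Complex.re_le_norm _
      _ ≤ ‖Φ b‖ := by
        rw [h1, norm_mul]
        exact mul_le_of_le_one_left (norm_nonneg _) h2

/-- A form of type `(n, 0)` and comass one restricts to a Lagrangian subspace as a volume form up
to a phase. -/
theorem norm_map_eq_sqrt_det_gram [FiniteDimensional ℝ T] (hn : 1 ≤ n)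
    (hdim : Module.finrank ℝ T = 2 * n) (Φ : T [⋀^Fin n]→ₗ[ℝ] ℂ)
    (hΦ : ∀ v i, Φ (Function.update v i (J (v i))) = Complex.I * Φ v)
    (hcomass : IsLUB {r : ℝ | ∃ v : Fin n → T, Orthonormal ℝ v ∧ r = (Φ v).re} 1)
    {e : Fin n → T} (he : LinearIndependent ℝ e) (hL : ∀ i j, ⟪J (e i), e j⟫ = 0) :
    ‖Φ e‖ = √((Matrix.gram ℝ e).det) := by
  have hfr : Module.finrank ℝ (Submodule.span ℝ (Set.range e)) = n := by
    rw [finrank_span_eq_card he, Fintype.card_fin]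
  let B := (stdOrthonormalBasis ℝ (Submodule.span ℝ (Set.range e))).reindex (finCongr hfr)
  let b : Fin n → T := fun i => B i
  have hb : Orthonormal ℝ b := B.orthonormal.comp_linearIsometry
    (Submodule.span ℝ (Set.range e)).subtypeₗᵢ
  have hLs : ∀ x ∈ Submodule.span ℝ (Set.range e), ∀ y ∈ Submodule.span ℝ (Set.range e),
      ⟪J x, y⟫ = 0 := by
    intro x hx y hy
    obtain ⟨c, rfl⟩ := (Submodule.mem_span_range_iff_exists_fun ℝ).mp hx
    obtain ⟨d, rfl⟩ := (Submodule.mem_span_range_iff_exists_fun ℝ).mp hy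
    simp [sum_inner, inner_sum, inner_smul_left, inner_smul_right, hL]
  have hLb : ∀ i j, ⟪J (b i), b j⟫ = 0 := fun i j => hLs _ (B i).2 _ (B j).2
  let P : Matrix (Fin n) (Fin n) ℝ := Matrix.of fun i j => ⟪e i, b j⟫
  have heP : ∀ i, e i = ∑ j, P i j • b j := by
    intro i
    have h := congrArg Subtype.val
      (B.sum_repr' ⟨e i, Submodule.subset_span ⟨i, rfl⟩⟩)
    simp only [Submodule.coe_sum, Submodule.coe_smul, Submodule.coe_inner] at h
    rw [← h]
    refine Finset.sum_congr rfl fun j _ => ?_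
    simp only [P, Matrix.of_apply, b]
    rw [real_inner_comm]
  have hgram : Matrix.gram ℝ e = P * P.transpose := by
    ext i j
    rw [Matrix.gram_apply, heP i, heP j, Matrix.mul_apply]
    simp [sum_inner, inner_sum, inner_smul_left, inner_smul_right, orthonormal_iff_ite.mp hb,
      mul_comm]
  have hΦe : Φ e = (P.map (fun r : ℝ => (r : ℂ))).det * Φ b := by
    rw [← map_complexCombination_eq_det hJ Φ hΦ b]
    congr 1
    funext i
    rw [heP i, complexCombination]
    simp
  have hcast : (P.map (fun r : ℝ => (r : ℂ))).det = ((P.det : ℝ) : ℂ) :=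
    (RingHom.map_det Complex.ofRealHom P).symm
  rw [hΦe, norm_mul, norm_map_orthonormal_eq_one hJ hJo hn hdim Φ hΦ hcomass hb hLb, mul_one,
    hgram, Matrix.det_mul, Matrix.det_transpose, Real.sqrt_mul_self_eq_abs, hcast,
    Complex.norm_real, Real.norm_eq_abs]

end LagrangianFrame

/-! ### Differentiating a multilinear map depending on a point -/

section MultilinearFamily

variable {k : ℕ} {V E F W : Type*} [NormedAddCommGroup V] [NormedSpace ℝ V]
  [NormedAddCommGroup E] [NormedSpace ℝ E] [FiniteDimensional ℝ E]
  [NormedAddCommGroup F] [NormedSpace ℝ F] [NormedAddCommGroup W] [NormedSpace ℝ W]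

theorem MultilinearMap.eq_sum_finBasis (m : MultilinearMap ℝ (fun _ : Fin k => E) W)
    (a : Fin k → E) :
    m a = ∑ r : Fin k → Fin (Module.finrank ℝ E),
      (∏ i, (Module.finBasis ℝ E).coord (r i) (a i)) •
        m (fun i => Module.finBasis ℝ E (r i)) := by
  conv_lhs => rw [show a = fun i => ∑ j, (Module.finBasis ℝ E).coord j (a i) •
    Module.finBasis ℝ E j from funext fun i => ((Module.finBasis ℝ E).sum_repr (a i)).symm]
  rw [MultilinearMap.map_sum]
  exact Finset.sum_congr rfl fun r _ => m.map_smul_univ _ _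

/-- The coordinate functionals as continuous linear maps. -/
noncomputable def finBasisCoordL (E : Type*) [NormedAddCommGroup E] [NormedSpace ℝ E]
    [FiniteDimensional ℝ E] (j : Fin (Module.finrank ℝ E)) : E →L[ℝ] ℝ :=
  ((Module.finBasis ℝ E).coord j).toContinuousLinearMap

theorem ContDiffAt.multilinearFamily {m : WithTop ℕ∞}
    {M : F → MultilinearMap ℝ (fun _ : Fin k => E) W} {y : V → F} {a : Fin k → V → E} {x₀ : V}
    (hM : ∀ b, ContDiffAt ℝ m (fun z => M z b) (y x₀)) (hy : ContDiffAt ℝ m y x₀)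
    (ha : ∀ i, ContDiffAt ℝ m (a i) x₀) :
    ContDiffAt ℝ m (fun x => M (y x) (fun i => a i x)) x₀ := by
  have h : (fun x => M (y x) (fun i => a i x)) = fun x =>
      ∑ r : Fin k → Fin (Module.finrank ℝ E), (∏ i, finBasisCoordL E (r i) (a i x)) •
        M (y x) (fun i => Module.finBasis ℝ E (r i)) := by
    funext x
    exact (M (y x)).eq_sum_finBasis _
  rw [h]
  refine ContDiffAt.sum fun r _ => ContDiffAt.smul ?_ ?_
  · exact contDiffAt_prod fun i _ => (finBasisCoordL E (r i)).contDiff.contDiffAt.comp x₀ (ha i)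
  · exact (hM _).comp x₀ hy

/-- The product rule for `x ↦ M (y x) (a x)`, where `M z` is a multilinear map on a
finite-dimensional space, depending on `z` through differentiable values. -/
theorem HasFDerivAt.multilinearFamily
    {M : F → MultilinearMap ℝ (fun _ : Fin k => E) W} {y : V → F} {a : Fin k → V → E} {x₀ : V}
    {y' : V →L[ℝ] F} {a' : Fin k → V →L[ℝ] E}
    (hM : ∀ b, DifferentiableAt ℝ (fun z => M z b) (y x₀)) (hy : HasFDerivAt y y' x₀)
    (ha : ∀ i, HasFDerivAt (a i) (a' i) x₀) :
    ∃ D : V →L[ℝ] W, HasFDerivAt (fun x => M (y x) (fun i => a i x)) D x₀ ∧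
      ∀ v, D v = fderiv ℝ (fun z => M z (fun i => a i x₀)) (y x₀) (y' v) +
        ∑ i, M (y x₀) (Function.update (fun i => a i x₀) i (a' i v)) := by
  let c := finBasisCoordL E
  let b : (Fin k → Fin (Module.finrank ℝ E)) → Fin k → E := fun r i => Module.finBasis ℝ E (r i)
  have hexp : ∀ (z : F) (u : Fin k → E), M z u = ∑ r : Fin k → Fin (Module.finrank ℝ E),
      (∏ i, c (r i) (u i)) • M z (b r) := fun z u => (M z).eq_sum_finBasis u
  have h : (fun x => M (y x) (fun i => a i x)) = fun x =>
      ∑ r : Fin k → Fin (Module.finrank ℝ E), (∏ i, c (r i) (a i x)) • M (y x) (b r) := by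
    funext x
    exact hexp _ _
  have hc : ∀ (r : Fin k → Fin (Module.finrank ℝ E)) i,
      HasFDerivAt (fun x => c (r i) (a i x)) ((c (r i)).comp (a' i)) x₀ :=
    fun r i => (c (r i)).hasFDerivAt.comp x₀ (ha i)
  have hm : ∀ r, HasFDerivAt (fun x => M (y x) (b r))
      ((fderiv ℝ (fun z => M z (b r)) (y x₀)).comp y') x₀ :=
    fun r => (hM (b r)).hasFDerivAt.comp x₀ hy
  have hp := fun r : Fin k → Fin (Module.finrank ℝ E) =>
    HasFDerivAt.finsetProd (u := Finset.univ) (fun i _ => hc r i)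
  have hsum := HasFDerivAt.fun_sum (u := Finset.univ) fun r _ => (hp r).smul (hm r)
  refine ⟨_, by rw [h]; exact hsum, fun v => ?_⟩
  have h1 : fderiv ℝ (fun z => M z (fun i => a i x₀)) (y x₀) (y' v) =
      ∑ r : Fin k → Fin (Module.finrank ℝ E), (∏ i, c (r i) (a i x₀)) •
        fderiv ℝ (fun z => M z (b r)) (y x₀) (y' v) := by
    have : (fun z => M z (fun i => a i x₀)) = fun z =>
        ∑ r : Fin k → Fin (Module.finrank ℝ E), (∏ i, c (r i) (a i x₀)) • M z (b r) := by
      funext z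
      exact hexp _ _
    rw [this, (HasFDerivAt.fun_sum (u := Finset.univ)
      fun r _ => (hM (b r)).hasFDerivAt.fun_const_smul (∏ i, c (r i) (a i x₀))).fderiv]
    simp
  have h2 : ∀ i, M (y x₀) (Function.update (fun i => a i x₀) i (a' i v)) =
      ∑ r : Fin k → Fin (Module.finrank ℝ E),
        ((∏ j ∈ Finset.univ.erase i, c (r j) (a j x₀)) * c (r i) (a' i v)) •
          M (y x₀) (b r) := by
    intro i
    rw [hexp]
    refine Finset.sum_congr rfl fun r _ => ?_
    rw [← Finset.prod_erase_mul _ _ (Finset.mem_univ i)]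
    congr 2
    · refine Finset.prod_congr rfl fun j hj => ?_
      rw [Function.update_of_ne (Finset.ne_of_mem_erase hj)]
    · rw [Function.update_self]
  rw [h1, Finset.sum_congr rfl fun i _ => h2 i, Finset.sum_comm, ← Finset.sum_add_distrib]
  simp only [sum_apply]
  refine Finset.sum_congr rfl fun r _ => ?_
  simp [Finset.sum_smul]

end MultilinearFamily

/-! ### Pulling back tensors in the preferred charts -/

section PullbackInCharts

variable {E : Type*} [NormedAddCommGroup E] [NormedSpace ℝ E]
  {X : Type*} [TopologicalSpace X] [ChartedSpace E X]

/-- The component map of a covariant tensor in the chart at `p`, as a multilinear map. -/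
noncomputable def tensorInChartMultilinear {k : ℕ} {W : Type*} [NormedAddCommGroup W]
    [NormedSpace ℝ W] (T : ∀ x : X, MultilinearMap ℝ (fun _ : Fin k => TangentSpace 𝓘(ℝ, E) x) W)
    (p : X) (x : E) : MultilinearMap ℝ (fun _ : Fin k => E) W :=
  (T ((extChartAt 𝓘(ℝ, E) p).symm x)).compLinearMap fun _ =>
    (mfderiv 𝓘(ℝ, E) 𝓘(ℝ, E) (extChartAt 𝓘(ℝ, E) p).symm x).toLinearMap

/-- A tensor depends on a tangent vector only through its base point and its components. -/
theorem tensor_congr {k : ℕ} {W : Type*} (T : ∀ x : X, (Fin k → TangentSpace 𝓘(ℝ, E) x) → W)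
    {z z' : X} (h : z = z') (v : Fin k → TangentSpace 𝓘(ℝ, E) z)
    (v' : Fin k → TangentSpace 𝓘(ℝ, E) z')
    (hv : ∀ i, tangentCoords z (v i) = tangentCoords z' (v' i)) : T z v = T z' v' := by
  subst h
  congr 1
  funext i
  exact (tangentCoords z).injective (hv i)

variable [IsManifold 𝓘(ℝ, E) 1 X]

theorem mdifferentiableAt_extChartAt_symm' (p : X) {x : E}
    (hx : x ∈ (extChartAt 𝓘(ℝ, E) p).target) :
    MDifferentiableAt 𝓘(ℝ, E) 𝓘(ℝ, E) (extChartAt 𝓘(ℝ, E) p).symm x := by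
  have h := mdifferentiableWithinAt_extChartAt_symm (I := 𝓘(ℝ, E)) hx
  simpa [mdifferentiableWithinAt_univ] using h

theorem tangentCoords_coordField_self (p : X) (a : E) :
    tangentCoords _ (coordField p a (extChartAt 𝓘(ℝ, E) p p)) = a := by
  have h := mfderivWithin_range_extChartAt_symm (I := 𝓘(ℝ, E)) (x := p)
  have h2 : mfderiv 𝓘(ℝ, E) 𝓘(ℝ, E) (extChartAt 𝓘(ℝ, E) p).symm (extChartAt 𝓘(ℝ, E) p p) =
      mfderivWithin 𝓘(ℝ, E) 𝓘(ℝ, E) (extChartAt 𝓘(ℝ, E) p).symm (Set.range 𝓘(ℝ, E))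
        (extChartAt 𝓘(ℝ, E) p p) := by
    rw [modelWithCornersSelf_coe, Set.range_id, mfderivWithin_univ]
  change mfderiv 𝓘(ℝ, E) 𝓘(ℝ, E) (extChartAt 𝓘(ℝ, E) p).symm (extChartAt 𝓘(ℝ, E) p p) a = a
  rw [h2, h]
  rfl

/-- At the centre of the chart the components of a tensor are its values. -/
theorem tensorInChart_self {k : ℕ} {W : Type*}
    (T : ∀ x : X, (Fin k → TangentSpace 𝓘(ℝ, E) x) → W) (p : X)
    (a : Fin k → TangentSpace 𝓘(ℝ, E) p) :
    tensorInChart T p (fun i => tangentCoords p (a i)) (extChartAt 𝓘(ℝ, E) p p) = T p a := by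
  refine tensor_congr T (extChartAt_to_inv p) _ _ fun i => ?_
  rw [tangentCoords_coordField_self]

variable {E' : Type*} [NormedAddCommGroup E'] [NormedSpace ℝ E']
  {L : Type*} [TopologicalSpace L] [ChartedSpace E' L]

omit [IsManifold 𝓘(ℝ, E) 1 X] in
theorem tangentCoords_mfderiv (f : L → X) {p : L} (hf : MDifferentiableAt 𝓘(ℝ, E') 𝓘(ℝ, E) f p)
    (a : TangentSpace 𝓘(ℝ, E') p) :
    tangentCoords (f p) (mfderiv 𝓘(ℝ, E') 𝓘(ℝ, E) f p a) =
      fderiv ℝ (writtenInExtChartAt 𝓘(ℝ, E') 𝓘(ℝ, E) p f) (extChartAt 𝓘(ℝ, E') p p)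
        (tangentCoords p a) := by
  have key : ∀ D : E' →L[ℝ] E, HasFDerivWithinAt (writtenInExtChartAt 𝓘(ℝ, E') 𝓘(ℝ, E) p f) D
      (Set.range 𝓘(ℝ, E')) (extChartAt 𝓘(ℝ, E') p p) → ∀ b : E', D b =
        fderiv ℝ (writtenInExtChartAt 𝓘(ℝ, E') 𝓘(ℝ, E) p f) (extChartAt 𝓘(ℝ, E') p p) b := by
    intro D h b
    rw [modelWithCornersSelf_coe, Set.range_id, hasFDerivWithinAt_univ] at h
    rw [h.fderiv]
  exact key _ hf.hasMFDerivAt.2 (tangentCoords p a)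

variable [IsManifold 𝓘(ℝ, E') 1 L]

/-- The chain rule in charts: the image under `df` of a coordinate vector field of `L` is the
combination of the coordinate vector fields of `X` given by the derivative of the coordinate
expression of `f`. -/
theorem tangentCoords_mfderiv_coordField (f : L → X) (p : L) {x : E'}
    (hx : x ∈ (extChartAt 𝓘(ℝ, E') p).target)
    (hf : MDifferentiableAt 𝓘(ℝ, E') 𝓘(ℝ, E) f ((extChartAt 𝓘(ℝ, E') p).symm x))
    (hfx : f ((extChartAt 𝓘(ℝ, E') p).symm x) ∈ (extChartAt 𝓘(ℝ, E) (f p)).source) (a : E') :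
    DifferentiableAt ℝ (writtenInExtChartAt 𝓘(ℝ, E') 𝓘(ℝ, E) p f) x ∧
    tangentCoords _ (mfderiv 𝓘(ℝ, E') 𝓘(ℝ, E) f ((extChartAt 𝓘(ℝ, E') p).symm x)
        (coordField p a x)) =
      tangentCoords _ (coordField (f p)
        (fderiv ℝ (writtenInExtChartAt 𝓘(ℝ, E') 𝓘(ℝ, E) p f) x a)
        (writtenInExtChartAt 𝓘(ℝ, E') 𝓘(ℝ, E) p f x)) := by
  set F := writtenInExtChartAt 𝓘(ℝ, E') 𝓘(ℝ, E) p f with hF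
  have hs := mdifferentiableAt_extChartAt_symm' p hx
  have hfs : MDifferentiableAt 𝓘(ℝ, E') 𝓘(ℝ, E) (f ∘ (extChartAt 𝓘(ℝ, E') p).symm) x :=
    hf.comp x hs
  have hφ : MDifferentiableAt 𝓘(ℝ, E) 𝓘(ℝ, E) (extChartAt 𝓘(ℝ, E) (f p))
      (f ((extChartAt 𝓘(ℝ, E') p).symm x)) :=
    mdifferentiableAt_extChartAt (by rwa [extChartAt_source] at hfx)
  have hFm : MDifferentiableAt 𝓘(ℝ, E') 𝓘(ℝ, E) F x :=
    MDifferentiableAt.comp x hφ hfs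
  have hFx : F x ∈ (extChartAt 𝓘(ℝ, E) (f p)).target :=
    (extChartAt 𝓘(ℝ, E) (f p)).map_source hfx
  have hs' := mdifferentiableAt_extChartAt_symm' (f p) hFx
  refine ⟨hFm.differentiableAt, ?_⟩
  have hev : f ∘ (extChartAt 𝓘(ℝ, E') p).symm =ᶠ[𝓝 x]
      (extChartAt 𝓘(ℝ, E) (f p)).symm ∘ F := by
    have hcont : ContinuousAt (f ∘ (extChartAt 𝓘(ℝ, E') p).symm) x := hfs.continuousAt
    filter_upwards [hcont.preimage_mem_nhds
      ((isOpen_extChartAt_source (I := 𝓘(ℝ, E)) (f p)).mem_nhds hfx)] with z hz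
    exact ((extChartAt 𝓘(ℝ, E) (f p)).left_inv hz).symm
  have h1 := (hf.hasMFDerivAt.comp x hs.hasMFDerivAt)
  have h2 := (hs'.hasMFDerivAt.comp x hFm.hasMFDerivAt).congr_of_eventuallyEq hev
  have h3 := hasMFDerivAt_unique h1 h2
  have h4 := congrArg (fun D : E' →L[ℝ] E => D a) h3
  rw [mfderiv_eq_fderiv] at h4
  exact h4

end PullbackInCharts

/-! ### Derivatives of parallel tensors along an immersion -/

section AlongImmersion

variable {n : ℕ} {E : Type*} [NormedAddCommGroup E] [NormedSpace ℝ E] [FiniteDimensional ℝ E]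
  {X : Type*} [TopologicalSpace X] [ChartedSpace E X] [IsManifold 𝓘(ℝ, E) 1 X]
  [Bundle.RiemannianBundle (fun x : X => TangentSpace 𝓘(ℝ, E) x)]
  {L : Type*} [TopologicalSpace L] [ChartedSpace (EuclideanSpace ℝ (Fin n)) L]
  [IsManifold (𝓡 n) 1 L]

/-- `f` is differentiable near `p` and its coordinate expression is twice differentiable at `p`:
the regularity needed for the second fundamental form at `p`. -/
def TwiceMDifferentiableAt (f : L → X) (p : L) : Prop :=
  (∀ᶠ q in 𝓝 p, MDifferentiableAt (𝓡 n) 𝓘(ℝ, E) f q) ∧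
    DifferentiableAt ℝ (fderiv ℝ (writtenInExtChartAt (𝓡 n) 𝓘(ℝ, E) p f)) (extChartAt (𝓡 n) p p)

/-- The components of the pull-back `f^* T`, evaluated on the constant fields `a i` of the chart
at `p`. -/
noncomputable def pullbackInChart {k : ℕ} {W : Type*}
    (T : ∀ x : X, (Fin k → TangentSpace 𝓘(ℝ, E) x) → W) (f : L → X) (p : L)
    (a : Fin k → EuclideanSpace ℝ (Fin n)) (x : EuclideanSpace ℝ (Fin n)) : W :=
  tensorInChart T (f p)
    (fun i => fderiv ℝ (writtenInExtChartAt (𝓡 n) 𝓘(ℝ, E) p f) x (a i))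
    (writtenInExtChartAt (𝓡 n) 𝓘(ℝ, E) p f x)

omit [FiniteDimensional ℝ E] [Bundle.RiemannianBundle (fun x : X => TangentSpace 𝓘(ℝ, E) x)] in
/-- Near `p` the function `pullbackInChart` is the pull-back evaluated on coordinate fields; at each
point the fields are those of the chart at `p`, not of the preferred chart at that point. -/
theorem eventually_pullbackInChart_eq {f : L → X} {p : L}
    (hf : ∀ᶠ q in 𝓝 p, MDifferentiableAt (𝓡 n) 𝓘(ℝ, E) f q) :
    ∀ᶠ x in 𝓝 (extChartAt (𝓡 n) p p), x ∈ (extChartAt (𝓡 n) p).target ∧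
      DifferentiableAt ℝ (writtenInExtChartAt (𝓡 n) 𝓘(ℝ, E) p f) x ∧
      ∀ {k : ℕ} {W : Type} (T : ∀ x : X, (Fin k → TangentSpace 𝓘(ℝ, E) x) → W)
        (a : Fin k → EuclideanSpace ℝ (Fin n)), pullbackInChart T f p a x =
          T (f ((extChartAt (𝓡 n) p).symm x)) (fun i =>
            dmap (E := E) f ((extChartAt (𝓡 n) p).symm x) (coordField p (a i) x)) := by
  have hc : Filter.Tendsto (extChartAt (𝓡 n) p).symm (𝓝 (extChartAt (𝓡 n) p p)) (𝓝 p) := by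
    have h := continuousAt_extChartAt_symm (I := 𝓡 n) p
    rwa [ContinuousAt, extChartAt_to_inv] at h
  have hcf : ContinuousAt f p := hf.self_of_nhds.continuousAt
  filter_upwards [extChartAt_target_mem_nhds (I := 𝓡 n) p, hc.eventually hf,
    hc.eventually (hcf.preimage_mem_nhds (extChartAt_source_mem_nhds (I := 𝓘(ℝ, E)) (f p)))]
    with x hx hfx hfs
  refine ⟨hx, (tangentCoords_mfderiv_coordField f p hx hfx hfs 0).1, fun T a => ?_⟩
  refine tensor_congr T ((extChartAt 𝓘(ℝ, E) (f p)).left_inv hfs) _ _ fun i => ?_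
  exact (tangentCoords_mfderiv_coordField f p hx hfx hfs (a i)).2.symm

/-- Along an immersion a parallel tensor is differentiated by differentiating each of its arguments
covariantly. -/
theorem hasFDerivAt_pullbackInChart {f : L → X} {p : L}
    (hf : TwiceMDifferentiableAt (n := n) (E := E) f p)
    {k : ℕ} {W : Type*} [NormedAddCommGroup W] [NormedSpace ℝ W]
    (T : ∀ x : X, MultilinearMap ℝ (fun _ : Fin k => TangentSpace 𝓘(ℝ, E) x) W)
    (hT : IsSmoothTensor (fun x => ⇑(T x))) (hT' : IsParallelTensor (fun x => ⇑(T x)))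
    (v : Fin k → TangentSpace (𝓡 n) p) :
    ∃ D : EuclideanSpace ℝ (Fin n) →L[ℝ] W,
      HasFDerivAt (pullbackInChart (fun x => ⇑(T x)) f p (fun i => tangentCoords p (v i))) D
        (extChartAt (𝓡 n) p p) ∧
      ∀ c : TangentSpace (𝓡 n) p, D (tangentCoords p c) =
        ∑ i, T (f p) (Function.update (fun j => dmap (E := E) f p (v j)) i
          (covHessian f p c (v i))) := by
  set F := writtenInExtChartAt (𝓡 n) 𝓘(ℝ, E) p f with hF
  set x₀ := extChartAt (𝓡 n) p p with hx₀
  have hFx : F x₀ = extChartAt 𝓘(ℝ, E) (f p) (f p) := by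
    simp [hF, hx₀, writtenInExtChartAt]
  have hFd : HasFDerivAt F (fderiv ℝ F x₀) x₀ :=
    ((eventually_pullbackInChart_eq (n := n) (E := E) hf.1).self_of_nhds).2.1.hasFDerivAt
  have ha : ∀ i, HasFDerivAt (fun x => fderiv ℝ F x (tangentCoords p (v i)))
      ((fderiv ℝ (fderiv ℝ F) x₀).flip (tangentCoords p (v i))) x₀ := fun i => by
    have h := hf.2.hasFDerivAt.clm_apply (hasFDerivAt_const (tangentCoords p (v i)) x₀)
    rw [ContinuousLinearMap.comp_zero, zero_add] at h
    exact h
  have hM : ∀ b, DifferentiableAt ℝ (fun z => tensorInChartMultilinear T (f p) z b) (F x₀) := by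
    intro b
    rw [hFx]
    exact (hT (f p) b).differentiableAt (by simp)
  have hd : ∀ w, tangentCoords (f p) (dmap (E := E) f p w) = fderiv ℝ F x₀ (tangentCoords p w) :=
    tangentCoords_mfderiv f hf.1.self_of_nhds
  obtain ⟨D, hD, hD'⟩ := HasFDerivAt.multilinearFamily hM hFd ha
  refine ⟨D, hD, fun c => ?_⟩
  have h1 := hT' (f p) (fun j => dmap (E := E) f p (v j)) (dmap (E := E) f p c)
  simp only [hd] at h1
  rw [hD', hFx]
  have h2 : ∀ b : Fin k → TangentSpace 𝓘(ℝ, E) (f p),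
      tensorInChartMultilinear T (f p) (extChartAt 𝓘(ℝ, E) (f p) (f p))
        (fun i => tangentCoords (f p) (b i)) = T (f p) b :=
    fun b => tensorInChart_self (fun x => ⇑(T x)) (f p) b
  have h3 : ∀ i, tensorInChartMultilinear T (f p) (extChartAt 𝓘(ℝ, E) (f p) (f p))
      (Function.update (fun i => fderiv ℝ F x₀ (tangentCoords p (v i))) i
        ((fderiv ℝ (fderiv ℝ F) x₀).flip (tangentCoords p (v i)) (tangentCoords p c))) =
      T (f p) (Function.update (fun j => dmap (E := E) f p (v j)) i
        ((tangentCoords (f p)).symm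
          (fderiv ℝ (fderiv ℝ F) x₀ (tangentCoords p c) (tangentCoords p (v i))))) := by
    intro i
    rw [← h2]
    congr 1
    funext j
    by_cases h : j = i
    · subst h
      simp
    · simp only [Function.update_of_ne h, hd]
  rw [Finset.sum_congr rfl fun i _ => h3 i]
  refine (congrArg₂ (· + ·) h1 rfl).trans ?_
  rw [← Finset.sum_add_distrib]
  refine Finset.sum_congr rfl fun i _ => ?_
  rw [← MultilinearMap.map_update_add, covHessian, add_comm]

omit [IsManifold 𝓘(ℝ, E) 1 X] in
theorem christoffel_symm (q : X) (a b : TangentSpace 𝓘(ℝ, E) q) :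
    christoffel q a b = christoffel q b a := by
  have hm : ∀ u w : E, metricInChart q u w = metricInChart q w u := fun u w => by
    funext x
    exact real_inner_comm _ _
  simp only [christoffel, christoffelForm]
  refine Finset.sum_congr rfl fun i _ => ?_
  rw [hm (tangentCoords q a) (tangentCoords q b)]
  congr 2
  ring

theorem covHessian_symm {f : L → X} {p : L} (hf : TwiceMDifferentiableAt (n := n) (E := E) f p)
    (a b : TangentSpace (𝓡 n) p) :
    covHessian (n := n) (E := E) f p a b = covHessian (n := n) (E := E) f p b a := by
  have h := second_derivative_symmetric_of_eventually
    ((eventually_pullbackInChart_eq (n := n) (E := E) hf.1).mono fun x hx => hx.2.1.hasFDerivAt)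
    hf.2.hasFDerivAt (tangentCoords p a) (tangentCoords p b)
  rw [covHessian, covHessian, h, christoffel_symm]

/-- The `2`-form `⟪J v, w⟫` as a multilinear map. -/
noncomputable def kahlerMultilinear {T : Type*} [NormedAddCommGroup T] [InnerProductSpace ℝ T]
    (J : T →ₗ[ℝ] T) : MultilinearMap ℝ (fun _ : Fin 2 => T) ℝ where
  toFun v := ⟪J (v 0), v 1⟫
  map_update_add' v i x y := by
    fin_cases i <;> simp [inner_add_left, inner_add_right]
  map_update_smul' v i c x := by
    fin_cases i <;> simp [inner_smul_left, inner_smul_right]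

/-- For a Lagrangian immersion the cubic form `⟪∇_c df(a), J df(b)⟫` is symmetric in `a`, `b`:
differentiate the identity `⟪J df(a), df(b)⟫ = 0`. -/
theorem inner_covHessian_symm (C : CalabiYau n E X) {f : L → X} {p : L}
    (hf : TwiceMDifferentiableAt (n := n) (E := E) f p) (hL : IsLagrangian (n := n) C.J f)
    (c a b : TangentSpace (𝓡 n) p) :
    ⟪covHessian (n := n) (E := E) f p c a, C.J (f p) (dmap (E := E) f p b)⟫ =
      ⟪covHessian (n := n) (E := E) f p c b, C.J (f p) (dmap (E := E) f p a)⟫ := by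
  obtain ⟨D, hD, hD'⟩ := hasFDerivAt_pullbackInChart hf (fun x => kahlerMultilinear (C.J x))
    C.kahler_smooth C.kahler_parallel ![a, b]
  have h0 : pullbackInChart (fun x => ⇑(kahlerMultilinear (C.J x))) f p
      (fun i => tangentCoords p (![a, b] i)) =ᶠ[𝓝 (extChartAt (𝓡 n) p p)] fun _ => (0 : ℝ) := by
    filter_upwards [eventually_pullbackInChart_eq (n := n) (E := E) hf.1] with x hx
    rw [hx.2.2]
    exact hL _ _ _
  have hD0 : D = 0 := hD.unique ((hasFDerivAt_const _ _).congr_of_eventuallyEq h0)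
  have h1 := hD' c
  rw [hD0] at h1
  have h2 : (0 : ℝ) = ⟪C.J (f p) (covHessian f p c a), dmap (E := E) f p b⟫ +
      ⟪C.J (f p) (dmap (E := E) f p a), covHessian (n := n) (E := E) f p c b⟫ := by
    simpa [Fin.sum_univ_two, kahlerMultilinear] using h1
  rw [inner_complexStructure_left (C.J_sq (f p)) (C.J_orthogonal (f p)),
    real_inner_comm (covHessian f p c b)] at h2
  linarith

end AlongImmersion

/-! ### Orientations and top-degree forms -/

/-- `someVector` is an arbitrary form representing an orientation, so only its sign is natural. -/
theorem Orientation.sign_someVector_map {n : ℕ} {M N : Type*} [AddCommGroup M] [Module ℝ M]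
    [AddCommGroup N] [Module ℝ N] (e : M ≃ₗ[ℝ] N) (o : Orientation ℝ M (Fin n)) (w : Fin n → N) :
    SignType.sign ((Orientation.map (Fin n) e o).someVector w) =
      SignType.sign (o.someVector (fun i => e.symm (w i))) := by
  have hne : o.someVector.compLinearMap (e.symm : N →ₗ[ℝ] M) ≠ 0 :=
    mt (o.someVector.compLinearEquiv_eq_zero_iff e.symm).mp o.someVector_ne_zero
  have h1 : Orientation.map (Fin n) e o =
      rayOfNeZero ℝ (o.someVector.compLinearMap (e.symm : N →ₗ[ℝ] M)) hne := by
    conv_lhs => rw [← Module.Ray.someVector_ray o]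
    exact Orientation.map_apply (ι := Fin n) e _ o.someVector_ne_zero
  have h2 := Module.Ray.someVector_ray (Orientation.map (Fin n) e o)
  conv_rhs at h2 => rw [h1]
  rw [ray_eq_iff] at h2
  obtain ⟨r, hr, h3⟩ := h2.exists_pos_left (Module.Ray.someVector_ne_zero _) hne
  have h4 := congrArg (fun m => SignType.sign (m w)) h3
  simp only [AlternatingMap.smul_apply, smul_eq_mul, sign_mul, sign_pos hr, one_mul] at h4
  exact h4

theorem AlternatingMap.eq_mul_div_basis {n : ℕ} {M : Type*} [AddCommGroup M] [Module ℝ M]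
    (b : Module.Basis (Fin n) ℝ M) (α : M [⋀^Fin n]→ₗ[ℝ] ℝ) (hα : α ≠ 0)
    (β : M [⋀^Fin n]→ₗ[ℝ] ℂ) (v : Fin n → M) :
    β v = (α v : ℂ) * (β b / (α b : ℂ)) := by
  have hb : (α b : ℂ) ≠ 0 := Complex.ofReal_ne_zero.mpr ((α.map_basis_ne_zero_iff b).mpr hα)
  have h : β = (LinearMap.toSpanSingleton ℝ ℂ (β b / (α b : ℂ))).compAlternatingMap α := by
    refine Module.Basis.ext_alternating b fun i hi => ?_
    let σ : Equiv.Perm (Fin n) := Equiv.ofBijective i (Finite.injective_iff_bijective.1 hi)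
    change β (b ∘ σ) = (α (b ∘ σ)) • (β b / (α b : ℂ))
    rw [AlternatingMap.map_perm, AlternatingMap.map_perm, smul_assoc, Complex.real_smul,
      mul_div_cancel₀ _ hb]
  conv_lhs => rw [h]
  simp

/-! ### The phase of a Lagrangian immersion -/

section Phase

variable {n : ℕ} {E : Type*} [NormedAddCommGroup E] [NormedSpace ℝ E] [FiniteDimensional ℝ E]
  {X : Type*} [TopologicalSpace X] [ChartedSpace E X]
  [Bundle.RiemannianBundle (fun x : X => TangentSpace 𝓘(ℝ, E) x)]
  {L : Type*} [TopologicalSpace L] [ChartedSpace (EuclideanSpace ℝ (Fin n)) L]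

/-- The coordinate basis as a basis of the tangent space. -/
noncomputable def tangentBasis (p : L) : Module.Basis (Fin n) ℝ (TangentSpace (𝓡 n) p) :=
  (EuclideanSpace.basisFun (Fin n) ℝ).toBasis.map (tangentCoords p).symm.toLinearEquiv

theorem tangentBasis_apply (p : L) (i : Fin n) : tangentBasis p i = coordBasis p i := by
  simp [tangentBasis, coordBasis]

theorem coe_tangentBasis (p : L) : ⇑(tangentBasis (n := n) p) = coordBasis p :=
  funext (tangentBasis_apply p)

omit [FiniteDimensional ℝ E] in
theorem gram_eq_matrixGram (f : L → X) (p : L) (v : Fin n → TangentSpace (𝓡 n) p) :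
    gram (E := E) f p v = Matrix.gram ℝ (fun i => dmap (E := E) f p (v i)) := rfl

variable (C : CalabiYau n E X) {f : L → X} {p : L}

theorem norm_form_eq_sqrt_det_gram (hn : 1 ≤ n)
    (hinj : Function.Injective (dmap (n := n) (E := E) f p))
    (hL : IsLagrangian (n := n) C.J f) {v : Fin n → TangentSpace (𝓡 n) p}
    (hv : LinearIndependent ℝ v) :
    ‖C.Φ (f p) (fun i => dmap (E := E) f p (v i))‖ = √((gram (E := E) f p v).det) := by
  rw [gram_eq_matrixGram]
  refine norm_map_eq_sqrt_det_gram (C.J_sq (f p)) (C.J_orthogonal (f p)) hn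
    ?_ (C.Φ (f p)) (C.Φ_type (f p)) (C.Φ_comass (f p)) ?_ fun i j => hL _ _ _
  · exact C.finrank_eq
  · exact hv.map' (dmap (E := E) f p).toLinearMap (LinearMap.ker_eq_bot.mpr hinj)

/-- In degree `n` all forms on `L` are proportional, so that the form `Φ|_L` and the induced volume
are multiples of the form orienting `L`, with coefficients of the same modulus. -/
theorem exists_phaseFactor (hn : 1 ≤ n)
    (hinj : Function.Injective (dmap (n := n) (E := E) f p))
    (hL : IsLagrangian (n := n) C.J f)
    (o : ∀ p : L, Orientation ℝ (TangentSpace (𝓡 n) p) (Fin n)) :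
    ∃ κ : ℂ, κ ≠ 0 ∧ ∀ v : Fin n → TangentSpace (𝓡 n) p,
      C.Φ (f p) (fun i => dmap (E := E) f p (v i)) = ((o p).someVector v : ℂ) * κ ∧
      inducedVolume (E := E) f o p v = (o p).someVector v * ‖κ‖ := by
  let α := (o p).someVector
  let β := (C.Φ (f p)).compLinearMap (dmap (n := n) (E := E) f p).toLinearMap
  have hα : α ≠ 0 := (o p).someVector_ne_zero
  let b := tangentBasis (n := n) p
  have hαb : α b ≠ 0 := (α.map_basis_ne_zero_iff b).mpr hα
  have hβ : ∀ v, β v = (α v : ℂ) * (β b / (α b : ℂ)) := α.eq_mul_div_basis b hα β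
  have hβb : β b ≠ 0 := by
    have h := norm_form_eq_sqrt_det_gram C hn hinj hL b.linearIndependent
    have h2 : 0 < (gram (E := E) f p b).det :=
      (Matrix.posDef_gram_of_linearIndependent (b.linearIndependent.map'
        (dmap (E := E) f p).toLinearMap (LinearMap.ker_eq_bot.mpr hinj))).det_pos
    intro h0
    change ‖β b‖ = _ at h
    rw [h0, norm_zero] at h
    exact (Real.sqrt_pos.mpr h2).ne h
  refine ⟨β b / (α b : ℂ), div_ne_zero hβb (Complex.ofReal_ne_zero.mpr hαb), fun v => ⟨hβ v, ?_⟩⟩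
  change (SignType.sign (α v) : ℝ) * √((gram (E := E) f p v).det) = α v * _
  by_cases h0 : α v = 0
  · simp [h0]
  · have hv : LinearIndependent ℝ v := by
      by_contra hv
      exact h0 (α.map_linearDependent v hv)
    have h1 := norm_form_eq_sqrt_det_gram C hn hinj hL hv
    change ‖β v‖ = _ at h1
    rw [← h1, hβ v, norm_mul, Complex.norm_real, Real.norm_eq_abs, ← mul_assoc, sign_mul_abs]

theorem existsUnique_isPhase (hn : 1 ≤ n)
    (hinj : ∀ p : L, Function.Injective (dmap (n := n) (E := E) f p))
    (hL : IsLagrangian (n := n) C.J f)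
    (o : ∀ p : L, Orientation ℝ (TangentSpace (𝓡 n) p) (Fin n)) :
    ∃! θ : L → Real.Angle, IsPhase (fun x => ⇑(C.Φ x)) f o θ := by
  choose κ hκ hκv using fun p : L => exists_phaseFactor (n := n) C (p := p) hn (hinj p) hL o
  have hiff : ∀ θ : L → Real.Angle, IsPhase (fun x => ⇑(C.Φ x)) f o θ ↔
      ∀ p, κ p = ((θ p).toCircle : ℂ) * (‖κ p‖ : ℂ) := by
    intro θ
    refine forall_congr' fun p => ⟨fun h => ?_, fun h v => ?_⟩
    · have hb : (o p).someVector (tangentBasis (n := n) p) ≠ 0 :=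
        ((o p).someVector.map_basis_ne_zero_iff _).mpr (o p).someVector_ne_zero
      have h1 := h (tangentBasis (n := n) p)
      rw [(hκv p _).2] at h1
      replace h1 := (hκv p (tangentBasis (n := n) p)).1.symm.trans h1
      apply mul_left_cancel₀ (Complex.ofReal_ne_zero.mpr hb)
      rw [h1]
      push_cast
      ring
    · rw [(hκv p v).2]
      refine (hκv p v).1.trans ?_
      conv_lhs => rw [h]
      push_cast
      ring
  refine ⟨fun p => ((κ p).arg : Real.Angle), (hiff _).mpr fun p => ?_, fun θ hθ => ?_⟩
  · rw [Real.Angle.toCircle_coe, Circle.coe_exp, mul_comm, Complex.norm_mul_exp_arg_mul_I]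
  · funext p
    have h := (hiff θ).mp hθ p
    have hn0 : (‖κ p‖ : ℂ) ≠ 0 := Complex.ofReal_ne_zero.mpr (norm_ne_zero_iff.mpr (hκ p))
    have h2 : ((θ p).toCircle : ℂ) = (((κ p).arg : Real.Angle).toCircle : ℂ) := by
      apply mul_right_cancel₀ hn0
      rw [← h, Real.Angle.toCircle_coe, Circle.coe_exp, mul_comm, Complex.norm_mul_exp_arg_mul_I]
    rw [← Real.Angle.arg_toCircle (θ p), h2, Real.Angle.arg_toCircle]

variable [IsManifold 𝓘(ℝ, E) 1 X] [IsManifold (𝓡 n) 1 L]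

/-- The function `Φ(∂₁ f, …, ∂ₙ f)` of the coordinates of `L` in the chart at `p`. -/
noncomputable def coordForm (C : CalabiYau n E X) (f : L → X) (p : L) :
    EuclideanSpace ℝ (Fin n) → ℂ :=
  pullbackInChart (fun x => ⇑(C.Φ x)) f p (fun i => EuclideanSpace.single i 1)

omit [FiniteDimensional ℝ E] [IsManifold 𝓘(ℝ, E) 1 X] [TopologicalSpace X] [ChartedSpace E X]
  [Bundle.RiemannianBundle (fun x : X => TangentSpace 𝓘(ℝ, E) x)] [NormedAddCommGroup E]
  [NormedSpace ℝ E] in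
/-- The constant sections of the local trivialization at `p` are the coordinate fields of the chart
at `p`. -/
theorem trivializationAt_symm_eq_coordField {p : L} {x : EuclideanSpace ℝ (Fin n)}
    (hx : x ∈ (extChartAt (𝓡 n) p).target)
    (hq : (extChartAt (𝓡 n) p).symm x ∈
      (trivializationAt (EuclideanSpace ℝ (Fin n)) (TangentSpace (𝓡 n)) p).baseSet)
    (a : EuclideanSpace ℝ (Fin n)) :
    ((trivializationAt (EuclideanSpace ℝ (Fin n)) (TangentSpace (𝓡 n)) p).continuousLinearEquivAt
      ℝ ((extChartAt (𝓡 n) p).symm x) hq).symm a = coordField p a x := by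
  rw [Bundle.Trivialization.symm_continuousLinearEquivAt_eq]
  have hs : (extChartAt (𝓡 n) p).symm x ∈
      (chartAt (EuclideanSpace ℝ (Fin n)) p).source := by
    rw [← extChartAt_source (𝓡 n)]
    exact (extChartAt (𝓡 n) p).map_target hx
  have h := TangentBundle.symmL_trivializationAt (I := 𝓡 n) hs
  rw [h]
  have h3 : ∀ y, y = x → tangentCoords _ (mfderivWithin 𝓘(ℝ, EuclideanSpace ℝ (Fin n)) (𝓡 n)
      (extChartAt (𝓡 n) p).symm (Set.range (𝓡 n)) y a) = tangentCoords _ (coordField p a x) := by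
    rintro y rfl
    rw [modelWithCornersSelf_coe, Set.range_id, mfderivWithin_univ]
    rfl
  exact (tangentCoords _).injective (h3 _ ((extChartAt (𝓡 n) p).right_inv hx))

/-- Near `p` the phase is `± Ψ / ‖Ψ‖`, where `Ψ = Φ(∂₁ f, …, ∂ₙ f)`, with a constant sign. -/
theorem IsPhase.eventually_coordForm_eq (hn : 1 ≤ n)
    (hf : ∀ᶠ q in 𝓝 p, MDifferentiableAt (𝓡 n) 𝓘(ℝ, E) f q)
    (hinj : ∀ p : L, Function.Injective (dmap (n := n) (E := E) f p))
    (hL : IsLagrangian (n := n) C.J f)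
    {o : ∀ p : L, Orientation ℝ (TangentSpace (𝓡 n) p) (Fin n)} (ho : IsContinuousOrientation o)
    {θ : L → Real.Angle} (hθ : IsPhase (fun x => ⇑(C.Φ x)) f o θ) :
    ∃ s : ℝ, s ≠ 0 ∧ ∀ᶠ x in 𝓝 (extChartAt (𝓡 n) p p),
      coordForm C f p x ≠ 0 ∧ coordForm C f p x =
        ((θ ((extChartAt (𝓡 n) p).symm x)).toCircle : ℂ) * ((s * ‖coordForm C f p x‖ : ℝ) : ℂ) := by
  have hp : p ∈ (trivializationAt (EuclideanSpace ℝ (Fin n)) (TangentSpace (𝓡 n)) p).baseSet :=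
    FiberBundle.mem_baseSet_trivializationAt' p
  let A := fun (q : L) (hq : q ∈ (trivializationAt (EuclideanSpace ℝ (Fin n))
    (TangentSpace (𝓡 n)) p).baseSet) =>
      (trivializationAt (EuclideanSpace ℝ (Fin n)) (TangentSpace (𝓡 n)) p).continuousLinearEquivAt
        ℝ q hq
  let e : Fin n → EuclideanSpace ℝ (Fin n) := fun i => EuclideanSpace.single i 1
  have he : (e : Fin n → EuclideanSpace ℝ (Fin n)) =
      ⇑((EuclideanSpace.basisFun (Fin n) ℝ).toBasis) := by
    funext i
    simp [e]
  have hA : ∀ q hq, LinearIndependent ℝ (fun i => (A q hq).symm (e i)) := fun q hq => by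
    have := (EuclideanSpace.basisFun (Fin n) ℝ).toBasis.linearIndependent
    rw [← he] at this
    exact this.map' (A q hq).symm.toLinearMap (LinearMap.ker_eq_bot.mpr (A q hq).symm.injective)
  have hne : (o p).someVector (fun i => (A p hp).symm (e i)) ≠ 0 := by
    have h : (fun i => (A p hp).symm (e i)) =
        ⇑((EuclideanSpace.basisFun (Fin n) ℝ).toBasis.map (A p hp).symm.toLinearEquiv) := by
      funext i
      rw [Module.Basis.map_apply, ← he]
      rfl
    rw [h]
    exact ((o p).someVector.map_basis_ne_zero_iff _).mpr (o p).someVector_ne_zero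
  refine ⟨(SignType.sign ((o p).someVector fun i => (A p hp).symm (e i)) : ℝ), ?_, ?_⟩
  · rcases lt_or_gt_of_ne hne with h | h
    · rw [sign_neg h]; norm_num
    · rw [sign_pos h]; norm_num
  have hc : Filter.Tendsto (extChartAt (𝓡 n) p).symm (𝓝 (extChartAt (𝓡 n) p p)) (𝓝 p) := by
    have h := continuousAt_extChartAt_symm (I := 𝓡 n) p
    rwa [ContinuousAt, extChartAt_to_inv] at h
  filter_upwards [eventually_pullbackInChart_eq (n := n) (E := E) hf, hc.eventually (ho p)]
    with x hx hox
  obtain ⟨hq, hp', ho'⟩ := hox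
  have hform : coordForm C f p x = C.Φ (f ((extChartAt (𝓡 n) p).symm x)) (fun i =>
      dmap (E := E) f ((extChartAt (𝓡 n) p).symm x) ((A _ hq).symm (e i))) := by
    rw [coordForm, hx.2.2]
    congr 1
    funext i
    rw [← trivializationAt_symm_eq_coordField hx.1 hq]
  have hsign := congrArg (fun o' => SignType.sign (o'.someVector e)) ho'
  simp only [Orientation.sign_someVector_map] at hsign
  have hnorm := norm_form_eq_sqrt_det_gram C hn (hinj _) hL (hA _ hq)
  rw [← hform] at hnorm
  constructor
  · rw [← norm_ne_zero_iff, hnorm, gram_eq_matrixGram]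
    exact (Real.sqrt_pos.mpr (Matrix.posDef_gram_of_linearIndependent ((hA _ hq).map'
      (dmap (E := E) f _).toLinearMap (LinearMap.ker_eq_bot.mpr (hinj _)))).det_pos).ne'
  · have h1 := hθ ((extChartAt (𝓡 n) p).symm x) (fun i => (A _ hq).symm (e i))
    refine hform.trans (h1.trans ?_)
    rw [inducedVolume, ← hnorm]
    congr 4

end Phase

/-! ### The gradient of the phase -/

section PhaseGradient

variable {n : ℕ} {E : Type*} [NormedAddCommGroup E] [NormedSpace ℝ E] [FiniteDimensional ℝ E]
  {X : Type*} [TopologicalSpace X] [ChartedSpace E X]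
  [Bundle.RiemannianBundle (fun x : X => TangentSpace 𝓘(ℝ, E) x)]
  {L : Type*} [TopologicalSpace L] [ChartedSpace (EuclideanSpace ℝ (Fin n)) L]
  (C : CalabiYau n E X) {f : L → X} {p : L}

omit [FiniteDimensional ℝ E] [Bundle.RiemannianBundle fun x : X => TangentSpace 𝓘(ℝ, E) x] in
theorem linearIndependent_dmap_coordBasis
    (hinj : Function.Injective (dmap (n := n) (E := E) f p)) :
    LinearIndependent ℝ (fun i => dmap (n := n) (E := E) f p (coordBasis p i)) := by
  have h := (tangentBasis (n := n) p).linearIndependent.map'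
    (dmap (n := n) (E := E) f p).toLinearMap (LinearMap.ker_eq_bot.mpr hinj)
  rw [coe_tangentBasis] at h
  exact h

/-- `⟪J df(V), H⟫ = g^{ij} ⟪∇_i ∂_j f, J df(V)⟫`, because `J df(V)` is normal to a Lagrangian
submanifold. -/
theorem inner_meanCurvature (hL : IsLagrangian (n := n) C.J f) (V : TangentSpace (𝓡 n) p) :
    ⟪C.J (f p) (dmap (E := E) f p V), meanCurvature (n := n) (E := E) f p⟫ =
      ∑ i, ∑ k, inverseMetric (n := n) (E := E) f p i k *
        ⟪covHessian (n := n) (E := E) f p (coordBasis p i) (coordBasis p k),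
          C.J (f p) (dmap (E := E) f p V)⟫ := by
  rw [meanCurvature, inner_sum]
  refine Finset.sum_congr rfl fun i _ => ?_
  rw [inner_sum]
  refine Finset.sum_congr rfl fun k _ => ?_
  have hmem : C.J (f p) (dmap (E := E) f p V) ∈
      (LinearMap.range (dmap (n := n) (E := E) f p).toLinearMap)ᗮ := by
    rw [Submodule.mem_orthogonal']
    rintro _ ⟨w, rfl⟩
    exact hL p V w
  rw [inner_smul_right, secondFundamentalForm, ← Submodule.inner_starProjection_left_eq_right,
    Submodule.starProjection_eq_self_iff.mpr hmem, real_inner_comm]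

/-- The formula `∇ϑ = -JH` follows from `V ϑ = ⟪J V, H⟫`: both sides are tangent to `L`. -/
theorem inducedGradient_eq_of_dirDeriv
    (hinj : Function.Injective (dmap (n := n) (E := E) f p)) (hL : IsLagrangian (n := n) C.J f)
    (ϑ : L → ℝ) (h : ∀ V : TangentSpace (𝓡 n) p, dirDeriv ϑ p V =
      ⟪C.J (f p) (dmap (E := E) f p V), meanCurvature (n := n) (E := E) f p⟫) :
    inducedGradient (n := n) (E := E) f ϑ p =
      -(C.J (f p) (meanCurvature (n := n) (E := E) f p)) := by
  let e : Fin n → TangentSpace 𝓘(ℝ, E) (f p) :=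
    fun i => dmap (n := n) (E := E) f p (coordBasis p i)
  have he : LinearIndependent ℝ e := linearIndependent_dmap_coordBasis hinj
  have hLe : ∀ i j, ⟪C.J (f p) (e i), e j⟫ = 0 := fun i j => hL p _ _
  have hG : IsUnit (Matrix.gram ℝ e).det :=
    (Matrix.posDef_gram_of_linearIndependent he).det_pos.ne'.isUnit
  have hinv : inverseMetric (n := n) (E := E) f p = (Matrix.gram ℝ e)⁻¹ := rfl
  have hskew := inner_complexStructure_left (C.J_sq (f p)) (C.J_orthogonal (f p))
  -- inner products with the tangent vectors `e k`
  have h1 : ∀ k, ⟪inducedGradient (n := n) (E := E) f ϑ p, e k⟫ =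
      ⟪-(C.J (f p) (meanCurvature (n := n) (E := E) f p)), e k⟫ := by
    intro k
    rw [inner_neg_left, hskew, neg_neg, real_inner_comm, real_inner_comm (C.J (f p) (e k)), ← h,
      inducedGradient, inner_sum]
    simp only [inner_sum, inner_smul_right, hinv]
    have h2 : ∀ i j, (Matrix.gram ℝ e)⁻¹ i j * dirDeriv ϑ p (coordBasis p j) *
        ⟪e k, dmap (n := n) (E := E) f p (coordBasis p i)⟫ =
        (Matrix.gram ℝ e) k i * (Matrix.gram ℝ e)⁻¹ i j * dirDeriv ϑ p (coordBasis p j) := by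
      intro i j
      rw [Matrix.gram_apply]
      ring
    simp only [h2]
    rw [Finset.sum_comm]
    simp only [← Finset.sum_mul, ← Matrix.mul_apply, Matrix.mul_nonsing_inv _ hG,
      Matrix.one_apply, ite_mul, one_mul, zero_mul, Finset.sum_ite_eq, Finset.mem_univ, if_true]
  -- inner products with the normal vectors `J (e k)`
  have h2 : ∀ k, ⟪inducedGradient (n := n) (E := E) f ϑ p, C.J (f p) (e k)⟫ =
      ⟪-(C.J (f p) (meanCurvature (n := n) (E := E) f p)), C.J (f p) (e k)⟫ := by
    intro k
    rw [inner_neg_left, C.J_orthogonal]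
    have hH : ⟪meanCurvature (n := n) (E := E) f p, e k⟫ = 0 := by
      simp only [meanCurvature, sum_inner, inner_smul_left, secondFundamentalForm]
      refine Finset.sum_eq_zero fun i _ => Finset.sum_eq_zero fun j _ => ?_
      exact mul_eq_zero_of_right _ (Submodule.inner_left_of_mem_orthogonal (K := LinearMap.range
        (dmap (n := n) (E := E) f p).toLinearMap) ⟨coordBasis p k, rfl⟩
        (Submodule.starProjection_apply_mem _ _))
    rw [hH, neg_zero]
    simp only [inducedGradient, sum_inner, inner_smul_left]
    refine Finset.sum_eq_zero fun i _ => Finset.sum_eq_zero fun j _ => ?_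
    have := hLe k i
    rw [real_inner_comm] at this
    exact mul_eq_zero_of_right _ this
  refine ext_inner_right ℝ fun w => ?_
  obtain ⟨z, rfl⟩ := exists_eq_complexCombination (C.J_sq (f p)) C.finrank_eq he hLe w
  simp only [complexCombination, inner_sum, inner_add_right, inner_smul_right, h1, h2]

variable [IsManifold 𝓘(ℝ, E) 1 X] [IsManifold (𝓡 n) 1 L]

omit [IsManifold (𝓡 n) 1 L] in
theorem dirDeriv_eq_fderiv {ϑ : L → ℝ} (hϑ : MDifferentiableAt (𝓡 n) 𝓘(ℝ, ℝ) ϑ p)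
    (V : TangentSpace (𝓡 n) p) : dirDeriv ϑ p V =
      fderiv ℝ (ϑ ∘ (extChartAt (𝓡 n) p).symm) (extChartAt (𝓡 n) p p) (tangentCoords p V) :=
  tangentCoords_mfderiv ϑ hϑ V

/-- The logarithmic derivative of `Φ(∂₁ f, …, ∂ₙ f)` has imaginary part `⟪J df(V), H⟫`. -/
theorem hasFDerivAt_coordForm (hinj : Function.Injective (dmap (n := n) (E := E) f p))
    (hL : IsLagrangian (n := n) C.J f) (hf : TwiceMDifferentiableAt (n := n) (E := E) f p) :
    ∃ D : EuclideanSpace ℝ (Fin n) →L[ℝ] ℂ,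
      HasFDerivAt (coordForm C f p) D (extChartAt (𝓡 n) p p) ∧
      ∀ V : TangentSpace (𝓡 n) p, ∃ r : ℝ, D (tangentCoords p V) = (r + Complex.I *
        ((⟪C.J (f p) (dmap (E := E) f p V), meanCurvature (n := n) (E := E) f p⟫ : ℝ) : ℂ)) *
          coordForm C f p (extChartAt (𝓡 n) p p) := by
  obtain ⟨D, hD, hD'⟩ := hasFDerivAt_pullbackInChart hf (fun x => (C.Φ x).toMultilinearMap)
    C.Φ_smooth C.Φ_parallel (coordBasis p)
  have hcoord : (fun i => tangentCoords p (coordBasis (n := n) p i)) =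
      fun i => EuclideanSpace.single i 1 := by
    funext i
    simp [coordBasis]
  rw [hcoord] at hD
  refine ⟨D, hD, fun V => ?_⟩
  obtain ⟨r, hr⟩ := sum_map_update_eq (C.J_sq (f p)) (C.J_orthogonal (f p)) C.finrank_eq
    (linearIndependent_dmap_coordBasis hinj) (fun i j => hL p _ _) (C.Φ (f p)) (C.Φ_type (f p))
    (fun i => covHessian (n := n) (E := E) f p V (coordBasis p i))
  have hval : coordForm C f p (extChartAt (𝓡 n) p p) =
      C.Φ (f p) (fun i => dmap (n := n) (E := E) f p (coordBasis p i)) := by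
    have hd : ∀ w, tangentCoords (f p) (dmap (n := n) (E := E) f p w) =
        fderiv ℝ (writtenInExtChartAt (𝓡 n) 𝓘(ℝ, E) p f) (extChartAt (𝓡 n) p p)
          (tangentCoords p w) := tangentCoords_mfderiv f hf.1.self_of_nhds
    have hFx : writtenInExtChartAt (𝓡 n) 𝓘(ℝ, E) p f (extChartAt (𝓡 n) p p) =
        extChartAt 𝓘(ℝ, E) (f p) (f p) := by
      simp [writtenInExtChartAt]
    rw [coordForm, pullbackInChart, hFx, ← tensorInChart_self (fun x => ⇑(C.Φ x)) (f p)]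
    simp only [hd, congrFun hcoord]
  refine ⟨r, ?_⟩
  rw [hD', hval, inner_meanCurvature C hL]
  refine hr.trans ?_
  congr 5
  funext i
  refine Finset.sum_congr rfl fun k _ => ?_
  rw [covHessian_symm hf, inner_covHessian_symm C hf hL]
  rfl

/-- `V θ = ⟪J V, H⟫`. Where `e^{iϑ}` is the phase, `Ψ e^{-iϑ}` is real for
`Ψ = Φ(∂₁ f, …, ∂ₙ f)`; so its logarithmic derivative is real, and `dϑ` is the imaginary part of the
logarithmic derivative of `Ψ`. -/
theorem dirDeriv_phase_eq (hn : 1 ≤ n)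
    (hinj : ∀ p : L, Function.Injective (dmap (n := n) (E := E) f p))
    (hL : IsLagrangian (n := n) C.J f) (hf : TwiceMDifferentiableAt (n := n) (E := E) f p)
    {o : ∀ p : L, Orientation ℝ (TangentSpace (𝓡 n) p) (Fin n)} (ho : IsContinuousOrientation o)
    {θ : L → Real.Angle} (hθ : IsPhase (fun x => ⇑(C.Φ x)) f o θ)
    {ϑ : L → ℝ} (hϑ : MDifferentiableAt (𝓡 n) 𝓘(ℝ, ℝ) ϑ p) (hϑθ : IsLocalLift θ p ϑ)
    (V : TangentSpace (𝓡 n) p) : dirDeriv ϑ p V =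
      ⟪C.J (f p) (dmap (E := E) f p V), meanCurvature (n := n) (E := E) f p⟫ := by
  obtain ⟨s, hs, hev⟩ := hθ.eventually_coordForm_eq C hn hf.1 hinj hL ho
  obtain ⟨D, hD, hD'⟩ := hasFDerivAt_coordForm C (hinj p) hL hf
  obtain ⟨r, hr⟩ := hD' V
  set t : ℝ := ⟪C.J (f p) (dmap (E := E) f p V), meanCurvature (n := n) (E := E) f p⟫
  set x₀ := extChartAt (𝓡 n) p p with hx₀
  let φ : EuclideanSpace ℝ (Fin n) → ℝ := ϑ ∘ (extChartAt (𝓡 n) p).symm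
  have hφ : HasFDerivAt φ (fderiv ℝ φ x₀) x₀ := by
    have hs' := mdifferentiableAt_extChartAt_symm' p
      (mem_extChartAt_target (I := 𝓘(ℝ, EuclideanSpace ℝ (Fin n))) p)
    have hϑ' : MDifferentiableAt (𝓡 n) 𝓘(ℝ, ℝ) ϑ ((extChartAt (𝓡 n) p).symm x₀) := by
      rw [hx₀, extChartAt_to_inv]; exact hϑ
    exact (MDifferentiableAt.comp x₀ hϑ' hs').differentiableAt.hasFDerivAt
  rw [dirDeriv_eq_fderiv hϑ V]
  change fderiv ℝ φ x₀ (tangentCoords p V) = t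
  have hc : Filter.Tendsto (extChartAt (𝓡 n) p).symm (𝓝 x₀) (𝓝 p) := by
    have h := continuousAt_extChartAt_symm (I := 𝓡 n) p
    rwa [ContinuousAt, extChartAt_to_inv] at h
  have hreal : ∀ᶠ x in 𝓝 x₀, coordForm C f p x * Complex.exp (-(φ x * Complex.I)) =
      ((s * ‖coordForm C f p x‖ : ℝ) : ℂ) := by
    filter_upwards [hev, hc.eventually hϑθ] with x hx hx'
    conv_lhs => rw [hx.2, ← hx', Real.Angle.toCircle_coe, Circle.coe_exp]
    rw [mul_right_comm, ← Complex.exp_add]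
    simp [φ]
  have hofReal : HasFDerivAt (fun x => (φ x : ℂ)) (Complex.ofRealCLM.comp (fderiv ℝ φ x₀)) x₀ :=
    Complex.ofRealCLM.hasFDerivAt.comp x₀ hφ
  have hexp := (hofReal.mul_const Complex.I).fun_neg.cexp
  have hprod := hD.mul hexp
  have him : HasFDerivAt (fun x => (coordForm C f p x * Complex.exp (-(φ x * Complex.I))).im)
      (0 : EuclideanSpace ℝ (Fin n) →L[ℝ] ℝ) x₀ := by
    refine (hasFDerivAt_const (0 : ℝ) x₀).congr_of_eventuallyEq ?_
    filter_upwards [hreal] with x hx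
    rw [hx, Complex.ofReal_im]
  have him' := Complex.imCLM.hasFDerivAt.comp x₀ hprod
  have h3 := congrArg (fun A : EuclideanSpace ℝ (Fin n) →L[ℝ] ℝ => A (tangentCoords p V))
    (him'.unique him)
  have hne : s * ‖coordForm C f p x₀‖ ≠ 0 :=
    mul_ne_zero hs (norm_ne_zero_iff.mpr hev.self_of_nhds.1)
  have h4 := hreal.self_of_nhds
  set Ψ := coordForm C f p x₀
  set w := Complex.exp (-(φ x₀ * Complex.I))
  set d := fderiv ℝ φ x₀ (tangentCoords p V)
  have h5 : (((r : ℂ) + Complex.I * ((t - d : ℝ) : ℂ)) * (Ψ * w)).im = 0 := by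
    refine Eq.trans ?_ h3
    simp only [ContinuousLinearMap.comp_apply, add_apply, smul_apply, neg_apply, hr,
      Complex.imCLM_apply, Complex.ofRealCLM_apply, smul_eq_mul]
    congr 1
    push_cast
    ring
  rw [h4, Complex.im_mul_ofReal] at h5
  simp only [Complex.add_im, Complex.ofReal_im, Complex.mul_im, Complex.I_re, Complex.I_im,
    Complex.ofReal_re, zero_mul, zero_add, one_mul, zero_add] at h5
  have h6 := (mul_eq_zero.mp h5).resolve_right hne
  linarith

/-- Near `p` the phase has the real-valued representative `ϑ₀ + arg (Ψ / Ψ(p))`, as regular as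
`Ψ = Φ(∂₁ f, …, ∂ₙ f)`. -/
theorem exists_localLift (hn : 1 ≤ n)
    (hf : ∀ᶠ q in 𝓝 p, MDifferentiableAt (𝓡 n) 𝓘(ℝ, E) f q)
    (hinj : ∀ p : L, Function.Injective (dmap (n := n) (E := E) f p))
    (hL : IsLagrangian (n := n) C.J f)
    {o : ∀ p : L, Orientation ℝ (TangentSpace (𝓡 n) p) (Fin n)} (ho : IsContinuousOrientation o)
    {θ : L → Real.Angle} (hθ : IsPhase (fun x => ⇑(C.Φ x)) f o θ) :
    ∃ φ : EuclideanSpace ℝ (Fin n) → ℝ, IsLocalLift θ p (φ ∘ extChartAt (𝓡 n) p) ∧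
      (DifferentiableAt ℝ (coordForm C f p) (extChartAt (𝓡 n) p p) →
        DifferentiableAt ℝ φ (extChartAt (𝓡 n) p p)) ∧
      (ContDiffAt ℝ 1 (coordForm C f p) (extChartAt (𝓡 n) p p) →
        ContDiffAt ℝ 1 φ (extChartAt (𝓡 n) p p)) := by
  obtain ⟨s, hs, hev⟩ := hθ.eventually_coordForm_eq C hn hf hinj hL ho
  set x₀ := extChartAt (𝓡 n) p p with hx₀
  set Ψ := coordForm C f p with hΨ
  have h0 := hev.self_of_nhds
  have hslit : Ψ x₀ / Ψ x₀ ∈ Complex.slitPlane := by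
    rw [div_self h0.1]
    exact Complex.one_mem_slitPlane
  refine ⟨fun x => (θ p).toReal + (Complex.log (Ψ x / Ψ x₀)).im, ?_, fun hd => ?_, fun hd => ?_⟩
  · have hev' : ∀ᶠ q in 𝓝 p, _ := (continuousAt_extChartAt (I := 𝓡 n) p).eventually hev
    filter_upwards [hev', extChartAt_source_mem_nhds (I := 𝓡 n) p] with q hq hqs
    rw [(extChartAt (𝓡 n) p).left_inv hqs] at hq
    have h0' := h0.2
    rw [hx₀, extChartAt_to_inv] at h0'
    rw [← hx₀] at h0'
    set x := extChartAt (𝓡 n) p q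
    have hz : Ψ x / Ψ x₀ ≠ 0 := div_ne_zero hq.1 h0.1
    have hcirc : (((((θ p).toReal + (Complex.log (Ψ x / Ψ x₀)).im : ℝ) : Real.Angle).toCircle
        : Circle) : ℂ) = ((θ q).toCircle : ℂ) := by
      rw [Real.Angle.coe_add, Real.Angle.toCircle_add, Real.Angle.coe_toReal, Circle.coe_mul,
        Real.Angle.toCircle_coe, Circle.coe_exp, Complex.log_im]
      have h1 := Complex.norm_mul_exp_arg_mul_I (Ψ x / Ψ x₀)
      have hn1 : (‖Ψ x‖ : ℂ) ≠ 0 := Complex.ofReal_ne_zero.mpr (norm_ne_zero_iff.mpr hq.1)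
      have hn0 : (‖Ψ x₀‖ : ℂ) ≠ 0 := Complex.ofReal_ne_zero.mpr (norm_ne_zero_iff.mpr h0.1)
      have hsc : (s : ℂ) ≠ 0 := Complex.ofReal_ne_zero.mpr hs
      rw [norm_div, eq_div_iff h0.1] at h1
      have hp' : Ψ x₀ = ((θ p).toCircle : ℂ) * ((s : ℂ) * ‖Ψ x₀‖) := by
        exact_mod_cast h0'
      have hq' : Ψ x = ((θ q).toCircle : ℂ) * ((s : ℂ) * ‖Ψ x‖) := by
        exact_mod_cast hq.2
      set a := Complex.exp (((Ψ x / Ψ x₀).arg : ℂ) * Complex.I)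
      rw [Complex.ofReal_div] at h1
      apply mul_right_cancel₀ (mul_ne_zero hsc hn1)
      rw [← hq']
      calc ((θ p).toCircle : ℂ) * a * (s * ‖Ψ x‖)
          = ‖Ψ x‖ / ‖Ψ x₀‖ * a * (((θ p).toCircle : ℂ) * (s * ‖Ψ x₀‖)) := by field_simp
        _ = Ψ x := by rw [← hp', h1]
    have := congrArg (fun z : ℂ => (z.arg : Real.Angle)) hcirc
    simp only [Real.Angle.arg_toCircle] at this
    exact this
  · have h1 : DifferentiableAt ℝ (fun x => Complex.log (Ψ x / Ψ x₀)) x₀ :=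
      DifferentiableAt.comp x₀ (g := Complex.log) (f := fun x => Ψ x / Ψ x₀)
        ((Complex.differentiableAt_log hslit).restrictScalars ℝ)
        (by simpa only [div_eq_mul_inv] using hd.mul_const (Ψ x₀)⁻¹)
    exact (Complex.imCLM.differentiableAt.comp x₀ h1).const_add _
  · have h1 : ContDiffAt ℝ 1 (fun x => Complex.log (Ψ x / Ψ x₀)) x₀ :=
      ContDiffAt.comp x₀ (g := Complex.log) (f := fun x => Ψ x / Ψ x₀)
        ((Complex.contDiffAt_log hslit).restrict_scalars ℝ) (hd.div_const (Ψ x₀))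
    exact contDiffAt_const.add (Complex.imCLM.contDiff.contDiffAt.comp x₀ h1)

omit [FiniteDimensional ℝ E] [Bundle.RiemannianBundle fun x : X => TangentSpace 𝓘(ℝ, E) x]
  [IsManifold 𝓘(ℝ, E) 1 X] [IsManifold (𝓡 n) 1 L] in
theorem TwiceMDifferentiableAt.of_contMDiff [IsManifold 𝓘(ℝ, E) 2 X] [IsManifold (𝓡 n) 2 L]
    (hf : ContMDiff (𝓡 n) 𝓘(ℝ, E) 2 f) :
    ContDiffAt ℝ 2 (writtenInExtChartAt (𝓡 n) 𝓘(ℝ, E) p f) (extChartAt (𝓡 n) p p) ∧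
      TwiceMDifferentiableAt (n := n) (E := E) f p := by
  have h := (contMDiffAt_iff.mp (hf p)).2
  rw [modelWithCornersSelf_coe, Set.range_id, contDiffWithinAt_univ] at h
  refine ⟨h, Filter.Eventually.of_forall fun q => (hf q).mdifferentiableAt (by norm_num), ?_⟩
  exact (h.fderiv_right (m := 1) (by norm_num)).differentiableAt (by norm_num)

omit [IsManifold 𝓘(ℝ, E) 1 X] [IsManifold (𝓡 n) 1 L] in
theorem contDiffAt_coordForm
    (h : ContDiffAt ℝ 2 (writtenInExtChartAt (𝓡 n) 𝓘(ℝ, E) p f) (extChartAt (𝓡 n) p p)) :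
    ContDiffAt ℝ 1 (coordForm C f p) (extChartAt (𝓡 n) p p) := by
  have hFx : writtenInExtChartAt (𝓡 n) 𝓘(ℝ, E) p f (extChartAt (𝓡 n) p p) =
      extChartAt 𝓘(ℝ, E) (f p) (f p) := by
    simp [writtenInExtChartAt]
  refine ContDiffAt.multilinearFamily
    (M := tensorInChartMultilinear (fun x => (C.Φ x).toMultilinearMap) (f p))
    (fun b => ?_) (h.of_le (by norm_num)) (fun i => ?_)
  · rw [hFx]
    exact (C.Φ_smooth (f p) b).of_le (by exact_mod_cast le_top)
  · exact (h.fderiv_right (m := 1) (by norm_num)).clm_apply contDiffAt_const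

/-- The phase of a Lagrangian immersion of class `C²` satisfies `∇θ = -JH`. -/
theorem phaseGradientFormula_of_contMDiff [IsManifold 𝓘(ℝ, E) 2 X] [IsManifold (𝓡 n) 2 L]
    (hn : 1 ≤ n) (hf : ContMDiff (𝓡 n) 𝓘(ℝ, E) 2 f)
    (hinj : ∀ p : L, Function.Injective (dmap (n := n) (E := E) f p))
    (hL : IsLagrangian (n := n) C.J f)
    {o : ∀ p : L, Orientation ℝ (TangentSpace (𝓡 n) p) (Fin n)} (ho : IsContinuousOrientation o)
    {θ : L → Real.Angle} (hθ : IsPhase (fun x => ⇑(C.Φ x)) f o θ) :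
    PhaseGradientFormula (n := n) C.J f θ p := by
  obtain ⟨hF, hf2⟩ := TwiceMDifferentiableAt.of_contMDiff (p := p) hf
  refine ⟨?_, fun ϑ hϑ hlift => ?_⟩
  · obtain ⟨φ, hφ, -, hφ1⟩ := exists_localLift C (p := p) hn hf2.1 hinj hL ho hθ
    refine ⟨φ ∘ extChartAt (𝓡 n) p, ?_, hφ⟩
    exact (hφ1 (contDiffAt_coordForm C hF)).contMDiffAt.comp p
      (contMDiffAt_extChartAt (n := 1))
  · have h := dirDeriv_phase_eq C hn hinj hL hf2 ho hθ hϑ hlift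
    exact ⟨h, inducedGradient_eq_of_dirDeriv C (hinj p) hL ϑ h⟩

end PhaseGradient

/-! ### The flat Calabi-Yau structure of `ℂⁿ` -/

section Flat

variable {n : ℕ}

theorem tangentCoords_coordField_vectorSpace {V : Type*} [NormedAddCommGroup V] [NormedSpace ℝ V]
    (p a x : V) : tangentCoords _ (coordField p a x) = a := by
  have h : ∀ g : V → V, g = id → mfderiv 𝓘(ℝ, V) 𝓘(ℝ, V) g x a = a := by
    rintro g rfl
    rw [mfderiv_id]
    rfl
  exact h _ (by rw [extChartAt_model_space_eq_id]; rfl)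

theorem inner_tangentSpace_vectorSpace {V : Type*} [NormedAddCommGroup V] [InnerProductSpace ℝ V]
    (z : V) (v w : TangentSpace 𝓘(ℝ, V) z) : ⟪v, w⟫ = ⟪tangentCoords z v, tangentCoords z w⟫ := rfl

/-- The Levi-Civita connection of a Euclidean space is the trivial one. -/
theorem christoffel_vectorSpace {V : Type*} [NormedAddCommGroup V] [InnerProductSpace ℝ V]
    [FiniteDimensional ℝ V] (p : V) (a b : TangentSpace 𝓘(ℝ, V) p) : christoffel p a b = 0 := by
  have h : ∀ a b : V, metricInChart p a b = fun _ => ⟪a, b⟫ := by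
    intro a b
    funext x
    rw [metricInChart, inner_tangentSpace_vectorSpace, tangentCoords_coordField_vectorSpace,
      tangentCoords_coordField_vectorSpace]
  simp [christoffel, christoffelForm, h]

theorem tensorInChart_of_constant {V : Type*} [NormedAddCommGroup V] [NormedSpace ℝ V] {k : ℕ}
    {W : Type*} (T₀ : (Fin k → V) → W) (p : V) (a : Fin k → V) :
    tensorInChart (fun (x : V) (v : Fin k → TangentSpace 𝓘(ℝ, V) x) =>
      T₀ (fun i => tangentCoords x (v i))) p a = fun _ => T₀ a := by
  funext x
  simp only [tensorInChart, tangentCoords_coordField_vectorSpace]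

theorem isSmoothTensor_of_constant {V : Type*} [NormedAddCommGroup V] [NormedSpace ℝ V] {k : ℕ}
    {W : Type*} [NormedAddCommGroup W] [NormedSpace ℝ W] (T₀ : (Fin k → V) → W) :
    IsSmoothTensor (fun (x : V) (v : Fin k → TangentSpace 𝓘(ℝ, V) x) =>
      T₀ (fun i => tangentCoords x (v i))) := by
  intro p a
  rw [tensorInChart_of_constant]
  exact contDiffAt_const

theorem isParallelTensor_of_constant {V : Type*} [NormedAddCommGroup V] [InnerProductSpace ℝ V]
    [FiniteDimensional ℝ V] {k : ℕ} {W : Type*} [NormedAddCommGroup W] [NormedSpace ℝ W]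
    (T₀ : (Fin k → V) → W) (hT₀ : ∀ (a : Fin k → V) i, T₀ (Function.update a i 0) = 0) :
    IsParallelTensor (fun (x : V) (v : Fin k → TangentSpace 𝓘(ℝ, V) x) =>
      T₀ (fun i => tangentCoords x (v i))) := by
  intro p a c
  rw [tensorInChart_of_constant, fderiv_fun_const]
  symm
  refine Finset.sum_eq_zero fun i _ => ?_
  rw [christoffel_vectorSpace]
  convert hT₀ (fun j => tangentCoords p (a j)) i with j
  by_cases h : j = i
  · subst h; simp
  · simp [Function.update_of_ne h]

/-- Multiplication by `i` on `ℂⁿ = ℝⁿ ⊕ iℝⁿ`. -/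
noncomputable def mulI (n : ℕ) (w : CSpace n) : CSpace n := WithLp.toLp 2 (-w.snd, w.fst)

theorem tangentCoords_flatJ (z : CSpace n) (v : TangentSpace 𝓘(ℝ, CSpace n) z) :
    tangentCoords z (flatJ n z v) = mulI n (tangentCoords z v) := rfl

theorem inner_mulI (v w : CSpace n) : ⟪mulI n v, mulI n w⟫ = ⟪v, w⟫ := by
  simp [mulI, WithLp.prod_inner_apply, add_comm]

theorem mulI_mulI (v : CSpace n) : mulI n (mulI n v) = -v := by
  apply WithLp.ofLp_injective 2
  ext <;> simp [mulI]

theorem mulI_zero : mulI n 0 = 0 := by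
  apply WithLp.ofLp_injective 2
  ext <;> simp [mulI]

/-- The complex coordinates of a vector of `ℝⁿ ⊕ iℝⁿ`. -/
noncomputable def complexCoords (n : ℕ) : CSpace n →ₗ[ℝ] (Fin n → ℂ) where
  toFun w := fun j => ((w.fst j : ℝ) : ℂ) + Complex.I * ((w.snd j : ℝ) : ℂ)
  map_add' v w := by
    funext j
    simp
    ring
  map_smul' c w := by
    funext j
    simp
    ring

theorem complexCoords_mulI (w : CSpace n) :
    complexCoords n (mulI n w) = Complex.I • complexCoords n w := by
  funext j
  simp only [complexCoords, mulI, LinearMap.coe_mk, AddHom.coe_mk, Pi.smul_apply, smul_eq_mul,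
    mul_add, ← mul_assoc, Complex.I_mul_I]
  simp
  ring

theorem sum_norm_complexCoords_sq (w : CSpace n) : ∑ j, ‖complexCoords n w j‖ ^ 2 = ⟪w, w⟫ := by
  rw [WithLp.prod_inner_apply, PiLp.inner_apply, PiLp.inner_apply, ← Finset.sum_add_distrib]
  refine Finset.sum_congr rfl fun j _ => ?_
  rw [← Complex.normSq_eq_norm_sq, Complex.normSq_apply]
  simp [complexCoords, sq]

/-- `dz₁ ∧ ⋯ ∧ dzₙ` as an alternating form. -/
noncomputable def flatDzForm (n : ℕ) : CSpace n [⋀^Fin n]→ₗ[ℝ] ℂ where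
  toFun w := Matrix.detRowAlternating (fun i => complexCoords n (w i))
  map_update_add' w i x y := by
    have key : ∀ u, (fun j => complexCoords n (Function.update w i u j)) =
        Function.update (fun j => complexCoords n (w j)) i (complexCoords n u) := fun u =>
      funext fun j => Function.apply_update (fun _ => complexCoords n) w i u j
    have := Subsingleton.elim ‹DecidableEq (Fin n)› (instDecidableEqFin n)
    subst this
    simp only [key, map_add, AlternatingMap.map_update_add]
  map_update_smul' w i c x := by
    have key : ∀ u, (fun j => complexCoords n (Function.update w i u j)) =
        Function.update (fun j => complexCoords n (w j)) i (complexCoords n u) := fun u =>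
      funext fun j => Function.apply_update (fun _ => complexCoords n) w i u j
    have := Subsingleton.elim ‹DecidableEq (Fin n)› (instDecidableEqFin n)
    subst this
    have hc : ∀ u : Fin n → ℂ, c • u = (c : ℂ) • u := fun u => by
      funext j
      simp
    simp only [key, map_smul, hc, AlternatingMap.map_update_smul]
    simp
  map_eq_zero_of_eq' w i j hij hne :=
    AlternatingMap.map_eq_zero_of_eq _ _ (by simp only [hij]) hne

theorem flatDzForm_apply (w : Fin n → CSpace n) :
    flatDzForm n w = Matrix.det (Matrix.of fun i => complexCoords n (w i)) := rfl

theorem flatDzForm_update_mulI (v : Fin n → CSpace n) (i : Fin n) :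
    flatDzForm n (Function.update v i (mulI n (v i))) = Complex.I * flatDzForm n v := by
  have key : (fun j => complexCoords n (Function.update v i (mulI n (v i)) j)) =
      Function.update (fun j => complexCoords n (v j)) i (Complex.I • complexCoords n (v i)) := by
    rw [← complexCoords_mulI]
    exact funext fun j => Function.apply_update (fun _ => complexCoords n) v i _ j
  change Matrix.detRowAlternating (fun j => complexCoords n _) = _
  rw [key, AlternatingMap.map_update_smul, Function.update_eq_self]
  rfl

/-- The flat Calabi-Yau structure of `ℂⁿ`. -/
noncomputable def flatCalabiYau (n : ℕ) : CalabiYau n (CSpace n) (CSpace n) where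
  finrank_eq := by
    rw [(WithLp.linearEquiv 2 ℝ _).finrank_eq]
    simp
    ring
  J := flatJ n
  J_sq x v := (tangentCoords x).injective (mulI_mulI _)
  J_orthogonal x v w := inner_mulI _ _
  kahler_smooth := isSmoothTensor_of_constant (fun v : Fin 2 → CSpace n => ⟪mulI n (v 0), v 1⟫)
  kahler_parallel := isParallelTensor_of_constant
    (fun v : Fin 2 → CSpace n => ⟪mulI n (v 0), v 1⟫) (by
      intro a i
      fin_cases i
      · simp [mulI_zero]
      · simp)
  Φ z := (flatDzForm n).compLinearMap (tangentCoords z).toLinearMap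
  Φ_type x v i := by
    refine Eq.trans ?_ (flatDzForm_update_mulI (fun j => tangentCoords x (v j)) i)
    refine congrArg (flatDzForm n) (funext fun j => ?_)
    by_cases h : j = i
    · subst h
      simp only [Function.update_self]
      rfl
    · simp only [Function.update_of_ne h]
      rfl
  Φ_smooth := isSmoothTensor_of_constant (flatDzForm n)
  Φ_parallel := isParallelTensor_of_constant (flatDzForm n)
    (fun a i => (flatDzForm n).map_update_zero a i)
  Φ_comass x := by
    constructor
    · rintro r ⟨v, hv, rfl⟩
      refine (Complex.re_le_norm _).trans (Matrix.norm_det_le_one_of_row_norm _ fun i => ?_)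
      refine (sum_norm_complexCoords_sq (tangentCoords x (v i))).trans ?_
      rw [← inner_tangentSpace_vectorSpace, real_inner_self_eq_norm_sq, hv.1 i, one_pow]
    · intro r hr
      refine hr ⟨fun i => (tangentCoords x).symm
        (WithLp.toLp 2 (EuclideanSpace.single i (1 : ℝ), 0) : CSpace n), ?_, ?_⟩
      · rw [orthonormal_iff_ite]
        intro i j
        rw [inner_tangentSpace_vectorSpace]
        simp [WithLp.prod_inner_apply, EuclideanSpace.inner_single_left, eq_comm]
      · have h : ((flatDzForm n) fun i =>
            (WithLp.toLp 2 (EuclideanSpace.single i (1 : ℝ), 0) : CSpace n)) = 1 := by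
          have h1 : (Matrix.of fun i => complexCoords n
              (WithLp.toLp 2 (EuclideanSpace.single i (1 : ℝ), 0) : CSpace n)) = 1 := by
            ext i j
            simp only [complexCoords, Matrix.one_apply, eq_comm]
            by_cases h : i = j <;> simp [h, eq_comm]
          rw [flatDzForm_apply, h1, Matrix.det_one]
        change (1 : ℝ) = ((flatDzForm n) fun i =>
            (WithLp.toLp 2 (EuclideanSpace.single i (1 : ℝ), 0) : CSpace n)).re
        rw [h, Complex.one_re]

end Flat

/-! ### Open subsets of `ℝⁿ` as manifolds, and graphs over them -/

section OpenSubset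

variable {n : ℕ} {Ω : TopologicalSpace.Opens (EuclideanSpace ℝ (Fin n))}

theorem extChartAt_opens_apply (p q : Ω) : extChartAt (𝓡 n) p q = (q : EuclideanSpace ℝ (Fin n)) :=
  rfl

theorem extChartAt_opens_source (p : Ω) : (extChartAt (𝓡 n) p).source = Set.univ := by
  rw [extChartAt_source]
  ext q
  simp [TopologicalSpace.Opens.chartAt_eq, chartAt_self_eq]

theorem extChartAt_opens_symm (p q : Ω) :
    (extChartAt (𝓡 n) p).symm (q : EuclideanSpace ℝ (Fin n)) = q := by
  rw [← extChartAt_opens_apply p q]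
  exact (extChartAt (𝓡 n) p).left_inv (by rw [extChartAt_opens_source]; trivial)

variable {V : Type*} [NormedAddCommGroup V] [NormedSpace ℝ V]

theorem writtenInExtChartAt_opens_eventuallyEq (F : EuclideanSpace ℝ (Fin n) → V) (p : Ω) :
    writtenInExtChartAt (𝓡 n) 𝓘(ℝ, V) p (fun q : Ω => F q) =ᶠ[𝓝 (p : EuclideanSpace ℝ (Fin n))]
      F := by
  filter_upwards [Ω.isOpen.mem_nhds p.2] with x hx
  have h := extChartAt_opens_symm p ⟨x, hx⟩
  simp only [writtenInExtChartAt, Function.comp_apply, extChartAt_model_space_eq_id]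
  change F ((extChartAt (𝓡 n) p).symm x : Ω) = F x
  rw [h]

theorem mdifferentiableAt_opens {F : EuclideanSpace ℝ (Fin n) → V} {p : Ω}
    (hF : DifferentiableAt ℝ F p) :
    MDifferentiableAt (𝓡 n) 𝓘(ℝ, V) (fun q : Ω => F q) p :=
  hF.mdifferentiableAt.comp p
    ((contMDiff_subtype_val (n := 1)).mdifferentiableAt (by norm_num))

theorem tangentCoords_mfderiv_opens {F : EuclideanSpace ℝ (Fin n) → V} {p : Ω}
    (hF : DifferentiableAt ℝ F p) (v : TangentSpace (𝓡 n) p) :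
    tangentCoords (F p) (mfderiv (𝓡 n) 𝓘(ℝ, V) (fun q : Ω => F q) p v) =
      fderiv ℝ F p (tangentCoords p v) := by
  refine (tangentCoords_mfderiv (fun q : Ω => F q) (mdifferentiableAt_opens hF) v).trans ?_
  rw [extChartAt_opens_apply, (writtenInExtChartAt_opens_eventuallyEq F p).fderiv_eq]

theorem dirDeriv_opens {ψ : EuclideanSpace ℝ (Fin n) → ℝ} {p : Ω} (hψ : DifferentiableAt ℝ ψ p)
    (v : TangentSpace (𝓡 n) p) :
    dirDeriv (fun q : Ω => ψ q) p v = fderiv ℝ ψ p (tangentCoords p v) :=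
  tangentCoords_mfderiv_opens hψ v

theorem twiceMDifferentiableAt_opens {F : EuclideanSpace ℝ (Fin n) → V} {p : Ω}
    (hF : ∀ q ∈ Ω, DifferentiableAt ℝ F q) (hF2 : DifferentiableAt ℝ (fderiv ℝ F) p) :
    TwiceMDifferentiableAt (n := n) (E := V) (fun q : Ω => F q) p := by
  refine ⟨Filter.Eventually.of_forall fun q => mdifferentiableAt_opens (hF q q.2), ?_⟩
  rw [extChartAt_opens_apply]
  exact hF2.congr_of_eventuallyEq (writtenInExtChartAt_opens_eventuallyEq F p).fderiv

theorem isContinuousOrientation_stdOrientation : IsContinuousOrientation (stdOrientation Ω) := by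
  have key : ∀ (p q : Ω) (hq : q ∈ (trivializationAt (EuclideanSpace ℝ (Fin n))
      (TangentSpace (𝓡 n)) p).baseSet),
      ((trivializationAt (EuclideanSpace ℝ (Fin n)) (TangentSpace (𝓡 n)) p).continuousLinearEquivAt
        ℝ q hq).toLinearEquiv = (tangentCoords q).toLinearEquiv := by
    intro p q hq
    ext1 v
    have hs : q ∈ (chartAt (EuclideanSpace ℝ (Fin n)) p).source := by
      rw [← extChartAt_source (𝓡 n), extChartAt_opens_source]
      trivial
    have h := congrArg (fun A : TangentSpace (𝓡 n) q →L[ℝ] EuclideanSpace ℝ (Fin n) => A v)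
      (TangentBundle.continuousLinearMapAt_trivializationAt (I := 𝓡 n) hs)
    have h2 := tangentCoords_mfderiv_opens (F := id) (p := q) differentiableAt_id v
    rw [fderiv_id] at h2
    refine Eq.trans ?_ (h.trans h2)
    exact congrFun (Bundle.Trivialization.coe_continuousLinearEquivAt_eq _ hq) v
  intro p
  have hb : ∀ q : Ω, q ∈ (trivializationAt (EuclideanSpace ℝ (Fin n))
      (TangentSpace (𝓡 n)) p).baseSet := by
    intro q
    rw [TangentBundle.trivializationAt_baseSet, ← extChartAt_source (𝓡 n),
      extChartAt_opens_source]
    trivial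
  refine Filter.Eventually.of_forall fun q => ⟨hb q, hb p, ?_⟩
  have hstd : ∀ q : Ω, Orientation.map (Fin n) (tangentCoords q).toLinearEquiv
      (stdOrientation Ω q) = (EuclideanSpace.basisFun (Fin n) ℝ).toBasis.orientation := by
    intro q
    rw [stdOrientation]
    exact (Orientation.map (Fin n) (tangentCoords q).symm.toLinearEquiv).symm_apply_apply _
  rw [key, key, hstd, hstd]

/-- The graph map `x ↦ (x, G x)` on all of `ℝⁿ`. -/
noncomputable def graphFun (G : EuclideanSpace ℝ (Fin n) → EuclideanSpace ℝ (Fin n))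
    (x : EuclideanSpace ℝ (Fin n)) : CSpace n := WithLp.toLp 2 (x, G x)

/-- The map `(x, y) ↦ x + i y` as a continuous linear map. -/
noncomputable def toCSpaceL (n : ℕ) :
    EuclideanSpace ℝ (Fin n) × EuclideanSpace ℝ (Fin n) →L[ℝ] CSpace n :=
  (WithLp.prodContinuousLinearEquiv 2 ℝ (EuclideanSpace ℝ (Fin n))
    (EuclideanSpace ℝ (Fin n))).symm.toContinuousLinearMap

theorem hasFDerivAt_comp_id_prodMk {U W : Type*} [NormedAddCommGroup U] [NormedSpace ℝ U]
    [NormedAddCommGroup W] [NormedSpace ℝ W] (A : U × U →L[ℝ] W) {G : U → U} {x : U}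
    (hG : DifferentiableAt ℝ G x) :
    DifferentiableAt ℝ (fun y => A (y, G y)) x ∧
      ∀ v, fderiv ℝ (fun y => A (y, G y)) x v = A (v, fderiv ℝ G x v) := by
  have h := A.hasFDerivAt.comp x ((hasFDerivAt_id x).prodMk hG.hasFDerivAt)
  refine ⟨h.differentiableAt, fun v => ?_⟩
  exact DFunLike.congr_fun h.fderiv v

theorem differentiableAt_graphFun {G : EuclideanSpace ℝ (Fin n) → EuclideanSpace ℝ (Fin n)}
    {x : EuclideanSpace ℝ (Fin n)} (hG : DifferentiableAt ℝ G x) :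
    DifferentiableAt ℝ (graphFun G) x := (hasFDerivAt_comp_id_prodMk (toCSpaceL n) hG).1

theorem fderiv_graphFun_apply {G : EuclideanSpace ℝ (Fin n) → EuclideanSpace ℝ (Fin n)}
    {x : EuclideanSpace ℝ (Fin n)} (hG : DifferentiableAt ℝ G x) (v : EuclideanSpace ℝ (Fin n)) :
    fderiv ℝ (graphFun G) x v = WithLp.toLp 2 (v, fderiv ℝ G x v) :=
  (hasFDerivAt_comp_id_prodMk (toCSpaceL n) hG).2 v

theorem tangentCoords_dmap_graphMap
    {G : EuclideanSpace ℝ (Fin n) → EuclideanSpace ℝ (Fin n)} {p : Ω}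
    (hG : DifferentiableAt ℝ G p) (v : TangentSpace (𝓡 n) p) :
    tangentCoords (graphMap Ω G p) (dmap (n := n) (E := CSpace n) (graphMap Ω G) p v) =
      WithLp.toLp 2 (tangentCoords p v, fderiv ℝ G p (tangentCoords p v)) := by
  rw [← fderiv_graphFun_apply hG]
  exact tangentCoords_mfderiv_opens (F := graphFun G)
    (differentiableAt_graphFun hG) v

theorem injective_dmap_graphMap
    {G : EuclideanSpace ℝ (Fin n) → EuclideanSpace ℝ (Fin n)} {p : Ω}
    (hG : DifferentiableAt ℝ G p) :
    Function.Injective (dmap (n := n) (E := CSpace n) (graphMap Ω G) p) := by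
  intro v w hvw
  have h := congrArg (tangentCoords (graphMap Ω G p)) hvw
  rw [tangentCoords_dmap_graphMap hG, tangentCoords_dmap_graphMap hG] at h
  exact (tangentCoords p).injective (congrArg (fun z : CSpace n => z.fst) h)

theorem contMDiff_graphMap {G : EuclideanSpace ℝ (Fin n) → EuclideanSpace ℝ (Fin n)}
    {m : WithTop ℕ∞} (hG : ContDiffOn ℝ m G Ω) :
    ContMDiff (𝓡 n) 𝓘(ℝ, CSpace n) m (graphMap Ω G) := by
  intro p
  have h : ContDiffAt ℝ m (graphFun G) p :=
    ContDiffAt.comp (p : EuclideanSpace ℝ (Fin n)) (g := toCSpaceL n)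
      (toCSpaceL n).contDiff.contDiffAt
      (contDiffAt_id.prodMk (hG.contDiffAt (Ω.isOpen.mem_nhds p.2)))
  exact h.contMDiffAt.comp p contMDiff_subtype_val.contMDiffAt

/-- Lagrangian graphs of class `C²`. -/
theorem phase_graphMap (hn : 1 ≤ n) {G : EuclideanSpace ℝ (Fin n) → EuclideanSpace ℝ (Fin n)}
    (hG : ContDiffOn ℝ 2 G Ω) (hL : IsLagrangian (n := n) (flatJ n) (graphMap Ω G)) :
    (∃! θ : Ω → Real.Angle, IsPhase (flatDz n) (graphMap Ω G) (stdOrientation Ω) θ) ∧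
      ∀ θ : Ω → Real.Angle, IsPhase (flatDz n) (graphMap Ω G) (stdOrientation Ω) θ →
        ∀ p : Ω, PhaseGradientFormula (n := n) (flatJ n) (graphMap Ω G) θ p := by
  have hinj : ∀ p : Ω, Function.Injective (dmap (n := n) (E := CSpace n) (graphMap Ω G) p) :=
    fun p => injective_dmap_graphMap
      ((hG.contDiffAt (Ω.isOpen.mem_nhds p.2)).differentiableAt (by norm_num))
  refine ⟨existsUnique_isPhase (flatCalabiYau n) hn hinj hL _, fun θ hθ p => ?_⟩
  exact phaseGradientFormula_of_contMDiff (flatCalabiYau n) hn (contMDiff_graphMap hG) hinj hL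
    isContinuousOrientation_stdOrientation hθ

end OpenSubset

/-! ### The operator `tr arctan` on symmetric matrices -/

section TraceArctan

variable {n : ℕ}

theorem Matrix.IsHermitian.exists_diagonalization {A : Matrix (Fin n) (Fin n) ℝ}
    (hA : A.IsHermitian) (f : ℝ → ℝ) :
    ∃ (U V : Matrix (Fin n) (Fin n) ℝ) (l : Fin n → ℝ), U * V = 1 ∧ V * U = 1 ∧
      A = U * Matrix.diagonal l * V ∧ cfc f A = U * Matrix.diagonal (fun i => f (l i)) * V := by
  refine ⟨hA.eigenvectorUnitary, star (hA.eigenvectorUnitary : Matrix (Fin n) (Fin n) ℝ),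
    hA.eigenvalues, ?_, ?_, ?_, ?_⟩
  · exact Unitary.mul_star_self_of_mem hA.eigenvectorUnitary.2
  · exact Unitary.star_mul_self_of_mem hA.eigenvectorUnitary.2
  · conv_lhs => rw [hA.spectral_theorem]
    rfl
  · rw [hA.cfc_eq]
    rfl

/-- The matrix `1 + iA`. Its rows are the complex coordinates of the tangent vectors to the graph
of a map with derivative `A`. -/
noncomputable def onePlusI (A : Matrix (Fin n) (Fin n) ℝ) : Matrix (Fin n) (Fin n) ℂ :=
  1 + Complex.I • A.map (fun r : ℝ => (r : ℂ))

theorem one_add_I_mul_eq (l : ℝ) : (1 : ℂ) + Complex.I * l =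
    Complex.exp (Real.arctan l * Complex.I) * (√(1 + l ^ 2) : ℝ) := by
  have h : (0 : ℝ) < √(1 + l ^ 2) := Real.sqrt_pos.mpr (by positivity)
  rw [Complex.exp_mul_I, ← Complex.ofReal_cos, ← Complex.ofReal_sin, Real.cos_arctan,
    Real.sin_arctan]
  have h' : ((√(1 + l ^ 2) : ℝ) : ℂ) ≠ 0 := Complex.ofReal_ne_zero.mpr h.ne'
  push_cast
  field_simp

/-- `det (1 + iA) = e^{i tr arctan A} |det (1 + iA)|`: for an eigenvalue `l` of `A`, the argument
of `1 + il` is `arctan l`. -/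
theorem det_onePlusI {A : Matrix (Fin n) (Fin n) ℝ} (hA : A.IsHermitian) :
    (onePlusI A).det = Complex.exp ((cfc Real.arctan A).trace * Complex.I) *
      (‖(onePlusI A).det‖ : ℝ) ∧ (onePlusI A).det ≠ 0 := by
  obtain ⟨U, V, l, hUV, hVU, hAl, hcfc⟩ := hA.exists_diagonalization Real.arctan
  let c : Matrix (Fin n) (Fin n) ℝ →+* Matrix (Fin n) (Fin n) ℂ := Complex.ofRealHom.mapMatrix
  have hcUV : c U * c V = 1 := by rw [← map_mul, hUV, map_one]
  have h1 : onePlusI A = c U * Matrix.diagonal (fun i => 1 + Complex.I * (l i : ℂ)) * c V := by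
    have hd : Matrix.diagonal (fun i => 1 + Complex.I * (l i : ℂ)) =
        1 + Complex.I • c (Matrix.diagonal l) := by
      ext i j
      by_cases h : i = j
      · subst h
        simp [c]
      · simp [c, h]
    have hAc : A.map (fun r : ℝ => (r : ℂ)) = c U * c (Matrix.diagonal l) * c V := by
      rw [← map_mul, ← map_mul, ← hAl]
      rfl
    rw [onePlusI, hd, hAc, mul_add, add_mul, mul_one, hcUV, Matrix.mul_smul, Matrix.smul_mul]
  have h2 : (onePlusI A).det = ∏ i, (1 + Complex.I * (l i : ℂ)) := by
    rw [h1, Matrix.det_mul, Matrix.det_mul, mul_right_comm, ← Matrix.det_mul, hcUV,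
      Matrix.det_one, one_mul, Matrix.det_diagonal]
  have h3 : (cfc Real.arctan A).trace = ∑ i, Real.arctan (l i) := by
    rw [hcfc, Matrix.trace_mul_comm, ← mul_assoc, hVU, one_mul, Matrix.trace_diagonal]
  have h4 : (onePlusI A).det = Complex.exp ((cfc Real.arctan A).trace * Complex.I) *
      ((∏ i, √(1 + l i ^ 2) : ℝ) : ℂ) := by
    rw [h2, h3, Finset.prod_congr rfl fun i _ => one_add_I_mul_eq (l i), Finset.prod_mul_distrib,
      ← Complex.exp_sum]
    push_cast
    rw [Finset.sum_mul]
  have hpos : 0 < ∏ i, √(1 + l i ^ 2) :=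
    Finset.prod_pos fun i _ => Real.sqrt_pos.mpr (by positivity)
  have hnorm : ‖(onePlusI A).det‖ = ∏ i, √(1 + l i ^ 2) := by
    rw [h4, norm_mul, Complex.norm_exp_ofReal_mul_I, one_mul, Complex.norm_real,
      Real.norm_of_nonneg hpos.le]
  refine ⟨by rw [hnorm]; exact h4, ?_⟩
  rw [← norm_ne_zero_iff, hnorm]
  exact hpos.ne'

/-- `tr arctan A = ∫₀¹ tr (A (1 + t² A²)⁻¹) dt`, because `arctan l = ∫₀¹ l / (1 + t² l²) dt`. -/
theorem trace_cfc_arctan_eq_integral {A : Matrix (Fin n) (Fin n) ℝ} (hA : A.IsHermitian) :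
    (∀ t : ℝ, (1 + t ^ 2 • (A * A)).det ≠ 0) ∧ (cfc Real.arctan A).trace =
      ∫ t in (0 : ℝ)..1, (A * (1 + t ^ 2 • (A * A)).adjugate).trace /
        (1 + t ^ 2 • (A * A)).det := by
  obtain ⟨U, V, l, hUV, hVU, hAl, hcfc⟩ := hA.exists_diagonalization Real.arctan
  have hconj : ∀ D D' : Matrix (Fin n) (Fin n) ℝ, U * D * V * (U * D' * V) = U * (D * D') * V := by
    intro D D'
    calc U * D * V * (U * D' * V) = U * D * (V * U) * D' * V := by simp only [mul_assoc]
      _ = U * (D * D') * V := by rw [hVU, mul_one, mul_assoc U]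
  have hM : ∀ t : ℝ, 1 + t ^ 2 • (A * A) =
      U * Matrix.diagonal (fun i => 1 + t ^ 2 * l i ^ 2) * V := by
    intro t
    have hd : Matrix.diagonal (fun i => 1 + t ^ 2 * l i ^ 2) =
        1 + t ^ 2 • (Matrix.diagonal l * Matrix.diagonal l) := by
      ext i j
      by_cases h : i = j
      · subst h
        simp [sq]
      · simp [h]
    rw [hd, mul_add, add_mul, mul_one, hUV, Matrix.mul_smul, Matrix.smul_mul, ← hconj, ← hAl]
  have hpos : ∀ (t : ℝ) i, 0 < 1 + t ^ 2 * l i ^ 2 := fun t i => by positivity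
  have hdet : ∀ t : ℝ, (1 + t ^ 2 • (A * A)).det ≠ 0 := by
    intro t
    rw [hM, Matrix.det_mul, Matrix.det_mul, mul_right_comm, ← Matrix.det_mul, hUV,
      Matrix.det_one, one_mul, Matrix.det_diagonal]
    exact (Finset.prod_pos fun i _ => hpos t i).ne'
  have hint : ∀ t : ℝ, (A * (1 + t ^ 2 • (A * A)).adjugate).trace / (1 + t ^ 2 • (A * A)).det =
      ∑ i, l i / (1 + t ^ 2 * l i ^ 2) := by
    intro t
    let N := U * Matrix.diagonal (fun i => l i / (1 + t ^ 2 * l i ^ 2)) * V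
    have hN : A = N * (1 + t ^ 2 • (A * A)) := by
      rw [hM, hconj, Matrix.diagonal_mul_diagonal]
      conv_lhs => rw [hAl]
      congr 3
      funext i
      have := (hpos t i).ne'
      field_simp
    rw [div_eq_iff (hdet t)]
    conv_lhs => rw [hN, mul_assoc, ← hN, Matrix.mul_adjugate, Matrix.mul_smul, mul_one,
      Matrix.trace_smul]
    rw [Matrix.trace_mul_comm, ← mul_assoc, hVU, one_mul, Matrix.trace_diagonal, smul_eq_mul,
      mul_comm]
  refine ⟨hdet, ?_⟩
  have h3 : (cfc Real.arctan A).trace = ∑ i, Real.arctan (l i) := by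
    rw [hcfc, Matrix.trace_mul_comm, ← mul_assoc, hVU, one_mul, Matrix.trace_diagonal]
  have hc : ∀ i, Continuous fun t : ℝ => l i / (1 + t ^ 2 * l i ^ 2) := fun i =>
    continuous_const.div (by fun_prop) fun t => (hpos t i).ne'
  simp only [hint]
  rw [h3, intervalIntegral.integral_finsetSum fun i _ => (hc i).intervalIntegrable _ _]
  refine Finset.sum_congr rfl fun i _ => ?_
  have hd : ∀ t ∈ Set.uIcc (0 : ℝ) 1, HasDerivAt (fun t => Real.arctan (t * l i))
      (l i / (1 + t ^ 2 * l i ^ 2)) t := by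
    intro t _
    have h := ((hasDerivAt_id t).mul_const (l i)).arctan
    have hl : l i / (1 + t ^ 2 * l i ^ 2) = 1 / (1 + (t * l i) ^ 2) * (1 * l i) := by ring
    rw [hl]
    exact h
  rw [intervalIntegral.integral_eq_sub_of_hasDerivAt hd ((hc i).intervalIntegrable _ _)]
  simp

/-- The integrand of `trace_cfc_arctan_eq_integral` depends continuously on the entries of `A`. -/
theorem continuous_trace_cfc_arctan {Y : Type*} [TopologicalSpace Y] [FirstCountableTopology Y]
    [LocallyCompactSpace Y]
    {A : Y → Matrix (Fin n) (Fin n) ℝ} (hA : Continuous A) (hH : ∀ y, (A y).IsHermitian) :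
    Continuous fun y => (cfc Real.arctan (A y)).trace := by
  simp only [fun y => (trace_cfc_arctan_eq_integral (hH y)).2]
  refine intervalIntegral.continuous_parametric_intervalIntegral_of_continuous' ?_ 0 1
  have hA' : Continuous fun q : Y × ℝ => A q.1 := hA.comp continuous_fst
  have hM : Continuous fun q : Y × ℝ => 1 + q.2 ^ 2 • (A q.1 * A q.1) :=
    continuous_const.add ((continuous_snd.pow 2).smul (hA'.mul hA'))
  exact ((hA'.mul hM.matrix_adjugate).matrix_trace).div hM.matrix_det
    fun q => (trace_cfc_arctan_eq_integral (hH q.1)).1 q.2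

end TraceArctan

/-! ### Graphs of gradients of functions of class `C²` -/

section GradientGraph

variable {n : ℕ}

theorem Module.Basis.someVector_orientation_pos {M : Type*} [AddCommGroup M] [Module ℝ M]
    (b : Module.Basis (Fin n) ℝ M) : 0 < b.orientation.someVector b := by
  have h : rayOfNeZero ℝ b.orientation.someVector b.orientation.someVector_ne_zero =
      rayOfNeZero ℝ b.det b.det_ne_zero := Module.Ray.someVector_ray b.orientation
  obtain ⟨r, hr, hr'⟩ := ((ray_eq_iff _ _).mp h).symm.exists_pos_left b.det_ne_zero
    b.orientation.someVector_ne_zero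
  rw [← hr', AlternatingMap.smul_apply, b.det_self, smul_eq_mul, mul_one]
  exact hr

theorem differentiableAt_comp_id_prod {U W V : Type*} [NormedAddCommGroup U] [NormedSpace ℝ U]
    [NormedAddCommGroup W] [NormedSpace ℝ W] [NormedAddCommGroup V] [NormedSpace ℝ V]
    (A : U × U →L[ℝ] W) (T : V →L[ℝ] U) {B : U → U →L[ℝ] V} {x : U} (hB : DifferentiableAt ℝ B x) :
    DifferentiableAt ℝ (fun y => A.comp ((ContinuousLinearMap.id ℝ U).prod (T.comp (B y)))) x := by
  have h : (fun y => A.comp ((ContinuousLinearMap.id ℝ U).prod (T.comp (B y)))) =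
      fun y => A.comp ((ContinuousLinearMap.inl ℝ U U)) +
        (A.comp ((ContinuousLinearMap.inr ℝ U U).comp T)).comp (B y) := by
    funext y
    ext v
    simp [← map_add]
  rw [h]
  exact ((differentiableAt_const _).clm_comp hB).const_add _

/-- The isomorphism from the dual of `ℝⁿ` to `ℝⁿ`, in coordinates. -/
noncomputable def dualToVec (n : ℕ) :
    (EuclideanSpace ℝ (Fin n) →L[ℝ] ℝ) →L[ℝ] EuclideanSpace ℝ (Fin n) :=
  (EuclideanSpace.equiv (Fin n) ℝ).symm.toContinuousLinearMap.comp
    (ContinuousLinearMap.pi fun j =>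
      ContinuousLinearMap.apply ℝ ℝ (EuclideanSpace.single j (1 : ℝ)))

theorem dualToVec_apply (l : EuclideanSpace ℝ (Fin n) →L[ℝ] ℝ) (j : Fin n) :
    dualToVec n l j = l (EuclideanSpace.single j 1) := rfl

theorem dualToVec_eq (l : EuclideanSpace ℝ (Fin n) →L[ℝ] ℝ) :
    dualToVec n l = (InnerProductSpace.toDual ℝ (EuclideanSpace ℝ (Fin n))).symm l := by
  ext j
  rw [dualToVec_apply, ← InnerProductSpace.toDual_symm_apply (𝕜 := ℝ),
    EuclideanSpace.inner_single_right]
  simp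

theorem inner_dualToVec (l : EuclideanSpace ℝ (Fin n) →L[ℝ] ℝ) (w : EuclideanSpace ℝ (Fin n)) :
    ⟪dualToVec n l, w⟫ = l w := by
  rw [dualToVec_eq, InnerProductSpace.toDual_symm_apply]

theorem gradient_eq_dualToVec (u : EuclideanSpace ℝ (Fin n) → ℝ) :
    gradient u = fun x => dualToVec n (fderiv ℝ u x) := by
  funext x
  rw [dualToVec_eq]
  rfl

theorem hasFDerivAt_gradient {u : EuclideanSpace ℝ (Fin n) → ℝ} {x : EuclideanSpace ℝ (Fin n)}
    (hu : DifferentiableAt ℝ (fderiv ℝ u) x) :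
    HasFDerivAt (gradient u) ((dualToVec n).comp (fderiv ℝ (fderiv ℝ u) x)) x := by
  rw [gradient_eq_dualToVec]
  exact (dualToVec n).hasFDerivAt.comp x hu.hasFDerivAt

theorem fderiv_gradient_apply {u : EuclideanSpace ℝ (Fin n) → ℝ} {x : EuclideanSpace ℝ (Fin n)}
    (hu : DifferentiableAt ℝ (fderiv ℝ u) x) (v : EuclideanSpace ℝ (Fin n)) :
    fderiv ℝ (gradient u) x v = dualToVec n (fderiv ℝ (fderiv ℝ u) x v) := by
  rw [(hasFDerivAt_gradient hu).fderiv]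
  rfl

theorem fderiv_gradient_single {u : EuclideanSpace ℝ (Fin n) → ℝ} {x : EuclideanSpace ℝ (Fin n)}
    (hu : DifferentiableAt ℝ (fderiv ℝ u) x) (i j : Fin n) :
    fderiv ℝ (gradient u) x (EuclideanSpace.single i 1) j = hessianMatrix u x i j := by
  rw [fderiv_gradient_apply hu, dualToVec_apply]
  rfl

theorem isHermitian_hessianMatrix {u : EuclideanSpace ℝ (Fin n) → ℝ}
    {x : EuclideanSpace ℝ (Fin n)} (hu : ContDiffAt ℝ 2 u x) : (hessianMatrix u x).IsHermitian := by
  ext i j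
  exact hu.isSymmSndFDerivAt (by simp) _ _

variable {Ω : TopologicalSpace.Opens (EuclideanSpace ℝ (Fin n))}
  {u : EuclideanSpace ℝ (Fin n) → ℝ}

theorem differentiableAt_fderiv_of_contDiffAt {x : EuclideanSpace ℝ (Fin n)}
    (hu : ContDiffAt ℝ 2 u x) : DifferentiableAt ℝ (fderiv ℝ u) x :=
  (hu.fderiv_right (m := 1) (by norm_num)).differentiableAt (by norm_num)

theorem continuousOn_hessianMatrix (hu : ContDiffOn ℝ 2 u Ω) :
    ContinuousOn (hessianMatrix u) Ω := by
  intro x hx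
  have h : ContinuousAt (fderiv ℝ (fderiv ℝ u)) x :=
    (((hu.contDiffAt (Ω.isOpen.mem_nhds hx)).fderiv_right (m := 1) (by norm_num)).fderiv_right
      (m := 0) (by norm_num)).continuousAt
  refine ContinuousAt.continuousWithinAt ?_
  refine continuousAt_pi.mpr fun i => continuousAt_pi.mpr fun j => ?_
  exact (h.clm_apply continuousAt_const).clm_apply continuousAt_const

theorem continuous_trArctan (hu : ContDiffOn ℝ 2 u Ω) : Continuous fun q : Ω => trArctan u q := by
  have : LocallyCompactSpace Ω := Ω.isOpen.locallyCompactSpace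
  exact continuous_trace_cfc_arctan (A := fun q : Ω => hessianMatrix u q)
    (continuousOn_iff_continuous_domRestrict.mp (continuousOn_hessianMatrix hu))
    fun q => isHermitian_hessianMatrix (hu.contDiffAt (Ω.isOpen.mem_nhds q.2))

/-- The graph of a gradient is Lagrangian because the Hessian is symmetric. -/
theorem isLagrangian_graphMap_gradient (hu : ContDiffOn ℝ 2 u Ω) :
    IsLagrangian (n := n) (flatJ n) (graphMap Ω (gradient u)) := by
  intro p v w
  have hu' := hu.contDiffAt (Ω.isOpen.mem_nhds p.2)
  have hd := differentiableAt_fderiv_of_contDiffAt hu'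
  have hg := (hasFDerivAt_gradient hd).differentiableAt
  rw [inner_tangentSpace_vectorSpace, tangentCoords_flatJ, tangentCoords_dmap_graphMap hg,
    tangentCoords_dmap_graphMap hg, fderiv_gradient_apply hd, fderiv_gradient_apply hd]
  set a := tangentCoords p v
  set b := tangentCoords p w
  have hsymm : fderiv ℝ (fderiv ℝ u) p a b = fderiv ℝ (fderiv ℝ u) p b a :=
    hu'.isSymmSndFDerivAt (by simp) a b
  simp only [mulI, WithLp.prod_inner_apply, inner_neg_left]
  change -⟪dualToVec n (fderiv ℝ (fderiv ℝ u) p a), b⟫ +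
    ⟪a, dualToVec n (fderiv ℝ (fderiv ℝ u) p b)⟫ = 0
  rw [inner_dualToVec, real_inner_comm, inner_dualToVec, hsymm]
  ring

/-- The coordinate frame of the graph of `∇u` has complex coordinates `1 + i D²u`. -/
theorem dmap_coordBasis_graph (hu : ContDiffOn ℝ 2 u Ω) (p : Ω) :
    (Matrix.of fun i => complexCoords n (tangentCoords (graphMap Ω (gradient u) p)
      (dmap (n := n) (E := CSpace n) (graphMap Ω (gradient u)) p (coordBasis p i)))) =
    onePlusI (hessianMatrix u p) := by
  have hd := differentiableAt_fderiv_of_contDiffAt (hu.contDiffAt (Ω.isOpen.mem_nhds p.2))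
  have hg := (hasFDerivAt_gradient hd).differentiableAt
  ext i j
  rw [Matrix.of_apply, tangentCoords_dmap_graphMap hg]
  have hc : tangentCoords p (coordBasis (n := n) p i) = EuclideanSpace.single i 1 := by
    simp [coordBasis]
  rw [hc]
  simp only [complexCoords, LinearMap.coe_mk, AddHom.coe_mk, onePlusI,
    Matrix.add_apply, Matrix.smul_apply, Matrix.map_apply, smul_eq_mul, Matrix.one_apply]
  by_cases h : i = j
  · subst h
    simp [fderiv_gradient_single hd]
  · simp [h, Ne.symm h, fderiv_gradient_single hd]

/-- The phase of the graph of `∇u` is `tr arctan D²u`. -/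
theorem isPhase_trArctan (hn : 1 ≤ n) (hu : ContDiffOn ℝ 2 u Ω) :
    IsPhase (flatDz n) (graphMap Ω (gradient u)) (stdOrientation Ω)
      (fun p : Ω => ((trArctan u p : ℝ) : Real.Angle)) := by
  intro p
  have hu' := hu.contDiffAt (Ω.isOpen.mem_nhds p.2)
  have hg := (hasFDerivAt_gradient (differentiableAt_fderiv_of_contDiffAt hu')).differentiableAt
  obtain ⟨κ, hκ, h⟩ := exists_phaseFactor (flatCalabiYau n) hn (injective_dmap_graphMap hg)
    (isLagrangian_graphMap_gradient hu) (stdOrientation Ω)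
  set a : ℝ := (stdOrientation Ω p).someVector (coordBasis p) with ha
  have hapos : 0 < a := by
    rw [← sign_eq_one_iff, ha, stdOrientation, Orientation.sign_someVector_map, sign_eq_one_iff]
    have hb : (fun i => (tangentCoords p).symm.toLinearEquiv.symm (coordBasis (n := n) p i)) =
        (EuclideanSpace.basisFun (Fin n) ℝ).toBasis := by
      funext i
      rw [OrthonormalBasis.coe_toBasis, EuclideanSpace.basisFun_apply]
      simp [coordBasis]
    rw [hb]
    exact Module.Basis.someVector_orientation_pos _
  have hdet : (onePlusI (hessianMatrix u p)).det = (a : ℂ) * κ := by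
    rw [← dmap_coordBasis_graph hu p]
    exact (h (coordBasis p)).1
  have hph := (det_onePlusI (isHermitian_hessianMatrix hu')).1
  have hac : (a : ℂ) ≠ 0 := Complex.ofReal_ne_zero.mpr hapos.ne'
  have hκ' : κ = ((trArctan u p : Real.Angle).toCircle : ℂ) * ‖κ‖ := by
    rw [hdet, norm_mul, Complex.norm_real, Real.norm_of_nonneg hapos.le] at hph
    rw [Real.Angle.toCircle_coe, Circle.coe_exp]
    apply mul_left_cancel₀ hac
    rw [hph, trArctan]
    push_cast
    ring
  intro v
  refine (h v).1.trans ?_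
  rw [(h v).2]
  conv_lhs => rw [hκ']
  push_cast
  ring

/-- Two functions which agree modulo `2π` and are continuous at `p` differ by a constant near
`p`. -/
theorem eventually_eq_add_const_of_angle_eq {Y : Type*} [TopologicalSpace Y] {p : Y} {f g : Y → ℝ}
    (hf : ContinuousAt f p) (hg : ContinuousAt g p)
    (h : ∀ᶠ q in 𝓝 p, (f q : Real.Angle) = (g q : Real.Angle)) :
    ∀ᶠ q in 𝓝 p, f q = g q + (f p - g p) := by
  obtain ⟨k, hk⟩ := Real.Angle.angle_eq_iff_two_pi_dvd_sub.mp h.self_of_nhds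
  have hc := Metric.continuousAt_iff'.mp (hf.sub hg) (2 * Real.pi) (by positivity)
  filter_upwards [h, hc] with q hq hq'
  obtain ⟨m, hm⟩ := Real.Angle.angle_eq_iff_two_pi_dvd_sub.mp hq
  rw [Real.dist_eq, Pi.sub_apply, Pi.sub_apply, hm, hk, ← mul_sub, abs_mul,
    abs_of_pos (by positivity : 0 < 2 * Real.pi)] at hq'
  have h1 : |(m : ℝ) - k| < 1 := by
    by_contra hcon
    nlinarith [Real.pi_pos]
  have h2 : m = k := by
    have : |m - k| < 1 := by exact_mod_cast h1
    rw [Int.abs_lt_one_iff] at this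
    omega
  rw [h2, ← hk] at hm
  linarith

/-- The formula `∇θ = -JH` for `θ = tr arctan D²u`, at points where `D²u` is differentiable. There
the phase has a local representative differentiable at `p`, from which `θ` differs by a
constant. -/
theorem trArctan_gradient_formula (hn : 1 ≤ n) (hu : ContDiffOn ℝ 2 u Ω) (p : Ω)
    (hp : DifferentiableAt ℝ (fderiv ℝ (fderiv ℝ u)) (p : EuclideanSpace ℝ (Fin n))) :
    MDifferentiableAt (𝓡 n) 𝓘(ℝ, ℝ) (fun q : Ω => trArctan u q) p ∧
      inducedGradient (n := n) (E := CSpace n) (graphMap Ω (gradient u))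
          (fun q : Ω => trArctan u q) p =
        -(flatJ n _ (meanCurvature (n := n) (E := CSpace n) (graphMap Ω (gradient u)) p)) := by
  have hd : ∀ q ∈ Ω, DifferentiableAt ℝ (fderiv ℝ u) q := fun q hq =>
    differentiableAt_fderiv_of_contDiffAt (hu.contDiffAt (Ω.isOpen.mem_nhds hq))
  have hF : ∀ q ∈ Ω, DifferentiableAt ℝ (graphFun (gradient u)) q := fun q hq =>
    differentiableAt_graphFun (hasFDerivAt_gradient (hd q hq)).differentiableAt
  have hF2 : DifferentiableAt ℝ (fderiv ℝ (graphFun (gradient u))) p := by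
    have h : fderiv ℝ (graphFun (gradient u)) =ᶠ[𝓝 (p : EuclideanSpace ℝ (Fin n))]
        fun x => (toCSpaceL n).comp ((ContinuousLinearMap.id ℝ _).prod
          ((dualToVec n).comp (fderiv ℝ (fderiv ℝ u) x))) := by
      filter_upwards [Ω.isOpen.mem_nhds p.2] with x hx
      ext1 v
      rw [fderiv_graphFun_apply (hasFDerivAt_gradient (hd x hx)).differentiableAt,
        fderiv_gradient_apply (hd x hx)]
      rfl
    exact (differentiableAt_comp_id_prod (toCSpaceL n) (dualToVec n) hp).congr_of_eventuallyEq h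
  have htwice : TwiceMDifferentiableAt (n := n) (E := CSpace n) (graphMap Ω (gradient u)) p :=
    twiceMDifferentiableAt_opens hF hF2
  have hinj : ∀ p : Ω, Function.Injective
      (dmap (n := n) (E := CSpace n) (graphMap Ω (gradient u)) p) :=
    fun q => injective_dmap_graphMap (hasFDerivAt_gradient (hd q q.2)).differentiableAt
  have hL := isLagrangian_graphMap_gradient hu
  have hθ := isPhase_trArctan hn hu
  have ho := isContinuousOrientation_stdOrientation (Ω := Ω)
  obtain ⟨φ, hφ, hφd, -⟩ := exists_localLift (flatCalabiYau n) (p := p) hn htwice.1 hinj hL ho hθ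
  obtain ⟨D, hD, -⟩ := hasFDerivAt_coordForm (flatCalabiYau n) (hinj p) hL htwice
  have hφm : MDifferentiableAt (𝓡 n) 𝓘(ℝ, ℝ) (fun q : Ω => φ q) p :=
    mdifferentiableAt_opens (hφd hD.differentiableAt)
  have hev := eventually_eq_add_const_of_angle_eq (continuous_trArctan hu).continuousAt
    hφm.continuousAt (hφ.mono fun q hq => hq.symm)
  have hm : MDifferentiableAt (𝓡 n) 𝓘(ℝ, ℝ) (fun q : Ω => trArctan u q) p :=
    (hφm.add mdifferentiableAt_const).congr_of_eventuallyEq hev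
  refine ⟨hm, ?_⟩
  exact inducedGradient_eq_of_dirDeriv (flatCalabiYau n) (hinj p) hL _
    (dirDeriv_phase_eq (flatCalabiYau n) hn hinj hL htwice ho hθ hm
      (Filter.Eventually.of_forall fun q => rfl))

end GradientGraph

/-! ### The Piola identity for maps of class `C¹` -/

section Piola

open MeasureTheory

variable {n : ℕ}

/-- A compactly supported map of class `C¹` can be smoothed with uniformly small change of its
derivative. -/
theorem exists_contDiff_fderiv_approx {V W : Type*} [NormedAddCommGroup V] [NormedSpace ℝ V]
    [FiniteDimensional ℝ V] [NormedAddCommGroup W] [NormedSpace ℝ W] [CompleteSpace W]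
    {F : V → W} (hF : ContDiff ℝ 1 F) (hc : HasCompactSupport F) {ε : ℝ} (hε : 0 < ε) :
    ∃ G : V → W, ContDiff ℝ ∞ G ∧ ∀ x, dist (fderiv ℝ G x) (fderiv ℝ F x) ≤ ε := by
  borelize V
  let μ : Measure V := Measure.addHaar
  have hcont : Continuous (fderiv ℝ F) := hF.continuous_fderiv (by norm_num)
  have hunif : UniformContinuous (fderiv ℝ F) :=
    (hc.fderiv ℝ).uniformContinuous_of_continuous hcont
  obtain ⟨δ, hδ, hd⟩ := Metric.uniformContinuous_iff.mp hunif ε hε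
  let ρ : ContDiffBump (0 : V) := ⟨δ / 2, δ, by positivity, by linarith⟩
  have hρ : LocallyIntegrable (ρ.normed μ) μ := ρ.continuous_normed.locallyIntegrable
  refine ⟨MeasureTheory.convolution (ρ.normed μ) F (ContinuousLinearMap.lsmul ℝ ℝ) μ,
    ρ.hasCompactSupport_normed.contDiff_convolution_left _ ρ.contDiff_normed
      hF.continuous.locallyIntegrable, fun x => ?_⟩
  rw [(hc.hasFDerivAt_convolution_right (ContinuousLinearMap.lsmul ℝ ℝ) hρ hF x).fderiv]
  exact ρ.dist_normed_convolution_le (μ := μ) hcont.aestronglyMeasurable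
    fun y hy => (hd (Metric.mem_ball.mp hy)).le

/-- The Jacobian matrix of `F`, with rows `∂ᵢ F`. -/
noncomputable def jacobianRows (F : EuclideanSpace ℝ (Fin n) → Fin n → ℂ)
    (x : EuclideanSpace ℝ (Fin n)) : Matrix (Fin n) (Fin n) ℂ :=
  Matrix.of fun i => fderiv ℝ F x (EuclideanSpace.single i 1)

theorem continuous_jacobianRows {F : EuclideanSpace ℝ (Fin n) → Fin n → ℂ} (hF : ContDiff ℝ 1 F) :
    Continuous (jacobianRows F) :=
  continuous_pi fun _ => (hF.continuous_fderiv (by norm_num)).clm_apply continuous_const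

theorem sum_sum_eq_zero_of_antisymm {ι : Type*} [Fintype ι] {T : ι → ι → ℂ}
    (h : ∀ i j, T i j = -T j i) : ∑ i, ∑ j, T i j = 0 := by
  rw [← self_eq_neg]
  conv_lhs => rw [Finset.sum_comm]
  rw [← Finset.sum_neg_distrib]
  refine Finset.sum_congr rfl fun j _ => ?_
  rw [← Finset.sum_neg_distrib]
  exact Finset.sum_congr rfl fun i _ => h i j

/-- The rows of the cofactor matrix of a Jacobian matrix are divergence free, because second
derivatives are symmetric and determinants are alternating. -/
theorem exists_hasFDerivAt_adjugate {F : EuclideanSpace ℝ (Fin n) → Fin n → ℂ}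
    (hF : ContDiff ℝ 2 F) (k : Fin n) (x : EuclideanSpace ℝ (Fin n)) :
    ∃ D : Fin n → EuclideanSpace ℝ (Fin n) →L[ℝ] ℂ,
      (∀ i, HasFDerivAt (fun y => (jacobianRows F y).adjugate k i) (D i) x) ∧
      ∑ i, D i (EuclideanSpace.single i 1) = 0 := by
  let e : Fin n → EuclideanSpace ℝ (Fin n) := fun i => EuclideanSpace.single i 1
  let R : EuclideanSpace ℝ (Fin n) → Fin n → Fin n → ℂ := fun y j => fderiv ℝ F y (e j)
  let H : Fin n → Fin n → Fin n → ℂ := fun i j => fderiv ℝ (fderiv ℝ F) x (e i) (e j)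
  have hH : ∀ i j, H i j = H j i := fun i j =>
    hF.contDiffAt.isSymmSndFDerivAt (by simp) _ _
  let c : Fin n → ℂ := Pi.single k 1
  have hdF : HasFDerivAt (fderiv ℝ F) (fderiv ℝ (fderiv ℝ F) x) x :=
    ((hF.fderiv_right (m := 1) (by norm_num)).differentiable (by norm_num) x).hasFDerivAt
  let ev : Fin n → (EuclideanSpace ℝ (Fin n) →L[ℝ] (Fin n → ℂ)) →L[ℝ] (Fin n → ℂ) := fun j =>
    ContinuousLinearMap.apply ℝ _ (e j)
  let d : MultilinearMap ℝ (fun _ : Fin n => Fin n → ℂ) ℂ :=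
    (Matrix.detRowAlternating (n := Fin n) (R := ℂ)).toMultilinearMap.restrictScalars ℝ
  have hrow : ∀ i j, HasFDerivAt (fun y => Function.update (R y) i c j)
      (if j = i then 0 else (ev j).comp (fderiv ℝ (fderiv ℝ F) x)) x := by
    intro i j
    by_cases h : j = i
    · subst h
      simp only [Function.update_self, if_true]
      exact hasFDerivAt_const _ _
    · simp only [Function.update_of_ne h, if_neg h]
      exact (ev j).hasFDerivAt.comp x hdF
  choose D hD hD' using fun i => HasFDerivAt.multilinearFamily (M := fun _ : ℝ => d)
    (y := fun _ => (0 : ℝ)) (fun b => differentiableAt_const _) (hasFDerivAt_const (0 : ℝ) x)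
    (hrow i)
  refine ⟨D, fun i => ?_, ?_⟩
  · have h : (fun y => (jacobianRows F y).adjugate k i) =
        fun y => d (Function.update (R y) i c) := by
      funext y
      rw [Matrix.adjugate_apply]
      rfl
    rw [h]
    exact hD i
  · -- `T i j` is the contribution of `∂ᵢ ∂ⱼ F`; it is antisymmetric in `i` and `j`
    let T : Fin n → Fin n → ℂ := fun i j => if j = i then 0 else
      Matrix.detRowAlternating (Function.update (Function.update (R x) i c) j (H i j))
    have hT : ∀ i, D i (e i) = ∑ j, T i j := by
      intro i
      rw [hD' i]
      simp only [fderiv_fun_const, Pi.zero_apply, zero_apply, zero_add]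
      refine Finset.sum_congr rfl fun j _ => ?_
      by_cases h : j = i
      · simp only [T, if_pos h, zero_apply]
        exact d.map_update_zero _ _
      · simp only [T, if_neg h]
        rfl
    rw [Finset.sum_congr rfl fun i _ => hT i]
    refine sum_sum_eq_zero_of_antisymm fun i j => ?_
    by_cases h : j = i
    · simp [T, h]
    · simp only [T, if_neg h, if_neg (Ne.symm h)]
      rw [← AlternatingMap.map_swap _ _ h, hH i j]
      congr 1
      rw [Function.update_comm (Ne.symm h)]
      funext l
      by_cases hi : l = i
      · subst hi
        simp [Function.update_of_ne h]
      · by_cases hj : l = j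
        · subst hj
          simp [Function.update_of_ne h]
        · simp [Function.comp_apply, Equiv.swap_apply_of_ne_of_ne hj hi, Function.update_of_ne hi,
            Function.update_of_ne hj]

/-- The Piola identity for maps of class `C²`, by integration by parts. -/
theorem integral_adjugate_mul_fderiv_of_contDiff_two {F : EuclideanSpace ℝ (Fin n) → Fin n → ℂ}
    (hF : ContDiff ℝ 2 F) {φ : EuclideanSpace ℝ (Fin n) → ℂ} (hφ : ContDiff ℝ 1 φ)
    (hc : HasCompactSupport φ) (k : Fin n) :
    ∫ x, ∑ i, (jacobianRows F x).adjugate k i * fderiv ℝ φ x (EuclideanSpace.single i 1) = 0 := by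
  choose D hD hD' using exists_hasFDerivAt_adjugate hF k
  have ha : ∀ i, ContDiff ℝ 1 fun y => (jacobianRows F y).adjugate k i := by
    intro i
    rw [contDiff_iff_contDiffAt]
    intro x
    have h : (fun y => (jacobianRows F y).adjugate k i) = fun y =>
        (Matrix.detRowAlternating (n := Fin n) (R := ℂ)).toMultilinearMap.restrictScalars ℝ
          (fun j => Function.update (fun j => fderiv ℝ F y (EuclideanSpace.single j 1)) i
            (Pi.single k 1 : Fin n → ℂ) j) := by
      funext y
      rw [Matrix.adjugate_apply]
      rfl
    rw [h]
    refine ContDiffAt.multilinearFamily (y := fun _ => (0 : ℝ))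
      (M := fun _ => (Matrix.detRowAlternating (n := Fin n)
        (R := ℂ)).toMultilinearMap.restrictScalars ℝ)
      (fun _ => contDiffAt_const) contDiffAt_const fun j => ?_
    by_cases hj : j = i
    · subst hj
      simp only [Function.update_self]
      exact contDiffAt_const
    · simp only [Function.update_of_ne hj]
      exact ((hF.fderiv_right (m := 1) (by norm_num)).clm_apply contDiff_const).contDiffAt
  have hac := fun i => (ha i).continuous
  have hφd : ∀ i, Continuous fun x => fderiv ℝ φ x (EuclideanSpace.single i (1 : ℝ)) := fun i =>
    (hφ.continuous_fderiv (by norm_num)).clm_apply continuous_const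
  have hφs : ∀ i, HasCompactSupport fun x => fderiv ℝ φ x (EuclideanSpace.single i (1 : ℝ)) :=
    fun i => hc.fderiv_apply ℝ _
  have hint1 : ∀ i, Integrable fun x => (jacobianRows F x).adjugate k i *
      fderiv ℝ φ x (EuclideanSpace.single i 1) := fun i =>
    ((hac i).mul (hφd i)).integrable_of_hasCompactSupport (hφs i).mul_left
  have hint2 : ∀ i, Integrable fun x =>
      fderiv ℝ (fun y => (jacobianRows F y).adjugate k i) x (EuclideanSpace.single i 1) * φ x :=
    fun i => ((((ha i).continuous_fderiv (by norm_num)).clm_apply continuous_const).mul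
      hφ.continuous).integrable_of_hasCompactSupport hc.mul_left
  have hint3 : ∀ i, Integrable fun x => (jacobianRows F x).adjugate k i * φ x := fun i =>
    ((hac i).mul hφ.continuous).integrable_of_hasCompactSupport hc.mul_left
  rw [integral_finsetSum _ fun i _ => hint1 i]
  rw [Finset.sum_congr rfl fun i _ => integral_mul_fderiv_eq_neg_fderiv_mul_of_integrable
    (hint2 i) (hint1 i) (hint3 i) (fun x _ => (ha i).differentiable (by norm_num) x)
    (fun x _ => hφ.differentiable (by norm_num) x)]
  rw [Finset.sum_neg_distrib, ← integral_finsetSum _ fun i _ => hint2 i, neg_eq_zero]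
  refine integral_eq_zero_of_ae (Filter.Eventually.of_forall fun x => ?_)
  simp only [← Finset.sum_mul, fun i => (hD x i).fderiv, hD' x, zero_mul, Pi.zero_apply]

/-- Only first derivatives of `F` enter the identity, so it passes to limits in `C¹`. -/
theorem integral_adjugate_mul_fderiv_of_hasCompactSupport
    {F : EuclideanSpace ℝ (Fin n) → Fin n → ℂ}
    (hF : ContDiff ℝ 1 F) (hFc : HasCompactSupport F) {φ : EuclideanSpace ℝ (Fin n) → ℂ}
    (hφ : ContDiff ℝ 1 φ) (hc : HasCompactSupport φ) (k : Fin n) :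
    ∫ x, ∑ i, (jacobianRows F x).adjugate k i * fderiv ℝ φ x (EuclideanSpace.single i 1) = 0 := by
  choose G hG hGF using fun m : ℕ => exists_contDiff_fderiv_approx hF hFc
    (ε := 1 / ((m : ℝ) + 1)) (by positivity)
  obtain ⟨C, hC⟩ := (hF.continuous_fderiv (by norm_num)).bounded_above_of_compact_support
    (hFc.fderiv ℝ)
  have hG2 : ∀ m, ContDiff ℝ 2 (G m) := fun m => contDiff_infty.mp (hG m) 2
  have hrow : ∀ m x, ‖(fun i => jacobianRows (G m) x i : Fin n → Fin n → ℂ)‖ ≤ |C| + 1 := by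
    intro m x
    refine (pi_norm_le_iff_of_nonneg (by positivity)).mpr fun i => ?_
    refine (ContinuousLinearMap.le_opNorm _ _).trans ?_
    rw [PiLp.norm_single, norm_one, mul_one]
    have h1 := hGF m x
    rw [dist_eq_norm] at h1
    have h2 : 1 / ((m : ℝ) + 1) ≤ 1 := by
      rw [div_le_one (by positivity)]
      linarith [Nat.cast_nonneg (α := ℝ) m]
    have h3 := norm_le_norm_add_norm_sub' (fderiv ℝ (G m) x) (fderiv ℝ F x)
    linarith [hC x, le_abs_self C]
  have hadj : ∀ i, Continuous fun R : Fin n → Fin n → ℂ => (Matrix.of R).adjugate k i := fun i =>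
    (continuous_apply_apply k i).comp (continuous_id.matrix_adjugate (R := ℂ))
  choose B hB using fun i => (isCompact_closedBall (0 : Fin n → Fin n → ℂ)
    (|C| + 1)).exists_bound_of_continuousOn (hadj i).continuousOn
  have hφd : ∀ i, Continuous fun x => fderiv ℝ φ x (EuclideanSpace.single i (1 : ℝ)) := fun i =>
    (hφ.continuous_fderiv (by norm_num)).clm_apply continuous_const
  have hφs : ∀ i, HasCompactSupport fun x => fderiv ℝ φ x (EuclideanSpace.single i (1 : ℝ)) :=
    fun i => hc.fderiv_apply ℝ _
  have hlim := tendsto_integral_of_dominated_convergence (μ := volume)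
    (F := fun m x => ∑ i, (jacobianRows (G m) x).adjugate k i *
      fderiv ℝ φ x (EuclideanSpace.single i 1))
    (f := fun x => ∑ i, (jacobianRows F x).adjugate k i *
      fderiv ℝ φ x (EuclideanSpace.single i 1))
    (fun x => ∑ i, B i * ‖fderiv ℝ φ x (EuclideanSpace.single i (1 : ℝ))‖)
    (fun m => (continuous_finsetSum _ fun i _ => ((hadj i).comp (continuous_jacobianRows
      ((hG2 m).of_le (by norm_num)))).mul (hφd i)).aestronglyMeasurable)
    (integrable_finsetSum _ fun i _ => (((hφd i).norm).integrable_of_hasCompactSupport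
      (hφs i).norm).const_mul _) (fun m => ?_) ?_
  · simp only [integral_adjugate_mul_fderiv_of_contDiff_two (hG2 _) hφ hc k] at hlim
    exact tendsto_nhds_unique hlim tendsto_const_nhds
  · refine Filter.Eventually.of_forall fun x => (norm_sum_le _ _).trans ?_
    refine Finset.sum_le_sum fun i _ => ?_
    rw [norm_mul]
    exact mul_le_mul_of_nonneg_right
      (hB i (fun j => jacobianRows (G m) x j) (mem_closedBall_zero_iff.mpr (hrow m x)))
      (norm_nonneg _)
  · refine Filter.Eventually.of_forall fun x => tendsto_finsetSum _ fun i _ => ?_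
    refine Filter.Tendsto.mul_const _ ?_
    refine ((hadj i).tendsto (jacobianRows F x)).comp ?_
    refine tendsto_pi_nhds.mpr fun j => ?_
    have h0 : Filter.Tendsto (fun m => fderiv ℝ (G m) x) Filter.atTop (𝓝 (fderiv ℝ F x)) :=
      tendsto_iff_dist_tendsto_zero.mpr (squeeze_zero (fun m => dist_nonneg) (fun m => hGF m x)
        tendsto_one_div_add_atTop_nhds_zero_nat)
    exact ((ContinuousLinearMap.apply ℝ (Fin n → ℂ)
      (EuclideanSpace.single j (1 : ℝ))).continuous.tendsto _).comp h0

theorem fderiv_apply_pi {φ : EuclideanSpace ℝ (Fin n) → Fin n → ℂ}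
    {x : EuclideanSpace ℝ (Fin n)} (hφ : DifferentiableAt ℝ φ x) (v : EuclideanSpace ℝ (Fin n))
    (k : Fin n) : fderiv ℝ φ x v k = fderiv ℝ (fun y => φ y k) x v := by
  exact (DFunLike.congr_fun ((ContinuousLinearMap.proj (R := ℝ)
    (φ := fun _ : Fin n => ℂ) k).hasFDerivAt.comp x hφ.hasFDerivAt).fderiv v).symm

theorem integral_trace_adjugate_mul_of_hasCompactSupport
    {F : EuclideanSpace ℝ (Fin n) → Fin n → ℂ}
    (hF : ContDiff ℝ 1 F) (hFc : HasCompactSupport F) {φ : EuclideanSpace ℝ (Fin n) → Fin n → ℂ}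
    (hφ : ContDiff ℝ 1 φ) (hc : HasCompactSupport φ) :
    ∫ x, ((jacobianRows F x).adjugate * jacobianRows φ x).trace = 0 := by
  have hφk : ∀ k, ContDiff ℝ 1 fun x => φ x k := fun k => contDiff_pi.mp hφ k
  have hck : ∀ k, HasCompactSupport fun x => φ x k := fun k =>
    hc.comp_left (g := fun v : Fin n → ℂ => v k) rfl
  have h : ∀ x, ((jacobianRows F x).adjugate * jacobianRows φ x).trace = ∑ k, ∑ i,
      (jacobianRows F x).adjugate k i *
        fderiv ℝ (fun y => φ y k) x (EuclideanSpace.single i 1) := by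
    intro x
    simp only [Matrix.trace, Matrix.diag_apply, Matrix.mul_apply]
    refine Finset.sum_congr rfl fun k _ => Finset.sum_congr rfl fun i _ => ?_
    rw [← fderiv_apply_pi (hφ.differentiable (by norm_num) x)]
    rfl
  simp only [h]
  rw [integral_finsetSum]
  · exact Finset.sum_eq_zero fun k _ =>
      integral_adjugate_mul_fderiv_of_hasCompactSupport hF hFc (hφk k) (hck k) k
  · intro k _
    refine integrable_finsetSum _ fun i _ => ?_
    refine Continuous.integrable_of_hasCompactSupport (.mul ?_ ?_)
      ((hck k).fderiv_apply ℝ _).mul_left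
    · exact (continuous_apply_apply k i).comp (continuous_jacobianRows hF).matrix_adjugate
    · exact ((hφk k).continuous_fderiv (by norm_num)).clm_apply continuous_const

/-- The weak Piola identity: the cofactor fields of a map of class `C¹` are divergence free in the
sense of distributions. -/
theorem integral_trace_adjugate_mul {Ω : Set (EuclideanSpace ℝ (Fin n))} (hΩ : IsOpen Ω)
    {F : EuclideanSpace ℝ (Fin n) → Fin n → ℂ} (hF : ContDiffOn ℝ 1 F Ω)
    {φ : EuclideanSpace ℝ (Fin n) → Fin n → ℂ} (hφ : ContDiff ℝ 1 φ) (hc : HasCompactSupport φ)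
    (hsub : tsupport φ ⊆ Ω) :
    ∫ x, ((jacobianRows F x).adjugate * jacobianRows φ x).trace = 0 := by
  -- `F` may be cut off outside a neighbourhood of the support of `φ`
  obtain ⟨K, hK, hφK, hKΩ⟩ := exists_compact_between hc.isCompact hΩ hsub
  obtain ⟨χ, hχ1, hχ0, -⟩ := exists_contMDiffMap_one_nhds_of_subset_interior
    (I := 𝓘(ℝ, EuclideanSpace ℝ (Fin n))) (n := ⊤) (isClosed_tsupport φ) hφK
  have hχ : ContDiff ℝ ∞ χ := χ.contMDiff.contDiff
  have hχs : tsupport χ ⊆ K := closure_minimal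
    (fun x hx => by_contra fun h => hx (hχ0 x h)) hK.isClosed
  have hcut : ContDiff ℝ 1 fun x => χ x • F x := by
    rw [contDiff_iff_contDiffAt]
    intro x
    by_cases hx : x ∈ Ω
    · exact (hχ.contDiffAt.of_le (by exact_mod_cast le_top)).smul
        (hF.contDiffAt (hΩ.mem_nhds hx))
    · have h : (fun x => χ x • F x) =ᶠ[𝓝 x] fun _ => 0 := by
        filter_upwards [(isClosed_tsupport χ).isOpen_compl.mem_nhds
          (fun h => hx (hKΩ (hχs h)))] with y hy
        rw [image_eq_zero_of_notMem_tsupport hy, zero_smul]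
      exact contDiffAt_const.congr_of_eventuallyEq h
  have hcutc : HasCompactSupport fun x => χ x • F x :=
    HasCompactSupport.intro hK fun x hx => by rw [hχ0 x hx, zero_smul]
  rw [← integral_trace_adjugate_mul_of_hasCompactSupport hcut hcutc hφ hc]
  congr 1
  funext x
  by_cases hx : x ∈ tsupport φ
  · have h : F =ᶠ[𝓝 x] fun x => χ x • F x := by
      filter_upwards [eventually_nhdsSet_iff_forall.mp hχ1 x hx] with y hy
      rw [hy, one_smul]
    simp only [jacobianRows, h.fderiv_eq]
  · have h : fderiv ℝ φ x = 0 := image_eq_zero_of_notMem_tsupport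
      (fun hx' => hx (tsupport_fderiv_subset ℝ hx'))
    have h' : jacobianRows φ x = 0 := by
      ext i k
      simp [jacobianRows, h]
    simp only [h', mul_zero]

end Piola

/-! ### The first variation of volume of the graph of a gradient -/

section FirstVariation

open MeasureTheory ComplexConjugate

variable {n : ℕ}

theorem inner_eq_re_sum_complexCoords (v w : CSpace n) :
    ⟪v, w⟫ = (∑ k, complexCoords n v k * conj (complexCoords n w k)).re := by
  rw [WithLp.prod_inner_apply, PiLp.inner_apply, PiLp.inner_apply, ← Finset.sum_add_distrib,
    Complex.re_sum]
  refine Finset.sum_congr rfl fun j _ => ?_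
  simp [complexCoords]
  ring

theorem onePlusI_mul_conjTranspose {A : Matrix (Fin n) (Fin n) ℝ} (hA : A.IsHermitian) :
    onePlusI A * (onePlusI A).conjTranspose = (1 + A * A).map (fun r : ℝ => (r : ℂ)) := by
  let c : Matrix (Fin n) (Fin n) ℝ →+* Matrix (Fin n) (Fin n) ℂ := Complex.ofRealHom.mapMatrix
  have h1 : (onePlusI A).conjTranspose = 1 - Complex.I • c A := by
    ext i j
    have h := hA.apply i j
    by_cases hij : i = j
    · subst hij
      simp [onePlusI, c]
      ring
    · simp only [star_trivial] at h
      simp [onePlusI, c, hij, Ne.symm hij, h]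
  have h2 : (1 + A * A).map (fun r : ℝ => (r : ℂ)) = 1 + c A * c A := by
    rw [← map_mul, ← map_one c, ← map_add]
    rfl
  rw [h1, h2]
  change (1 + Complex.I • c A) * (1 - Complex.I • c A) = _
  rw [add_mul, one_mul, mul_sub, mul_one, Matrix.smul_mul, Matrix.mul_smul, smul_smul,
    Complex.I_mul_I, neg_smul, one_smul]
  abel

theorem isHermitian_one_add_mul_self {A : Matrix (Fin n) (Fin n) ℝ} (hA : A.IsHermitian) :
    (1 + A * A).IsHermitian := by
  refine Matrix.isHermitian_one.add ?_
  rw [Matrix.IsHermitian, Matrix.conjTranspose_mul, hA]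

theorem det_one_add_mul_self {A : Matrix (Fin n) (Fin n) ℝ} (hA : A.IsHermitian) :
    (1 + A * A).det = ‖(onePlusI A).det‖ ^ 2 := by
  have h := congrArg Matrix.det (onePlusI_mul_conjTranspose hA)
  rw [Matrix.det_mul, Matrix.det_conjTranspose] at h
  have h2 : ((1 + A * A).map (fun r : ℝ => (r : ℂ))).det = (((1 + A * A).det : ℝ) : ℂ) :=
    (RingHom.map_det Complex.ofRealHom _).symm
  rw [h2] at h
  have h3 := Complex.mul_conj' (onePlusI A).det
  have h4 := h.symm.trans h3
  exact_mod_cast h4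

/-- Let `g = 1 + A²` and `M = 1 + iA`. Then `M M* = g` and `det M = e^{iψ} |det M|` with
`ψ = tr arctan A`, hence `|det M| M* g⁻¹ = e^{-iψ} adj M`; this is multiplied by `N`, and the real
part of the trace is taken. -/
theorem sum_inv_mul_re_eq {A : Matrix (Fin n) (Fin n) ℝ} (hA : A.IsHermitian)
    (N : Matrix (Fin n) (Fin n) ℂ) :
    (∑ i, ∑ j, (1 + A * A)⁻¹ i j * (∑ k, N i k * conj (onePlusI A j k)).re) *
        ‖(onePlusI A).det‖ =
      (Complex.exp (-((cfc Real.arctan A).trace * Complex.I)) *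
        ((onePlusI A).adjugate * N).trace).re := by
  obtain ⟨hdet, hne⟩ := det_onePlusI hA
  set M := onePlusI A
  set g := 1 + A * A with hg
  set ψ := (cfc Real.arctan A).trace
  let c : Matrix (Fin n) (Fin n) ℝ →+* Matrix (Fin n) (Fin n) ℂ := Complex.ofRealHom.mapMatrix
  have hM : M * M.conjTranspose = c g := onePlusI_mul_conjTranspose hA
  have hgdet : IsUnit g.det := by
    rw [isUnit_iff_ne_zero, hg, det_one_add_mul_self hA]
    exact pow_ne_zero 2 (norm_ne_zero_iff.mpr hne)
  have hgsymm : g⁻¹.IsHermitian := (isHermitian_one_add_mul_self hA).inv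
  have hMX : M * (M.conjTranspose * c g⁻¹) = 1 := by
    rw [← mul_assoc, hM, ← map_mul, Matrix.mul_nonsing_inv _ hgdet, map_one]
  have hadj : M.adjugate = M.det • (M.conjTranspose * c g⁻¹) := by
    rw [← mul_one M.adjugate, ← hMX, ← mul_assoc, Matrix.adjugate_mul, Matrix.smul_mul, one_mul]
  have htr : ((∑ i, ∑ j, g⁻¹ i j * (∑ k, N i k * conj (M j k)).re : ℝ)) =
      (M.conjTranspose * c g⁻¹ * N).trace.re := by
    rw [mul_assoc, Matrix.trace_mul_comm, mul_assoc, Matrix.trace, Complex.re_sum, Finset.sum_comm]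
    refine Finset.sum_congr rfl fun j _ => ?_
    rw [Matrix.diag_apply, Matrix.mul_apply, Complex.re_sum]
    refine Finset.sum_congr rfl fun i _ => ?_
    have h1 : c g⁻¹ j i = ((g⁻¹ i j : ℝ) : ℂ) := by
      rw [← hgsymm.apply i j]
      rfl
    rw [h1, Complex.re_ofReal_mul]
    rfl
  rw [htr, hadj, Matrix.smul_mul, Matrix.trace_smul, smul_eq_mul, ← mul_assoc]
  conv_rhs => rw [hdet]
  rw [← mul_assoc, ← Complex.exp_add, neg_add_cancel, Complex.exp_zero, one_mul,
    Complex.re_ofReal_mul, mul_comm]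

variable {Ω : TopologicalSpace.Opens (EuclideanSpace ℝ (Fin n))}
  {u : EuclideanSpace ℝ (Fin n) → ℝ}

theorem complexCoords_dmap_coordBasis (hu : ContDiffOn ℝ 2 u Ω) (p : Ω) (i k : Fin n) :
    complexCoords n (tangentCoords (graphMap Ω (gradient u) p)
      (dmap (n := n) (E := CSpace n) (graphMap Ω (gradient u)) p (coordBasis p i))) k =
    onePlusI (hessianMatrix u p) i k := by
  rw [← dmap_coordBasis_graph hu p]
  rfl

theorem gram_graphMap_gradient (hu : ContDiffOn ℝ 2 u Ω) (p : Ω) :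
    gram (n := n) (E := CSpace n) (graphMap Ω (gradient u)) p (coordBasis p) =
      1 + hessianMatrix u p * hessianMatrix u p := by
  have hA := isHermitian_hessianMatrix (hu.contDiffAt (Ω.isOpen.mem_nhds p.2))
  ext i j
  have h1 := congrFun (congrFun (onePlusI_mul_conjTranspose hA) i) j
  rw [gram, Matrix.of_apply, inner_tangentSpace_vectorSpace, inner_eq_re_sum_complexCoords]
  simp only [complexCoords_dmap_coordBasis hu]
  exact congrArg Complex.re h1

theorem sqrt_det_gram_graphMap (hu : ContDiffOn ℝ 2 u Ω) (p : Ω) :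
    √((gram (n := n) (E := CSpace n) (graphMap Ω (gradient u)) p (coordBasis p)).det) =
      ‖(onePlusI (hessianMatrix u p)).det‖ := by
  rw [gram_graphMap_gradient hu, det_one_add_mul_self
    (isHermitian_hessianMatrix (hu.contDiffAt (Ω.isOpen.mem_nhds p.2))),
    Real.sqrt_sq (norm_nonneg _)]

/-- The function `e^{-i tr arctan D²u} tr (adj (1 + i D²u) N)` of the matrix `N` with rows `y i`.
For `y i = ∂ᵢ Y` its real part is the density of the first variation of volume. -/
noncomputable def variationForm (u : EuclideanSpace ℝ (Fin n) → ℝ)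
    (x : EuclideanSpace ℝ (Fin n)) (y : Fin n → CSpace n) : ℂ :=
  Complex.exp (-(trArctan u x * Complex.I)) * ((onePlusI (hessianMatrix u x)).adjugate *
    Matrix.of fun i => complexCoords n (y i)).trace

/-- For `y i = ∂ᵢ Y` the left-hand side is `div_L Y √(det g)`. -/
theorem sum_inverseMetric_mul_inner (hu : ContDiffOn ℝ 2 u Ω) (p : Ω) (y : Fin n → CSpace n) :
    (∑ i : Fin n, ∑ j : Fin n,
      inverseMetric (n := n) (E := CSpace n) (graphMap Ω (gradient u)) p i j *
        ⟪y i, tangentCoords (graphMap Ω (gradient u) p)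
          (dmap (n := n) (E := CSpace n) (graphMap Ω (gradient u)) p (coordBasis p j))⟫) *
      √((gram (n := n) (E := CSpace n) (graphMap Ω (gradient u)) p (coordBasis p)).det) =
    (variationForm u p y).re := by
  have hA := isHermitian_hessianMatrix (hu.contDiffAt (Ω.isOpen.mem_nhds p.2))
  have h := sum_inv_mul_re_eq hA (Matrix.of fun i => complexCoords n (y i))
  rw [sqrt_det_gram_graphMap hu, inverseMetric, gram_graphMap_gradient hu]
  simp only [inner_eq_re_sum_complexCoords, complexCoords_dmap_coordBasis hu]
  exact h

theorem inner_mulI_left (v w : CSpace n) : ⟪mulI n v, w⟫ = -⟪v, mulI n w⟫ := by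
  rw [← inner_mulI v, mulI_mulI, inner_neg_right, neg_neg]

/-- The vector field `J ∇ψ` along the graph of `∇u`, in the coordinates of `ℂⁿ`. -/
noncomputable def mulIGradient (Ω : TopologicalSpace.Opens (EuclideanSpace ℝ (Fin n)))
    (u ψ : EuclideanSpace ℝ (Fin n) → ℝ) (p : Ω) : CSpace n :=
  mulI n (tangentCoords (graphMap Ω (gradient u) p) (inducedGradient (n := n) (E := CSpace n)
    (graphMap Ω (gradient u)) (fun q : Ω => ψ q) p))

/-- The density of `⟪J ∇ψ, y⟫ dvol_L` is that of `-div_L`, with `∂ᵢ ψ J y` in place of `∂ᵢ Y`. -/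
theorem inner_mulIGradient {ψ : EuclideanSpace ℝ (Fin n) → ℝ} (hu : ContDiffOn ℝ 2 u Ω) (p : Ω)
    (hψ : DifferentiableAt ℝ ψ p) (y : CSpace n) :
    ⟪mulIGradient Ω u ψ p, y⟫ *
      √((gram (n := n) (E := CSpace n) (graphMap Ω (gradient u)) p (coordBasis p)).det) =
    -(variationForm u p fun i => fderiv ℝ ψ p (EuclideanSpace.single i 1) • mulI n y).re := by
  have hinv : ∀ i j, inverseMetric (n := n) (E := CSpace n) (graphMap Ω (gradient u)) p i j =
      inverseMetric (n := n) (E := CSpace n) (graphMap Ω (gradient u)) p j i := by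
    have h : (gram (n := n) (E := CSpace n) (graphMap Ω (gradient u)) p
        (coordBasis p)).IsHermitian := by
      rw [gram_graphMap_gradient hu]
      exact isHermitian_one_add_mul_self
        (isHermitian_hessianMatrix (hu.contDiffAt (Ω.isOpen.mem_nhds p.2)))
    intro i j
    exact (h.inv.apply j i)
  rw [← sum_inverseMetric_mul_inner hu, ← neg_mul]
  congr 1
  rw [mulIGradient, inner_mulI_left, inducedGradient]
  simp only [map_sum, map_smul, sum_inner, inner_smul_left, dirDeriv_opens hψ]
  rw [Finset.sum_comm]
  congr 1
  refine Finset.sum_congr rfl fun j _ => Finset.sum_congr rfl fun i _ => ?_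
  rw [hinv j i, real_inner_comm]
  simp [coordBasis]
  ring

end FirstVariation

/-! ### The weak mean curvature vector of the graph of a gradient -/

section WeakMeanCurvature

open MeasureTheory

variable {n : ℕ}

theorem variationForm_sub (u : EuclideanSpace ℝ (Fin n) → ℝ) (x : EuclideanSpace ℝ (Fin n))
    (y z : Fin n → CSpace n) :
    variationForm u x (fun i => y i - z i) = variationForm u x y - variationForm u x z := by
  have h : (Matrix.of fun i => complexCoords n (y i - z i)) =
      (Matrix.of fun i => complexCoords n (y i)) - Matrix.of fun i => complexCoords n (z i) := by
    ext i j
    simp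
  rw [variationForm, h, mul_sub, Matrix.trace_sub, mul_sub]
  rfl

theorem variationForm_zero (u : EuclideanSpace ℝ (Fin n) → ℝ) (x : EuclideanSpace ℝ (Fin n))
    {y : Fin n → CSpace n} (hy : ∀ i, y i = 0) : variationForm u x y = 0 := by
  obtain rfl : y = fun _ => 0 := funext hy
  simpa using variationForm_sub u x (fun _ => 0) (fun _ => 0)

theorem continuous_onePlusI : Continuous (onePlusI (n := n)) :=
  continuous_const.add
    ((continuous_id.matrix_map Complex.continuous_ofReal).const_smul Complex.I)

theorem continuous_complexCoords : Continuous (complexCoords n) := by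
  refine continuous_pi fun j => ?_
  have h1 : Continuous fun w : CSpace n => w.fst j :=
    (EuclideanSpace.proj (𝕜 := ℝ) j).continuous.comp (WithLp.continuous_fst 2 _ _)
  have h2 : Continuous fun w : CSpace n => w.snd j :=
    (EuclideanSpace.proj (𝕜 := ℝ) j).continuous.comp (WithLp.continuous_snd 2 _ _)
  exact (Complex.continuous_ofReal.comp h1).add
    (continuous_const.mul (Complex.continuous_ofReal.comp h2))

/-- Complex coordinates as a continuous linear map. -/
noncomputable def complexCoordsL (n : ℕ) : CSpace n →L[ℝ] (Fin n → ℂ) :=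
  ⟨complexCoords n, continuous_complexCoords⟩

theorem continuous_mulI : Continuous (mulI n) :=
  (toCSpaceL n).continuous.comp
    ((WithLp.continuous_snd 2 _ _).neg.prodMk (WithLp.continuous_fst 2 _ _))

variable {Ω : TopologicalSpace.Opens (EuclideanSpace ℝ (Fin n))}
  {u ψ : EuclideanSpace ℝ (Fin n) → ℝ}

theorem continuousOn_variationForm (hu : ContDiffOn ℝ 2 u Ω)
    {y : Fin n → EuclideanSpace ℝ (Fin n) → CSpace n} (hy : ∀ i, ContinuousOn (y i) Ω) :
    ContinuousOn (fun x => variationForm u x (fun i => y i x)) Ω := by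
  rw [continuousOn_iff_continuous_domRestrict]
  have hA : Continuous fun q : Ω => hessianMatrix u q :=
    continuousOn_iff_continuous_domRestrict.mp (continuousOn_hessianMatrix hu)
  have hN : Continuous fun q : Ω => (Matrix.of fun i => complexCoords n (y i q)) :=
    continuous_pi fun i => (complexCoordsL n).continuous.comp
      (continuousOn_iff_continuous_domRestrict.mp (hy i))
  have hθ := Complex.continuous_ofReal.comp (continuous_trArctan hu)
  exact (Complex.continuous_exp.comp (hθ.mul continuous_const).neg).mul
    (((continuous_onePlusI.comp hA).matrix_adjugate.mul hN).matrix_trace)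

theorem integrableOn_of_continuousOn {V : Type*} [NormedAddCommGroup V]
    {h : EuclideanSpace ℝ (Fin n) → V} (hh : ContinuousOn h Ω) {K : Set (EuclideanSpace ℝ (Fin n))}
    (hK : IsCompact K) (hKΩ : K ⊆ Ω) (h0 : ∀ x ∉ K, h x = 0) : IntegrableOn h Ω :=
  ((hh.mono hKΩ).integrableOn_compact hK).of_forall_sdiff_eq_zero Ω.isOpen.measurableSet
    fun x hx => h0 x hx.2

/-- The graph map in complex coordinates. -/
noncomputable def complexGraph (u : EuclideanSpace ℝ (Fin n) → ℝ) (x : EuclideanSpace ℝ (Fin n)) :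
    Fin n → ℂ := complexCoordsL n (graphFun (gradient u) x)

theorem fderiv_clm_comp_apply {U V W : Type*} [NormedAddCommGroup U] [NormedSpace ℝ U]
    [NormedAddCommGroup V] [NormedSpace ℝ V] [NormedAddCommGroup W] [NormedSpace ℝ W]
    (A : V →L[ℝ] W) {F : U → V} {x : U} (hF : DifferentiableAt ℝ F x) (v : U) :
    fderiv ℝ (fun y => A (F y)) x v = A (fderiv ℝ F x v) :=
  DFunLike.congr_fun (A.hasFDerivAt.comp x hF.hasFDerivAt).fderiv v

theorem jacobianRows_complexGraph (hu : ContDiffOn ℝ 2 u Ω) {x : EuclideanSpace ℝ (Fin n)}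
    (hx : x ∈ Ω) : jacobianRows (complexGraph u) x = onePlusI (hessianMatrix u x) := by
  have hg := (hasFDerivAt_gradient (differentiableAt_fderiv_of_contDiffAt
    (hu.contDiffAt (Ω.isOpen.mem_nhds hx)))).differentiableAt
  rw [← dmap_coordBasis_graph hu ⟨x, hx⟩]
  ext i k
  rw [Matrix.of_apply, tangentCoords_dmap_graphMap hg, ← fderiv_graphFun_apply hg]
  refine (congrFun (fderiv_clm_comp_apply (complexCoordsL n) (differentiableAt_graphFun hg)
    (EuclideanSpace.single i 1)) k).trans ?_
  simp [coordBasis]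
  rfl

theorem contDiffOn_complexGraph (hu : ContDiffOn ℝ 2 u Ω) : ContDiffOn ℝ 1 (complexGraph u) Ω := by
  intro x hx
  have hg : ContDiffAt ℝ 1 (gradient u) x := by
    rw [gradient_eq_dualToVec]
    exact (dualToVec n).contDiff.contDiffAt.comp x
      ((hu.contDiffAt (Ω.isOpen.mem_nhds hx)).fderiv_right (m := 1) (by norm_num))
  exact (ContDiffAt.comp x (g := (complexCoordsL n).comp (toCSpaceL n))
    ((complexCoordsL n).comp (toCSpaceL n)).contDiff.contDiffAt
    (contDiffAt_id.prodMk hg)).contDiffWithinAt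

theorem fderiv_cexp_smul {U V W : Type*} [NormedAddCommGroup U] [NormedSpace ℝ U]
    [NormedAddCommGroup V] [NormedSpace ℝ V] [NormedAddCommGroup W] [NormedSpace ℝ W]
    [NormedSpace ℂ W] [IsScalarTower ℝ ℂ W] (A : V →L[ℝ] W) {f : U → ℝ} {Y : U → V} {x : U}
    (hf : DifferentiableAt ℝ f x) (hY : DifferentiableAt ℝ Y x) (v : U) :
    fderiv ℝ (fun y => Complex.exp (-(f y * Complex.I)) • A (Y y)) x v =
      Complex.exp (-(f x * Complex.I)) •
        (A (fderiv ℝ Y x v) - fderiv ℝ f x v • Complex.I • A (Y x)) := by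
  have h1 : HasFDerivAt (fun y => (f y : ℂ)) (Complex.ofRealCLM.comp (fderiv ℝ f x)) x :=
    Complex.ofRealCLM.hasFDerivAt.comp x hf.hasFDerivAt
  have h2 := (h1.mul_const Complex.I).fun_neg.cexp
  have h3 := h2.smul (A.hasFDerivAt.comp x hY.hasFDerivAt)
  refine (DFunLike.congr_fun h3.fderiv v).trans ?_
  simp only [ContinuousLinearMap.comp_apply, add_apply, smul_apply, neg_apply,
    Complex.ofRealCLM_apply, smul_eq_mul, Function.comp_apply, ContinuousLinearMap.smulRight_apply]
  have hs : ∀ (r : ℝ) (w : W), r • w = (r : ℂ) • w := fun r w => (algebraMap_smul ℂ r w).symm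
  rw [smul_sub, sub_eq_add_neg, hs, smul_smul, smul_smul,
    ← neg_smul]
  congr 2
  ring

/-- The first variation formula for graphs of gradients, in weak form: the Piola identity applied
to `e^{-iψ} Y`. -/
theorem integral_variationForm_eq_zero (hu : ContDiffOn ℝ 2 u Ω) (hψ : ContDiffOn ℝ 1 ψ Ω)
    (hψu : ∀ p : Ω, trArctan u p = ψ p) {Y : EuclideanSpace ℝ (Fin n) → CSpace n}
    (hY : ContDiff ℝ ∞ Y) (hYc : HasCompactSupport Y) (hYΩ : tsupport Y ⊆ Ω) :
    ∫ x in Ω, variationForm u x (fun i => fderiv ℝ Y x (EuclideanSpace.single i 1) -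
      fderiv ℝ ψ x (EuclideanSpace.single i 1) • mulI n (Y x)) = 0 := by
  let φ : EuclideanSpace ℝ (Fin n) → Fin n → ℂ := fun x =>
    Complex.exp (-(ψ x * Complex.I)) • complexCoordsL n (Y x)
  have hY0 : ∀ x ∉ tsupport Y, φ x = 0 := fun x hx => by
    simp [φ, image_eq_zero_of_notMem_tsupport hx]
  have hφs : tsupport φ ⊆ tsupport Y := closure_minimal
    (fun x hx => by_contra fun h => hx (hY0 x h)) (isClosed_tsupport Y)
  have hφc : HasCompactSupport φ := HasCompactSupport.intro hYc.isCompact hY0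
  have hφ : ContDiff ℝ 1 φ := by
    rw [contDiff_iff_contDiffAt]
    intro x
    by_cases hx : x ∈ Ω
    · have h1 : ContDiffAt ℝ 1 (fun x => Complex.exp (-(ψ x * Complex.I))) x :=
        (((Complex.ofRealCLM.contDiff.contDiffAt.comp x
          (hψ.contDiffAt (Ω.isOpen.mem_nhds hx))).mul contDiffAt_const).neg).cexp
      exact h1.smul ((complexCoordsL n).contDiff.contDiffAt.comp x
        (contDiff_infty.mp hY 1).contDiffAt)
    · have h : φ =ᶠ[𝓝 x] fun _ => 0 := by
        filter_upwards [(isClosed_tsupport Y).isOpen_compl.mem_nhds (fun h => hx (hYΩ h))] with y hy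
        exact hY0 y hy
      exact contDiffAt_const.congr_of_eventuallyEq h
  have hzero := integral_trace_adjugate_mul Ω.isOpen (contDiffOn_complexGraph hu) hφ hφc
    (hφs.trans hYΩ)
  rw [← setIntegral_eq_integral_of_forall_compl_eq_zero (s := (Ω : Set _))] at hzero
  · rw [← hzero]
    refine setIntegral_congr_fun Ω.isOpen.measurableSet fun x hx => ?_
    have hJ : jacobianRows φ x = Complex.exp (-(trArctan u x * Complex.I)) •
        Matrix.of fun i => complexCoords n (fderiv ℝ Y x (EuclideanSpace.single i 1) -
          fderiv ℝ ψ x (EuclideanSpace.single i 1) • mulI n (Y x)) := by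
      ext i k
      refine (congrFun (fderiv_cexp_smul (complexCoordsL n)
        ((hψ.contDiffAt (Ω.isOpen.mem_nhds hx)).differentiableAt (by norm_num))
        (hY.differentiable (by norm_num) x) (EuclideanSpace.single i 1)) k).trans ?_
      rw [hψu ⟨x, hx⟩, Matrix.smul_apply, Matrix.of_apply, map_sub, map_smul, complexCoords_mulI]
      rfl
    simp only [variationForm]
    rw [hJ, jacobianRows_complexGraph hu hx, Matrix.mul_smul, Matrix.trace_smul, smul_eq_mul]
  · intro x hx
    have h : fderiv ℝ φ x = 0 := image_eq_zero_of_notMem_tsupport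
      (fun hx' => hx (hYΩ (hφs (tsupport_fderiv_subset ℝ hx'))))
    have h' : jacobianRows φ x = 0 := by
      ext i k
      simp [jacobianRows, h]
    rw [h', mul_zero, Matrix.trace_zero]

theorem setIntegral_re_variationForm (hu : ContDiffOn ℝ 2 u Ω) (hψ : ContDiffOn ℝ 1 ψ Ω)
    (hψu : ∀ p : Ω, trArctan u p = ψ p) {Y : EuclideanSpace ℝ (Fin n) → CSpace n}
    (hY : ContDiff ℝ ∞ Y) (hYc : HasCompactSupport Y) (hYΩ : tsupport Y ⊆ Ω) :
    IntegrableOn (fun x => (variationForm u x (fun i =>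
      fderiv ℝ ψ x (EuclideanSpace.single i 1) • mulI n (Y x))).re) Ω ∧
    ∫ x in Ω, (variationForm u x (fun i => fderiv ℝ Y x (EuclideanSpace.single i 1))).re =
      ∫ x in Ω, (variationForm u x (fun i =>
        fderiv ℝ ψ x (EuclideanSpace.single i 1) • mulI n (Y x))).re := by
  have hc1 : ∀ i : Fin n,
      ContinuousOn (fun x => fderiv ℝ Y x (EuclideanSpace.single i (1 : ℝ))) Ω :=
    fun i => ((hY.continuous_fderiv (by norm_num)).clm_apply continuous_const).continuousOn
  have hc2 : ∀ i : Fin n, ContinuousOn (fun x => fderiv ℝ ψ x (EuclideanSpace.single i (1 : ℝ)) •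
      mulI n (Y x)) Ω := fun i =>
    ((hψ.continuousOn_fderiv_of_isOpen Ω.isOpen (by norm_num)).clm_apply continuousOn_const).smul
      (continuous_mulI.comp hY.continuous).continuousOn
  have hi1 := integrableOn_of_continuousOn (continuousOn_variationForm hu hc1) hYc.isCompact hYΩ
    fun x hx => variationForm_zero u x fun i => by
      rw [image_eq_zero_of_notMem_tsupport (fun hx' => hx (tsupport_fderiv_subset ℝ hx'))]
      rfl
  have hi2 := integrableOn_of_continuousOn (continuousOn_variationForm hu hc2) hYc.isCompact hYΩ
    fun x hx => variationForm_zero u x fun i => by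
      rw [image_eq_zero_of_notMem_tsupport hx, mulI_zero, smul_zero]
  have h := integral_variationForm_eq_zero hu hψ hψu hY hYc hYΩ
  simp only [variationForm_sub] at h
  rw [integral_sub hi1 hi2, sub_eq_zero] at h
  refine ⟨hi2.re, ?_⟩
  have h1 := integral_re hi1
  have h2 := integral_re hi2
  simp only [RCLike.re_eq_complex_re] at h1 h2
  rw [h1, h2, h]

/-- The vector field `J ∇ψ` is a weak mean curvature vector of the graph of `∇u`, where
`ψ = tr arctan D²u`; hence `H` is one if and only if it has the same integrals as `J ∇ψ`. -/
theorem isWeakMeanCurvature_iff_forall_integral (hu : ContDiffOn ℝ 2 u Ω) (hψ : ContDiffOn ℝ 1 ψ Ω)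
    (hψu : ∀ p : Ω, trArctan u p = ψ p) (H : Ω → CSpace n) :
    IsWeakMeanCurvature (graphMap Ω (gradient u)) H ↔
      ∀ Y : EuclideanSpace ℝ (Fin n) → CSpace n, ContDiff ℝ ∞ Y → HasCompactSupport Y →
        tsupport Y ⊆ Ω →
        ∫ p : Ω, ⟪H p, Y p⟫ * ‖(onePlusI (hessianMatrix u p)).det‖
            ∂(volume.comap Subtype.val) =
          ∫ p : Ω, ⟪mulIGradient Ω u ψ p, Y p⟫ * ‖(onePlusI (hessianMatrix u p)).det‖
            ∂(volume.comap Subtype.val) := by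
  refine forall_congr' fun Y => forall_congr' fun hY => forall_congr' fun hYc =>
    forall_congr' fun hYΩ => ?_
  simp only [sum_inverseMetric_mul_inner hu]
  simp only [sqrt_det_gram_graphMap hu]
  have hJ : ∀ p : Ω, ⟪mulIGradient Ω u ψ p, Y p⟫ * ‖(onePlusI (hessianMatrix u p)).det‖ =
      -(variationForm u p fun i =>
        fderiv ℝ ψ p (EuclideanSpace.single i 1) • mulI n (Y p)).re := fun p => by
    rw [← sqrt_det_gram_graphMap hu]
    exact inner_mulIGradient hu p ((hψ.contDiffAt (Ω.isOpen.mem_nhds p.2)).differentiableAt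
      (by norm_num)) _
  simp only [hJ]
  have h := (setIntegral_re_variationForm hu hψ hψu hY hYc hYΩ).2
  rw [← integral_subtype_comap Ω.isOpen.measurableSet,
    ← integral_subtype_comap Ω.isOpen.measurableSet] at h
  rw [integral_neg]
  have key : ∀ a b c : ℝ, a = b → (a = -c ↔ c = -b) := fun a b c hab =>
    ⟨fun h => by linarith, fun h => by linarith⟩
  exact key _ _ _ h

/-- The field `J ∇ψ` is the only continuous weak mean curvature vector: test with the fields `η c`
for a constant vector `c` and a smooth function `η`. -/
theorem isWeakMeanCurvature_iff_eq (hu : ContDiffOn ℝ 2 u Ω) (hψ : ContDiffOn ℝ 1 ψ Ω)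
    (hψu : ∀ p : Ω, trArctan u p = ψ p) {H : Ω → CSpace n} (hH : Continuous H) :
    IsWeakMeanCurvature (graphMap Ω (gradient u)) H ↔ ∀ p, H p = mulIGradient Ω u ψ p := by
  rw [isWeakMeanCurvature_iff_forall_integral hu hψ hψu]
  refine ⟨fun hweak => ?_, fun h Y _ _ _ => by simp only [h]⟩
  let s : EuclideanSpace ℝ (Fin n) → ℝ := fun x => ‖(onePlusI (hessianMatrix u x)).det‖
  have hs0 : ∀ p : Ω, s p ≠ 0 := fun p => norm_ne_zero_iff.mpr
    (det_onePlusI (isHermitian_hessianMatrix (hu.contDiffAt (Ω.isOpen.mem_nhds p.2)))).2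
  have hsc : ContinuousOn s Ω :=
    continuous_onePlusI.matrix_det.norm.comp_continuousOn (continuousOn_hessianMatrix hu)
  -- extensions of `H` and of `⟪H - J ∇ψ, c⟫ √(det g)` to `ℝⁿ`
  let H' : EuclideanSpace ℝ (Fin n) → CSpace n := Function.extend Subtype.val H 0
  have hH' : ∀ p : Ω, H' p = H p := fun p => Subtype.val_injective.extend_apply _ _ _
  have hH'c : ContinuousOn H' Ω := by
    rw [continuousOn_iff_continuous_domRestrict]
    exact hH.congr fun p => (hH' p).symm
  let v : (EuclideanSpace ℝ (Fin n) → CSpace n) → EuclideanSpace ℝ (Fin n) → ℝ := fun Y x =>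
    (variationForm u x (fun i => fderiv ℝ ψ x (EuclideanSpace.single i 1) • mulI n (Y x))).re
  have hvc : ∀ Y, Continuous Y → ContinuousOn (v Y) Ω := fun Y hY =>
    Complex.continuous_re.comp_continuousOn (continuousOn_variationForm hu fun i =>
      ((hψ.continuousOn_fderiv_of_isOpen Ω.isOpen (by norm_num)).clm_apply
        continuousOn_const).smul (continuous_mulI.comp hY).continuousOn)
  have hv : ∀ (Y : EuclideanSpace ℝ (Fin n) → CSpace n) (p : Ω),
      ⟪mulIGradient Ω u ψ p, Y p⟫ * s p = -v Y p := fun Y p => by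
    have h := inner_mulIGradient hu p ((hψ.contDiffAt (Ω.isOpen.mem_nhds p.2)).differentiableAt
      (by norm_num)) (Y p)
    rw [sqrt_det_gram_graphMap hu] at h
    exact h
  let f : CSpace n → EuclideanSpace ℝ (Fin n) → ℝ := fun c x =>
    ⟪H' x, c⟫ * s x + v (fun _ => c) x
  have hfc : ∀ c, ContinuousOn (f c) Ω := fun c =>
    ((hH'c.inner continuousOn_const).mul hsc).add (hvc _ continuous_const)
  have hf : ∀ c (p : Ω), f c p = ⟪H p - mulIGradient Ω u ψ p, c⟫ * s p := by
    intro c p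
    have h := hv (fun _ => c) p
    simp only [f, hH', inner_sub_left, sub_mul, h]
    ring
  have hf0 : ∀ c, ∀ x ∈ Ω, f c x = 0 := by
    intro c
    have hae := Ω.isOpen.ae_eq_zero_of_integral_contDiff_smul_eq_zero (f := f c) (μ := volume)
      ((hfc c).locallyIntegrableOn Ω.isOpen.measurableSet) ?_
    · exact Measure.eqOn_open_of_ae_eq (f := f c) (g := fun _ => 0)
        ((ae_restrict_iff' Ω.isOpen.measurableSet).mpr hae) Ω.isOpen (hfc c) continuousOn_const
    · intro η hη hηc hηΩ
      let Y : EuclideanSpace ℝ (Fin n) → CSpace n := fun x => η x • c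
      have hY : ContDiff ℝ ∞ Y := hη.smul contDiff_const
      have hY0 : ∀ x ∉ tsupport η, Y x = 0 := fun x hx => by
        simp only [Y, image_eq_zero_of_notMem_tsupport hx, zero_smul]
      have hYs : tsupport Y ⊆ tsupport η := closure_minimal
        (fun x hx => by_contra fun h => hx (hY0 x h)) (isClosed_tsupport η)
      have hint1 : IntegrableOn (fun x => ⟪H' x, Y x⟫ * s x) Ω :=
        integrableOn_of_continuousOn ((hH'c.inner hY.continuous.continuousOn).mul hsc)
          hηc.isCompact hηΩ fun x hx => by rw [hY0 x hx, inner_zero_right, zero_mul]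
      have hint2 : IntegrableOn (v Y) Ω :=
        integrableOn_of_continuousOn (hvc Y hY.continuous) hηc.isCompact hηΩ fun x hx => by
          simp only [v, hY0 x hx, mulI_zero, smul_zero]
          rw [variationForm_zero u x fun _ => rfl, Complex.zero_re]
      have h := hweak Y hY (HasCompactSupport.intro hηc.isCompact hY0) (hYs.trans hηΩ)
      have h1 : ∫ p : Ω, ⟪H p, Y p⟫ * s p ∂(volume.comap Subtype.val) =
          ∫ x in Ω, ⟪H' x, Y x⟫ * s x := by
        rw [← integral_subtype_comap Ω.isOpen.measurableSet]
        exact integral_congr_ae (Filter.Eventually.of_forall fun p => by simp only [hH'])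
      have h2 : ∫ p : Ω, ⟪mulIGradient Ω u ψ p, Y p⟫ * s p ∂(volume.comap Subtype.val) =
          -∫ x in Ω, v Y x := by
        rw [← integral_neg, ← integral_subtype_comap Ω.isOpen.measurableSet]
        exact integral_congr_ae (Filter.Eventually.of_forall fun p => hv Y p)
      have h3 : ∫ x in Ω, (⟪H' x, Y x⟫ * s x + v Y x) = 0 := by
        rw [integral_add hint1 hint2]
        linarith [h1.symm.trans (h.trans h2)]
      rw [← setIntegral_eq_integral_of_forall_compl_eq_zero (s := (Ω : Set _)), ← h3]
      · refine setIntegral_congr_fun Ω.isOpen.measurableSet fun x hx => ?_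
        have h4 := hf c ⟨x, hx⟩
        have h5 := hv Y ⟨x, hx⟩
        have h6 := hH' ⟨x, hx⟩
        simp only at h4 h5 h6
        change η x • f c x = _
        rw [h4, h6, smul_eq_mul, ← neg_eq_iff_eq_neg.mpr h5]
        simp only [Y, inner_sub_left, inner_smul_right]
        ring
      · intro x hx
        rw [image_eq_zero_of_notMem_tsupport (fun h => hx (hηΩ h)), zero_smul]
  intro p
  have h := hf0 (H p - mulIGradient Ω u ψ p) p p.2
  rw [hf] at h
  exact sub_eq_zero.mp (inner_self_eq_zero.mp ((mul_eq_zero.mp h).resolve_right (hs0 p)))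

theorem isWeakMeanCurvature_iff (hu : ContDiffOn ℝ 2 u Ω) (hψ : ContDiffOn ℝ 1 ψ Ω)
    (hψu : ∀ p : Ω, trArctan u p = ψ p) {H : Ω → CSpace n} (hH : Continuous H) :
    IsWeakMeanCurvature (graphMap Ω (gradient u)) H ↔
      ∀ p : Ω, inducedGradient (n := n) (E := CSpace n) (graphMap Ω (gradient u))
          (fun q : Ω => ψ q) p =
        -(flatJ n _ ((tangentCoords (graphMap Ω (gradient u) p)).symm (H p))) := by
  rw [isWeakMeanCurvature_iff_eq hu hψ hψu hH]
  refine forall_congr' fun p => ?_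
  rw [mulIGradient]
  set z := graphMap Ω (gradient u) p
  set w := inducedGradient (n := n) (E := CSpace n) (graphMap Ω (gradient u)) (fun q : Ω => ψ q) p
  rw [← (tangentCoords z).injective.eq_iff]
  change _ ↔ tangentCoords z w = -mulI n (H p)
  constructor
  · intro h
    rw [h, mulI_mulI, neg_neg]
  · intro h
    rw [h, ← mulI_mulI (mulI n (H p))]
    simp only [mulI_mulI, neg_neg]

end WeakMeanCurvature
theorem propositionA1 (n : ℕ) (hn : 1 ≤ n) :
    -- Lagrangian submanifolds of Calabi-Yau manifolds
    (∀ (E : Type*) [NormedAddCommGroup E] [NormedSpace ℝ E] [FiniteDimensional ℝ E]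
      (X : Type*) [TopologicalSpace X] [ChartedSpace E X] [IsManifold 𝓘(ℝ, E) ∞ X]
      [Bundle.RiemannianBundle (fun x : X => TangentSpace 𝓘(ℝ, E) x)]
      [IsContMDiffRiemannianBundle 𝓘(ℝ, E) ∞ E (fun x : X => TangentSpace 𝓘(ℝ, E) x)]
      (C : CalabiYau n E X)
      (L : Type*) [TopologicalSpace L] [ChartedSpace (EuclideanSpace ℝ (Fin n)) L]
      [IsManifold (𝓡 n) ∞ L]
      (f : L → X) (_ : ContMDiff (𝓡 n) 𝓘(ℝ, E) 2 f)
      (_ : ∀ p : L, Function.Injective (dmap (n := n) (E := E) f p))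
      (_ : IsLagrangian (n := n) C.J f)
      (o : ∀ p : L, Orientation ℝ (TangentSpace (𝓡 n) p) (Fin n))
      (_ : IsContinuousOrientation o),
      (∃! θ : L → Real.Angle, IsPhase (fun x => ⇑(C.Φ x)) f o θ) ∧
      ∀ θ : L → Real.Angle, IsPhase (fun x => ⇑(C.Φ x)) f o θ →
        ∀ p : L, PhaseGradientFormula (n := n) C.J f θ p) ∧
    -- Lagrangian graphs over open subsets of `ℝⁿ` in `ℂⁿ`
    (∀ (Ω : TopologicalSpace.Opens (EuclideanSpace ℝ (Fin n)))
      (G : EuclideanSpace ℝ (Fin n) → EuclideanSpace ℝ (Fin n)),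
      ContDiffOn ℝ 2 G Ω → IsLagrangian (n := n) (flatJ n) (graphMap Ω G) →
      (∃! θ : Ω → Real.Angle, IsPhase (flatDz n) (graphMap Ω G) (stdOrientation Ω) θ) ∧
      ∀ θ : Ω → Real.Angle, IsPhase (flatDz n) (graphMap Ω G) (stdOrientation Ω) θ →
        ∀ p : Ω, PhaseGradientFormula (n := n) (flatJ n) (graphMap Ω G) θ p) ∧
    -- graphs of gradients of `C²` functions, and the equation `tr arctan D²u = ψ`
    (∀ (Ω : TopologicalSpace.Opens (EuclideanSpace ℝ (Fin n)))
      (u : EuclideanSpace ℝ (Fin n) → ℝ), ContDiffOn ℝ 2 u Ω →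
      (∀ p : Ω, Function.Injective
        (dmap (n := n) (E := CSpace n) (graphMap Ω (gradient u)) p)) ∧
      IsLagrangian (n := n) (flatJ n) (graphMap Ω (gradient u)) ∧
      IsPhase (flatDz n) (graphMap Ω (gradient u)) (stdOrientation Ω)
        (fun p : Ω => ((trArctan u p : ℝ) : Real.Angle)) ∧
      (∀ p : Ω, DifferentiableAt ℝ (fderiv ℝ (fderiv ℝ u)) (p : EuclideanSpace ℝ (Fin n)) →
        MDifferentiableAt (𝓡 n) 𝓘(ℝ, ℝ) (fun q : Ω => trArctan u q) p ∧
        inducedGradient (n := n) (E := CSpace n) (graphMap Ω (gradient u))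
            (fun q : Ω => trArctan u q) p
          = -(flatJ n _ (meanCurvature (n := n) (E := CSpace n) (graphMap Ω (gradient u)) p))) ∧
      ∀ ψ : EuclideanSpace ℝ (Fin n) → ℝ, ContDiffOn ℝ 1 ψ Ω →
        (∀ p : Ω, trArctan u p = ψ p) →
        (∀ p : Ω, DifferentiableAt ℝ (fderiv ℝ (fderiv ℝ u)) (p : EuclideanSpace ℝ (Fin n)) →
          inducedGradient (n := n) (E := CSpace n) (graphMap Ω (gradient u))
              (fun q : Ω => ψ q) p
            = -(flatJ n _
                (meanCurvature (n := n) (E := CSpace n) (graphMap Ω (gradient u)) p))) ∧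
        ∀ H : Ω → CSpace n, Continuous H →
          (IsWeakMeanCurvature (graphMap Ω (gradient u)) H ↔
            ∀ p : Ω, inducedGradient (n := n) (E := CSpace n) (graphMap Ω (gradient u))
                (fun q : Ω => ψ q) p
              = -(flatJ n _ ((tangentCoords (graphMap Ω (gradient u) p)).symm (H p))))) := by
  refine ⟨?_, fun Ω G hG hL => phase_graphMap hn hG hL, ?_⟩
  · intro E _ _ _ X _ _ _ _ _ C L _ _ _ f hf hinj hL o ho
    exact ⟨existsUnique_isPhase C hn hinj hL o, fun θ hθ p =>
      phaseGradientFormula_of_contMDiff C hn hf hinj hL ho hθ⟩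
  · intro Ω u hu
    refine ⟨fun p => injective_dmap_graphMap (hasFDerivAt_gradient
      (differentiableAt_fderiv_of_contDiffAt
        (hu.contDiffAt (Ω.isOpen.mem_nhds p.2)))).differentiableAt,
      isLagrangian_graphMap_gradient hu, isPhase_trArctan hn hu,
      trArctan_gradient_formula hn hu, fun ψ hψ hψu => ⟨fun p hp => ?_, fun H hH =>
        isWeakMeanCurvature_iff hu hψ hψu hH⟩⟩
    have h : (fun q : Ω => ψ q) = fun q : Ω => trArctan u q := funext fun q => (hψu q).symm
    rw [h]
    exact (trArctan_gradient_formula hn hu p hp).2
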